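/- Let $\pi\colon E\to S$ be a smooth real vector bundle of finite rank over a smooth finite-dimensional manifold $S$ (Hausdorff, $\sigma$-compact, without boundary), and let $\Pi$ be a Poisson bivector field on the total space $E$ for which the zero section $S\subset E$ is coisotropic, i.e. $\Pi^{\#}$ maps covectors annihilating $TS$ to vectors tangent to $S$. Let $\mathcal E=\pi^*E\to E$ be the pull back of $E\to S$ along $\pi$, and let $$BFV(E)=\Gamma\big(\textstyle\bigwedge\mathcal E\otimes\bigwedge\mathcal E^*\big),\qquad BFV^{(p,q)}(E)=\Gamma\big(\textstyle\bigwedge^p\mathcal E\otimes\bigwedge^q\mathcal E^*\big),\qquad BFV^k(E)=\bigoplus_{p-q=k}BFV^{(p,q)}(E),$$ a graded commutative algebra. Let $G$ be the graded skew-symmetric biderivation of $BFV(E)$ that extends the natural pairing of $\mathcal E$ with $\mathcal E^*$ and vanishes when one argument lies in $C^\infty(E)$. For a connection $\nabla$ on $E\to S$, denote also by $\nabla$ the induced (dual, exterior, pulled back) connection on $\bigwedge\mathcal E\otimes\bigwedge\mathcal E^*\to E$, and let $\varphi_\nabla(\Pi)$ be the horizontal lift of $\Pi$, i.e. the biderivation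 $(a,b)\mapsto\sum_{i,j}\Pi^{ij}\,\nabla_i a\,\nabla_j b$ of $BFV(E)$, where $\Pi^{ij}$ are the components of $\Pi$ in a local frame. A BFV-bracket for $\nabla$ is a graded Poisson bracket of degree $0$ on $BFV(E)$ of the form $$[\cdot,\cdot]^{\nabla}_{BFV}=G+\varphi_\nabla(\Pi)+\Delta,\qquad \Delta\big(BFV^{(p,q)}(E),BFV^{(p',q')}(E)\big)\subset\bigoplus_{P>p+p',\,Q>q+q'}BFV^{(P,Q)}(E).$$ A BFV-charge for such a bracket is an element $\Omega\in BFV^1(E)$ with $[\Omega,\Omega]^\nabla_{BFV}=0$ whose component in $BFV^{(1,0)}(E)=\Gamma(\mathcal E)$ is the tautological section $e\mapsto e$ of $\mathcal E\to E$. Let $\nabla_0,\nabla_1$ be two connections on $E\to S$, let $[\cdot,\cdot]^{\nabla_0}_{BFV}$ and $[\cdot,\cdot]^{\nabla_1}_{BFV}$ be BFV-brackets for $\nabla_0$ and $\nabla_1$, and let $\Omega_0$ and $\Omega_1$ be BFV-charges for these brackets. Then the differential graded Poisson algebras $$\big(BFV(E),[\Omega_0,\cdot]^{\nabla_0}_{BFV},[\cdot,\cdot]^{\nabla_0}_{BFV}\big)\quad\text{and}\quad\big(BFV(E),[\Omega_1,\cdot]^{\nabla_1}_{BFV},[\cdot,\cdot]^{\nabla_1}_{BFV}\big)$$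 are isomorphic: there is a degree-preserving isomorphism of unital algebras $BFV(E)\to BFV(E)$ that intertwines the brackets and the differentials. -/

import Mathlib

open Bundle
open scoped Manifold ContDiff

noncomputable section

namespace BFV

/-! ### Differential graded Poisson algebras -/

section Algebra

variable {A : Type*} [Ring A] [Algebra ℝ A]

/-- A graded Poisson bracket of degree `0` on an algebra `A` with a `ℤ`-grading `𝒜`. -/
structure GradedPoissonBracket (𝒜 : ℤ → Submodule ℝ A) where
  /-- the bracket -/
  br : A →ₗ[ℝ] A →ₗ[ℝ] A
  br_mem : ∀ {k l : ℤ} {a b : A}, a ∈ 𝒜 k → b ∈ 𝒜 l → br a b ∈ 𝒜 (k + l)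
  skew : ∀ {k l : ℤ} {a b : A}, a ∈ 𝒜 k → b ∈ 𝒜 l →
    br a b = -((-1 : ℝ) ^ (k * l) • br b a)
  leibniz : ∀ {k l : ℤ} {a b : A} (c : A), a ∈ 𝒜 k → b ∈ 𝒜 l →
    br a (b * c) = br a b * c + (-1 : ℝ) ^ (k * l) • (b * br a c)
  jacobi : ∀ {k l : ℤ} {a b : A} (c : A), a ∈ 𝒜 k → b ∈ 𝒜 l →
    br a (br b c) = br (br a b) c + (-1 : ℝ) ^ (k * l) • br b (br a c)

/-- A differential graded Poisson algebra structure on the graded algebra `(A, 𝒜)`: a graded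
Poisson bracket together with a differential of degree `+1` that is a derivation of the product
and of the bracket. -/
structure DGPoissonAlgebra (𝒜 : ℤ → Submodule ℝ A) extends GradedPoissonBracket 𝒜 where
  /-- the differential -/
  d : A →ₗ[ℝ] A
  d_mem : ∀ {k : ℤ} {a : A}, a ∈ 𝒜 k → d a ∈ 𝒜 (k + 1)
  d_d : ∀ a : A, d (d a) = 0
  d_mul : ∀ {k : ℤ} {a : A} (b : A), a ∈ 𝒜 k →
    d (a * b) = d a * b + (-1 : ℝ) ^ k • (a * d b)
  d_br : ∀ {k : ℤ} {a : A} (b : A), a ∈ 𝒜 k →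
    d (br a b) = br (d a) b + (-1 : ℝ) ^ k • br a (d b)

/-- An isomorphism of differential graded Poisson algebras: an isomorphism of unital algebras
that respects the degrees, the brackets and the differentials. -/
structure DGPoissonIso {A' : Type*} [Ring A'] [Algebra ℝ A']
    {𝒜 : ℤ → Submodule ℝ A} {𝒜' : ℤ → Submodule ℝ A'}
    (P : DGPoissonAlgebra 𝒜) (P' : DGPoissonAlgebra 𝒜') where
  /-- the underlying isomorphism of algebras -/
  toAlgEquiv : A ≃ₐ[ℝ] A'
  map_mem_iff : ∀ (k : ℤ) (a : A), toAlgEquiv a ∈ 𝒜' k ↔ a ∈ 𝒜 k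
  map_br : ∀ a b : A, toAlgEquiv (P.br a b) = P'.br (toAlgEquiv a) (toAlgEquiv b)
  map_d : ∀ a : A, toAlgEquiv (P.d a) = P'.d (toAlgEquiv a)

/-- A degree `+1` element `Ω` with `[Ω, Ω] = 0` turns a graded Poisson algebra into a
differential graded one with differential `[Ω, ·]`. -/
def GradedPoissonBracket.withCharge {𝒜 : ℤ → Submodule ℝ A} (P : GradedPoissonBracket 𝒜)
    (Ω : A) (hΩ : Ω ∈ 𝒜 1) (hmc : P.br Ω Ω = 0) : DGPoissonAlgebra 𝒜 where
  toGradedPoissonBracket := P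
  d := P.br Ω
  d_mem {k a} ha := by
    have h := P.br_mem hΩ ha
    rwa [add_comm] at h
  d_d a := by
    have h := P.jacobi a hΩ hΩ
    rw [hmc] at h
    simp only [map_zero, LinearMap.zero_apply, mul_one, zpow_one, zero_add, neg_smul,
      one_smul] at h
    have h2 : (2 : ℝ) • P.br Ω (P.br Ω a) = 0 := by
      rw [two_smul]
      exact add_eq_zero_iff_eq_neg.mpr h
    exact (smul_eq_zero.mp h2).resolve_left two_ne_zero
  d_mul {k a} b ha := by
    have h := P.leibniz b hΩ ha
    rwa [one_mul] at h
  d_br {k a} b ha := by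
    have h := P.jacobi b hΩ ha
    rwa [one_mul] at h

end Algebra

/-! ### The fibre algebra `⋀ W ⊗ ⋀ W* = ⋀ (W ⊕ W*)` -/

section Fibre

variable (W : Type*) [AddCommGroup W] [Module ℝ W]

/-- The algebra `⋀ (W ⊕ W*)`, canonically isomorphic to `⋀ W ⊗ ⋀ W*`. -/
abbrev GhostAlg : Type _ := ExteriorAlgebra ℝ (W × Module.Dual ℝ W)

variable {W}

/-- The inclusion `W → ⋀ (W ⊕ W*)` (ghosts). -/
def ghost : W →ₗ[ℝ] GhostAlg W :=
  ExteriorAlgebra.ι ℝ ∘ₗ LinearMap.inl ℝ W (Module.Dual ℝ W)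

/-- The inclusion `W* → ⋀ (W ⊕ W*)` (ghost momenta). -/
def ghostMomentum : Module.Dual ℝ W →ₗ[ℝ] GhostAlg W :=
  ExteriorAlgebra.ι ℝ ∘ₗ LinearMap.inr ℝ W (Module.Dual ℝ W)

variable (W)

/-- The part `⋀^p W ⊗ ⋀^q W*` of ghost degree `p` and ghost-momentum degree `q`. -/
def bideg (p q : ℕ) : Submodule ℝ (GhostAlg W) :=
  LinearMap.range (ghost (W := W)) ^ p * LinearMap.range (ghostMomentum (W := W)) ^ q

/-- The part of total degree `k`, the sum of the `⋀^p W ⊗ ⋀^q W*` with `p - q = k`. -/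
def totalDeg (k : ℤ) : Submodule ℝ (GhostAlg W) :=
  ⨆ (p : ℕ) (q : ℕ) (_ : (p : ℤ) - q = k), bideg W p q

/-- The sum of the `⋀^P W ⊗ ⋀^Q W*` with `P > p` and `Q > q`. -/
def higher (p q : ℕ) : Submodule ℝ (GhostAlg W) :=
  ⨆ (P : ℕ) (Q : ℕ) (_ : p < P ∧ q < Q), bideg W P Q

variable {W}

/-- The biderivation of `⋀ (W ⊕ W*)` that extends the natural pairing between `W` and `W*`:
in terms of a basis with ghosts `cⁱ` and dual ghost momenta `bᵢ` it is
`∑ᵢ (a ∂/∂cⁱ) (∂/∂bᵢ a') + (a ∂/∂bᵢ) (∂/∂cⁱ a')`, with a right derivative on the first and a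
left derivative on the second argument. It does not depend on the basis. -/
def pairingBracket {ι : Type*} [Fintype ι] (w : Module.Basis ι ℝ W) (a a' : GhostAlg W) :
    GhostAlg W :=
  ∑ i, (CliffordAlgebra.contractRight a (w.coord i ∘ₗ LinearMap.fst ℝ W (Module.Dual ℝ W)) *
        CliffordAlgebra.contractLeft
          (Module.Dual.eval ℝ W (w i) ∘ₗ LinearMap.snd ℝ W (Module.Dual ℝ W)) a' +
      CliffordAlgebra.contractRight a
          (Module.Dual.eval ℝ W (w i) ∘ₗ LinearMap.snd ℝ W (Module.Dual ℝ W)) *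
        CliffordAlgebra.contractLeft (w.coord i ∘ₗ LinearMap.fst ℝ W (Module.Dual ℝ W)) a')

/-- The derivation of `⋀ M` that extends the endomorphism `T` of `M`:
`x ↦ ∑ᵢ T(mᵢ) ∧ (mⁱ ⌟ x)` for a basis `m` of `M` with dual basis `mⁱ`. -/
def derivationExt {M : Type*} [AddCommGroup M] [Module ℝ M] {ι : Type*} [Fintype ι]
    (m : Module.Basis ι ℝ M) (T : M →ₗ[ℝ] M) (x : ExteriorAlgebra ℝ M) : ExteriorAlgebra ℝ M :=
  ∑ i, ExteriorAlgebra.ι ℝ (T (m i)) * CliffordAlgebra.contractLeft (m.coord i) x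

/-- The map `⋀ (W ⊕ W*) → ⋀ (W' ⊕ W'*)` induced by `f : W → W'` and a map `g : W' → W`
(in the applications the inverse of `f`). -/
def ghostMap {W' : Type*} [AddCommGroup W'] [Module ℝ W'] (f : W →ₗ[ℝ] W') (g : W' →ₗ[ℝ] W) :
    GhostAlg W →ₐ[ℝ] GhostAlg W' :=
  ExteriorAlgebra.map (f.prodMap g.dualMap)

variable (W)

/-- A basis of `⋀ (W ⊕ W*)` for finite-dimensional `W`. -/
def ghostBasis [FiniteDimensional ℝ W] :
    Module.Basis (Finset (Fin (Module.finrank ℝ (W × Module.Dual ℝ W)))) ℝ (GhostAlg W) :=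
  (Module.finBasis ℝ (W × Module.Dual ℝ W)).ExteriorAlgebra

end Fibre

/-! ### Poisson bivector fields -/

section Poisson

variable {E : Type*} [NormedAddCommGroup E] [NormedSpace ℝ E] {H : Type*} [TopologicalSpace H]
  (I : ModelWithCorners ℝ E H) (M : Type*) [TopologicalSpace M] [ChartedSpace H M]

/-- A Poisson bivector field `Π` on `M`: a smooth field of alternating bilinear forms on the
cotangent spaces such that `{f, g} = ⟨Π, df ∧ dg⟩` satisfies the Jacobi identity. Smoothness of
the field is expressed by the smoothness of `{f, g}` for all smooth `f`, `g`. -/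
structure PoissonBivector where
  /-- the bilinear form on each cotangent space -/
  toFun : ∀ x : M, (TangentSpace I x →L[ℝ] ℝ) →ₗ[ℝ] (TangentSpace I x →L[ℝ] ℝ) →ₗ[ℝ] ℝ
  alternating : ∀ (x : M) (ξ : TangentSpace I x →L[ℝ] ℝ), toFun x ξ ξ = 0
  smooth : ∀ f g : M → ℝ, ContMDiff I 𝓘(ℝ, ℝ) ∞ f → ContMDiff I 𝓘(ℝ, ℝ) ∞ g →
    ContMDiff I 𝓘(ℝ, ℝ) ∞ (fun x => toFun x (mvfderiv I f x) (mvfderiv I g x))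
  jacobi : ∀ f g h : M → ℝ, ContMDiff I 𝓘(ℝ, ℝ) ∞ f → ContMDiff I 𝓘(ℝ, ℝ) ∞ g →
    ContMDiff I 𝓘(ℝ, ℝ) ∞ h →
    letI br (u v : M → ℝ) : M → ℝ := fun x => toFun x (mvfderiv I u x) (mvfderiv I v x)
    br f (br g h) = br (br f g) h + br g (br f h)

end Poisson

/-! ### The BFV algebra of a vector bundle -/

section Bundle

variable {EB : Type*} [NormedAddCommGroup EB] [NormedSpace ℝ EB]
  {S : Type*} [TopologicalSpace S] [ChartedSpace EB S]
  (F : Type*) [NormedAddCommGroup F] [NormedSpace ℝ F]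
  (V : S → Type*) [TopologicalSpace (TotalSpace F V)]
  [∀ x, AddCommGroup (V x)] [∀ x, Module ℝ (V x)] [∀ x, TopologicalSpace (V x)]
  [FiberBundle F V]

/-- The zero section of `V → S` is a coisotropic submanifold of the total space: `Π^#` maps every
covector that annihilates the tangent space of the zero section to a vector tangent to the zero
section. -/
def IsCoisotropic (P : PoissonBivector (𝓘(ℝ, EB).prod 𝓘(ℝ, F)) (TotalSpace F V)) : Prop :=
  ∀ (x : S) (ξ : TangentSpace (𝓘(ℝ, EB).prod 𝓘(ℝ, F)) (zeroSection F V x) →L[ℝ] ℝ),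
    (∀ v : TangentSpace 𝓘(ℝ, EB) x,
      ξ (mfderiv 𝓘(ℝ, EB) (𝓘(ℝ, EB).prod 𝓘(ℝ, F)) (zeroSection F V) x v) = 0) →
    ∃ v : TangentSpace 𝓘(ℝ, EB) x,
      ∀ η : TangentSpace (𝓘(ℝ, EB).prod 𝓘(ℝ, F)) (zeroSection F V x) →L[ℝ] ℝ,
        P.toFun (zeroSection F V x) ξ η =
          η (mfderiv 𝓘(ℝ, EB) (𝓘(ℝ, EB).prod 𝓘(ℝ, F)) (zeroSection F V) x v)

/-- Not necessarily smooth sections of `⋀ ℰ ⊗ ⋀ ℰ*` over the total space of `V → S`. The fibre at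
`e` of the pull back `ℰ` of `V` to its total space is `V e.proj`. -/
abbrev RawSection : Type _ := ∀ e : TotalSpace F V, GhostAlg (V e.proj)

variable [VectorBundle ℝ F V] {F V}

/-- A section of `⋀ ℰ ⊗ ⋀ ℰ*` read in the trivialization of `V` around `x`. -/
def inTriv (x : S) (a : RawSection F V) (e : TotalSpace F V) : GhostAlg F :=
  ghostMap ((trivializationAt F V x).linearMapAt ℝ e.proj)
    ((trivializationAt F V x).symmₗ ℝ e.proj) (a e)

variable (EB) in
/-- Smoothness of a section of `⋀ ℰ ⊗ ⋀ ℰ*`: in every local trivialization all coordinates, with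
respect to the finite-dimensional vector space `⋀ (F ⊕ F*)`, are smooth functions. -/
def IsSmooth (a : RawSection F V) : Prop :=
  ∀ (x : S) (ℓ : Module.Dual ℝ (GhostAlg F)),
    ContMDiffOn (𝓘(ℝ, EB).prod 𝓘(ℝ, F)) 𝓘(ℝ, ℝ) ∞ (fun e => ℓ (inTriv x a e))
      (TotalSpace.proj ⁻¹' (trivializationAt F V x).baseSet)

variable [FiniteDimensional ℝ F]

theorem IsSmooth.mul {a b : RawSection F V} (ha : IsSmooth EB a) (hb : IsSmooth EB b) :
    IsSmooth EB (a * b) := by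
  intro x ℓ
  have key : ∀ y z : GhostAlg F, ℓ (y * z) =
      ∑ s, ∑ t, ((ghostBasis F).coord s y * (ghostBasis F).coord t z) *
        ℓ (ghostBasis F s * ghostBasis F t) := by
    intro y z
    conv_lhs => rw [← (ghostBasis F).sum_repr y, ← (ghostBasis F).sum_repr z]
    simp only [Finset.sum_mul, Finset.mul_sum, map_sum, smul_mul_assoc, mul_smul_comm, map_smul,
      smul_eq_mul, Module.Basis.coord_apply]
    refine Finset.sum_comm.trans (Finset.sum_congr rfl fun s _ => Finset.sum_congr rfl fun t _ => ?_)
    ring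
  have h : (fun e => ℓ (inTriv x (a * b) e)) = fun e => ∑ s, ∑ t,
      ((ghostBasis F).coord s (inTriv x a e) * (ghostBasis F).coord t (inTriv x b e)) *
        ℓ (ghostBasis F s * ghostBasis F t) := by
    funext e
    rw [← key]
    simp only [inTriv, Pi.mul_apply, map_mul]
  rw [h]
  refine contMDiffOn_finsetSum fun s _ => contMDiffOn_finsetSum fun t _ => ?_
  exact ((ha x _).mul (hb x _)).mul contMDiffOn_const

variable (EB F V) in
/-- The smooth sections of `⋀ ℰ ⊗ ⋀ ℰ*` as a subalgebra of all sections. -/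
def smoothSections : Subalgebra ℝ (RawSection F V) where
  carrier := {a | IsSmooth EB a}
  mul_mem' ha hb := ha.mul hb
  add_mem' {a b} ha hb := by
    intro x ℓ
    have h : (fun e => ℓ (inTriv x (a + b) e)) =
        fun e => ℓ (inTriv x a e) + ℓ (inTriv x b e) := by
      funext e
      simp only [inTriv, Pi.add_apply, map_add]
    rw [h]
    exact (ha x ℓ).add (hb x ℓ)
  algebraMap_mem' r := by
    intro x ℓ
    have h : (fun e => ℓ (inTriv x (algebraMap ℝ (RawSection F V) r) e)) =
        fun _ => ℓ (algebraMap ℝ (GhostAlg F) r) := by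
      funext e
      simp only [inTriv, Pi.algebraMap_apply, AlgHom.commutes]
    rw [h]
    exact contMDiffOn_const

variable (EB F V) in
/-- The algebra `BFV(E) = Γ(⋀ ℰ ⊗ ⋀ ℰ*)` of smooth sections. -/
def BFVAlg : Type _ := smoothSections EB F V

instance instRingBFVAlg : Ring (BFVAlg EB F V) := Subalgebra.toRing (smoothSections EB F V)

instance instAlgebraBFVAlg : Algebra ℝ (BFVAlg EB F V) :=
  Subalgebra.algebra (smoothSections EB F V)

variable (EB F V) in
/-- `BFV^{(p,q)}(E) = Γ(⋀^p ℰ ⊗ ⋀^q ℰ*)`. -/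
def bfvBideg (p q : ℕ) : Submodule ℝ (BFVAlg EB F V) where
  carrier := {a | ∀ e, a.1 e ∈ bideg (V e.proj) p q}
  add_mem' ha hb e := Submodule.add_mem _ (ha e) (hb e)
  zero_mem' _ := Submodule.zero_mem _
  smul_mem' r _ ha e := Submodule.smul_mem _ r (ha e)

variable (EB F V) in
/-- `BFV^k(E)`, the part of total degree `k`. -/
def bfvDeg (k : ℤ) : Submodule ℝ (BFVAlg EB F V) where
  carrier := {a | ∀ e, a.1 e ∈ totalDeg (V e.proj) k}
  add_mem' ha hb e := Submodule.add_mem _ (ha e) (hb e)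
  zero_mem' _ := Submodule.zero_mem _
  smul_mem' r _ ha e := Submodule.smul_mem _ r (ha e)

variable (F V) in
/-- A basis of the fibre of `V` at `x`. -/
def fibreBasis (x : S) : Module.Basis (Fin (Module.finrank ℝ F)) ℝ (V x) :=
  (Module.finBasis ℝ F).map ((trivializationAt F V x).linearEquivAt ℝ x
    (FiberBundle.mem_baseSet_trivializationAt F V x)).symm

/-- The biderivation `G` given by the fibre pairing between `ℰ` and `ℰ*`. -/
def fibrePairing (a b : RawSection F V) : RawSection F V :=
  fun e => pairingBracket (fibreBasis F V e.proj) (a e) (b e)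

variable [∀ x, IsTopologicalAddGroup (V x)] [∀ x, ContinuousSMul ℝ (V x)]

/-- The connection form at `x` of a connection on `V` in the trivialization around `x`, evaluated
on the tangent vector `X`: it maps `f ∈ F` to `∇_X` of the local section that is constantly `f`. -/
def connectionForm (cov : CovariantDerivative 𝓘(ℝ, EB) F V) (x : S)
    (X : TangentSpace 𝓘(ℝ, EB) x) : F →ₗ[ℝ] F :=
  (Module.finBasis ℝ F).constr ℝ fun i =>
    (trivializationAt F V x).linearMapAt ℝ x
      (cov.toFun (fun y => (trivializationAt F V x).symmₗ ℝ y (Module.finBasis ℝ F i)) x X)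

/-- The connection on `⋀ ℰ ⊗ ⋀ ℰ*` induced by a connection on `V`: the covariant derivative of
the section `a` at `e` in the direction of a tangent vector `Y` of the total space. In the
trivialization around the base point of `e` it is `Y(a) + A(dπ Y) · a`, where the connection form
`A` acts on `⋀ (F ⊕ F*)` by the derivation that extends `A` on `F` and `-Aᵗ` on `F*`. -/
def nabla (cov : CovariantDerivative 𝓘(ℝ, EB) F V) (a : RawSection F V) (e : TotalSpace F V)
    (Y : TangentSpace (𝓘(ℝ, EB).prod 𝓘(ℝ, F)) e) : GhostAlg (V e.proj) :=
  letI A : F →ₗ[ℝ] F := connectionForm cov e.proj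
    (mfderiv (𝓘(ℝ, EB).prod 𝓘(ℝ, F)) 𝓘(ℝ, EB) (TotalSpace.proj : TotalSpace F V → S) e Y)
  ghostMap ((trivializationAt F V e.proj).symmₗ ℝ e.proj)
    ((trivializationAt F V e.proj).linearMapAt ℝ e.proj)
    ((∑ s, mvfderiv (𝓘(ℝ, EB).prod 𝓘(ℝ, F))
        (fun e' => (ghostBasis F).coord s (inTriv e.proj a e')) e Y • ghostBasis F s) +
      derivationExt (Module.finBasis ℝ (F × Module.Dual ℝ F)) (A.prodMap (-A.dualMap))
        (inTriv e.proj a e))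

variable [FiniteDimensional ℝ EB]

/-- A basis of the tangent space of the total space at `e`. -/
def tangentBasis (e : TotalSpace F V) :
    Module.Basis (Fin (Module.finrank ℝ (EB × F))) ℝ
      (TangentSpace (𝓘(ℝ, EB).prod 𝓘(ℝ, F)) e) :=
  (Module.finBasis ℝ (EB × F) : Module.Basis (Fin (Module.finrank ℝ (EB × F))) ℝ (EB × F))

/-- The dual basis of the cotangent space. -/
def cotangentBasis (e : TotalSpace F V) (i : Fin (Module.finrank ℝ (EB × F))) :
    TangentSpace (𝓘(ℝ, EB).prod 𝓘(ℝ, F)) e →L[ℝ] ℝ :=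
  (LinearMap.toContinuousLinearMap ((Module.finBasis ℝ (EB × F)).coord i) : EB × F →L[ℝ] ℝ)

/-- The biderivation `φ(Π)` given by the horizontal lift of the bivector field `Π` on the total
space: `(a, b) ↦ ∑ᵢⱼ Πⁱʲ ∇ᵢ a ∇ⱼ b`. -/
def horizontalLift (cov : CovariantDerivative 𝓘(ℝ, EB) F V)
    (P : PoissonBivector (𝓘(ℝ, EB).prod 𝓘(ℝ, F)) (TotalSpace F V))
    (a b : RawSection F V) : RawSection F V :=
  fun e => ∑ i, ∑ j, P.toFun e (cotangentBasis e i) (cotangentBasis e j) •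
    (nabla cov a e (tangentBasis e i) * nabla cov b e (tangentBasis e j))

/-- `B` is a BFV-bracket for the Poisson bivector field `Π` and the connection `∇`: as a bivector
field it is `G + φ(Π) + Δ`, where `Δ` maps functions of total bidegree `(p, q)` to sums of
functions of bidegrees `(P, Q)` with `P > p` and `Q > q`. -/
def IsBFVBracket (cov : CovariantDerivative 𝓘(ℝ, EB) F V)
    (P : PoissonBivector (𝓘(ℝ, EB).prod 𝓘(ℝ, F)) (TotalSpace F V))
    (B : GradedPoissonBracket (bfvDeg EB F V)) : Prop :=
  ∀ (p q p' q' : ℕ), ∀ a ∈ bfvBideg EB F V p q, ∀ b ∈ bfvBideg EB F V p' q',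
    ∀ e : TotalSpace F V,
      (B.br a b).1 e - fibrePairing a.1 b.1 e - horizontalLift cov P a.1 b.1 e ∈
        higher (V e.proj) (p + p') (q + q')

/-- BFV-charges: degree `+1` elements `Ω` with `[Ω, Ω] = 0` whose component in
`BFV^{(1,0)}(E) = Γ(ℰ)` is the tautological section `e ↦ e` of `ℰ`, the other components having
bidegrees `(k + 1, k)` with `k ≥ 1`. -/
structure IsBFVCharge (B : GradedPoissonBracket (bfvDeg EB F V)) (Ω : BFVAlg EB F V) : Prop where
  mem : Ω ∈ bfvDeg EB F V 1
  mc : B.br Ω Ω = 0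
  lowest : ∀ e : TotalSpace F V, Ω.1 e - ghost e.2 ∈ higher (V e.proj) 1 0

/-- The differential graded Poisson algebra `(BFV(E), [Ω, ·], [·, ·])`. -/
def bfvComplex (B : GradedPoissonBracket (bfvDeg EB F V)) (Ω : BFVAlg EB F V)
    (hΩ : IsBFVCharge B Ω) : DGPoissonAlgebra (bfvDeg EB F V) :=
  B.withCharge Ω hΩ.mem hΩ.mc

end Bundle

end BFV

end

noncomputable section

namespace BFV

/-! ### Weight decompositions -/

section Weight

variable {A : Type*} [Ring A] [Algebra ℝ A]

/-- A finite weight decomposition of a graded commutative algebra that is compatible with the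
grading `𝒜` by degree. -/
structure WeightDecomposition (𝒜 : ℤ → Submodule ℝ A) where
  /-- the part of weight `n` -/
  W : ℤ → Submodule ℝ A
  /-- the projection to the part of weight `n` -/
  proj : ℤ → A →ₗ[ℝ] A
  /-- an upper bound for the weights -/
  top : ℤ
  proj_mem : ∀ n a, proj n a ∈ W n
  proj_of_mem : ∀ {n a}, a ∈ W n → proj n a = a
  proj_of_ne : ∀ {n m a}, a ∈ W n → m ≠ n → proj m a = 0
  sum_proj : ∀ a, ∑ n ∈ Finset.Icc 0 top, proj n a = a
  proj_deg : ∀ {k a} n, a ∈ 𝒜 k → proj n a ∈ 𝒜 k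
  mul_mem : ∀ {n m a b}, a ∈ W n → b ∈ W m → a * b ∈ W (n + m)
  deg_mul_mem : ∀ {k l a b}, a ∈ 𝒜 k → b ∈ 𝒜 l → a * b ∈ 𝒜 (k + l)
  iSup_deg : ⨆ k, 𝒜 k = ⊤
  zero_le : W 0 ≤ 𝒜 0
  mul_comm : ∀ {k l a b}, a ∈ 𝒜 k → b ∈ 𝒜 l → a * b = (-1 : ℝ) ^ (k * l) • (b * a)

namespace WeightDecomposition

variable {𝒜 : ℤ → Submodule ℝ A} (w : WeightDecomposition 𝒜)

theorem eq_zero_of_notMem {n : ℤ} {a : A} (ha : a ∈ w.W n) (hn : n ∉ Finset.Icc 0 w.top) :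
    a = 0 := by
  rw [← w.sum_proj a]
  exact Finset.sum_eq_zero fun m hm => w.proj_of_ne ha fun h => hn (h ▸ hm)

theorem eq_zero_of_neg {n : ℤ} {a : A} (ha : a ∈ w.W n) (hn : n < 0) : a = 0 :=
  w.eq_zero_of_notMem ha fun h => by
    have := (Finset.mem_Icc.1 h).1
    omega

theorem proj_eq_zero_of_notMem {n : ℤ} (a : A) (hn : n ∉ Finset.Icc 0 w.top) :
    w.proj n a = 0 := w.eq_zero_of_notMem (w.proj_mem n a) hn

theorem central {f : A} (hf : f ∈ w.W 0) (a : A) : f * a = a * f := by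
  have : a ∈ ⨆ k, 𝒜 k := w.iSup_deg ▸ Submodule.mem_top
  induction this using Submodule.iSup_induction' with
  | mem k a ha =>
    rw [w.mul_comm (w.zero_le hf) ha]
    simp
  | zero => simp
  | add a b _ _ ha hb => rw [mul_add, add_mul, ha, hb]

/-- The elements of weight at least `n`. -/
def F (n : ℤ) : Submodule ℝ A where
  carrier := {a | ∀ m < n, w.proj m a = 0}
  add_mem' ha hb m hm := by rw [map_add, ha m hm, hb m hm, add_zero]
  zero_mem' _ _ := map_zero _
  smul_mem' r a ha m hm := by rw [map_smul, ha m hm, smul_zero]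

theorem W_le_F {n m : ℤ} (h : m ≤ n) : w.W n ≤ w.F m := fun _ ha l hl =>
  w.proj_of_ne ha (by omega)

theorem F_anti {n m : ℤ} (h : m ≤ n) : w.F n ≤ w.F m := fun _ ha l hl => ha l (by omega)

theorem mem_F_of_le {n m : ℤ} {a : A} (ha : a ∈ w.F n) (h : m ≤ n) : a ∈ w.F m := w.F_anti h ha

theorem mem_F_of_nonpos {n : ℤ} (h : n ≤ 0) (a : A) : a ∈ w.F n := fun m hm =>
  w.proj_eq_zero_of_notMem a fun h' => by
    have := (Finset.mem_Icc.1 h').1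
    omega

theorem eq_zero_of_mem_F {n : ℤ} {a : A} (ha : a ∈ w.F n) (hn : w.top < n) : a = 0 := by
  rw [← w.sum_proj a]
  exact Finset.sum_eq_zero fun m hm => ha m (by have := (Finset.mem_Icc.1 hm).2; omega)

theorem eq_zero_of_mem_W_of_mem_F {n m : ℤ} {a : A} (ha : a ∈ w.W n) (ha' : a ∈ w.F m)
    (h : n < m) : a = 0 := by
  rw [← w.proj_of_mem ha, ha' n h]

theorem sub_proj_mem {n : ℤ} {a : A} (ha : a ∈ w.F n) : a - w.proj n a ∈ w.F (n + 1) := by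
  intro m hm
  rw [map_sub]
  rcases eq_or_ne m n with rfl | h
  · rw [w.proj_of_mem (w.proj_mem m a), sub_self]
  · rw [ha m (by omega), w.proj_of_ne (w.proj_mem n a) h, sub_self]

theorem induction {p : A → Prop} (add : ∀ a b, p a → p b → p (a + b))
    (hom : ∀ k n a, a ∈ 𝒜 k → a ∈ w.W n → p a) (a : A) : p a := by
  have h0 : p 0 := hom 0 0 0 (Submodule.zero_mem _) (Submodule.zero_mem _)
  have : a ∈ ⨆ k, 𝒜 k := w.iSup_deg ▸ Submodule.mem_top
  induction this using Submodule.iSup_induction' with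
  | mem k a ha =>
    rw [← w.sum_proj a]
    exact Finset.sum_induction _ p add h0 fun n _ =>
      hom k n _ (w.proj_deg n ha) (w.proj_mem n a)
  | zero => exact h0
  | add a b _ _ ha hb => exact add a b ha hb

theorem induction_deg {k : ℤ} {p : A → Prop} (add : ∀ a b, p a → p b → p (a + b))
    (hom : ∀ n a, a ∈ 𝒜 k → a ∈ w.W n → p a) {a : A} (ha : a ∈ 𝒜 k) : p a := by
  rw [← w.sum_proj a]
  exact Finset.sum_induction _ p add (hom 0 0 (Submodule.zero_mem _) (Submodule.zero_mem _))
    fun n _ => hom n _ (w.proj_deg n ha) (w.proj_mem n a)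

theorem induction_W {n : ℤ} {p : A → Prop} (add : ∀ a b, p a → p b → p (a + b))
    (hom : ∀ k a, a ∈ 𝒜 k → a ∈ w.W n → p a) {a : A} (ha : a ∈ w.W n) : p a := by
  have h0 : p 0 := hom 0 0 (Submodule.zero_mem _) (Submodule.zero_mem _)
  rw [← w.proj_of_mem ha]
  refine w.induction (p := fun a => p (w.proj n a)) (fun a b ha hb => ?_)
    (fun k m a hk _ => hom k _ (w.proj_deg n hk) (w.proj_mem n a)) a
  rw [map_add]
  exact add _ _ ha hb

theorem induction_F {n : ℤ} {p : A → Prop} (add : ∀ a b, p a → p b → p (a + b))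
    (hom : ∀ k m a, n ≤ m → a ∈ 𝒜 k → a ∈ w.W m → p a) {a : A} (ha : a ∈ w.F n) : p a := by
  have h0 : p 0 := hom 0 n 0 le_rfl (Submodule.zero_mem _) (Submodule.zero_mem _)
  rw [← w.sum_proj a]
  refine Finset.sum_induction _ p add h0 fun m _ => ?_
  rcases lt_or_ge m n with h | h
  · rw [ha m h]
    exact h0
  · exact w.induction_W add (fun k a => hom k m a h) (w.proj_mem m a)

theorem bilin_ext {D D' : A →ₗ[ℝ] A →ₗ[ℝ] A}
    (h : ∀ k l n m a b, a ∈ 𝒜 k → a ∈ w.W n → b ∈ 𝒜 l → b ∈ w.W m → D a b = D' a b) :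
    D = D' := by
  ext a b
  refine w.induction (p := fun a => D a b = D' a b) (fun a a' ha ha' => ?_)
    (fun k n a hk hn => ?_) a
  · simp only [map_add, LinearMap.add_apply, ha, ha']
  · refine w.induction (p := fun b => D a b = D' a b) (fun b b' hb hb' => ?_)
      (fun l m b hl hm => h k l n m a b hk hn hl hm) b
    simp only [map_add, hb, hb']

theorem proj_mul {n m : ℤ} (x : A) {c : A} (hc : c ∈ w.W m) :
    w.proj (n + m) (x * c) = w.proj n x * c := by
  refine w.induction (p := fun x => w.proj (n + m) (x * c) = w.proj n x * c)
    (fun a b ha hb => by simp only [add_mul, map_add, ha, hb]) (fun k i a _ ha => ?_) x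
  rcases eq_or_ne i n with rfl | h
  · rw [w.proj_of_mem ha, w.proj_of_mem (w.mul_mem ha hc)]
  · rw [w.proj_of_ne ha h.symm, w.proj_of_ne (w.mul_mem ha hc) (by omega), zero_mul]

theorem proj_mul' {n m : ℤ} (x : A) {c : A} (hc : c ∈ w.W m) :
    w.proj (m + n) (c * x) = c * w.proj n x := by
  refine w.induction (p := fun x => w.proj (m + n) (c * x) = c * w.proj n x)
    (fun a b ha hb => by simp only [mul_add, map_add, ha, hb]) (fun k i a _ ha => ?_) x
  rcases eq_or_ne i n with rfl | h
  · rw [w.proj_of_mem ha, w.proj_of_mem (w.mul_mem hc ha)]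
  · rw [w.proj_of_ne ha h.symm, w.proj_of_ne (w.mul_mem hc ha) (by omega), mul_zero]

/-- `D` raises weights by at least `j`. -/
def Shift (D : A →ₗ[ℝ] A →ₗ[ℝ] A) (j : ℤ) : Prop :=
  ∀ n m a b, a ∈ w.F n → b ∈ w.F m → D a b ∈ w.F (n + m + j)

variable {w}

theorem Shift.of_hom {D : A →ₗ[ℝ] A →ₗ[ℝ] A} {j : ℤ}
    (h : ∀ k l n m a b, a ∈ 𝒜 k → a ∈ w.W n → b ∈ 𝒜 l → b ∈ w.W m →
      D a b ∈ w.F (n + m + j)) : w.Shift D j := by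
  intro n m a b ha hb
  refine w.induction_F (p := fun a => D a b ∈ w.F (n + m + j)) (fun a a' h h' => ?_)
    (fun k i a hi hk ha => ?_) ha
  · rw [map_add]
    exact Submodule.add_mem _ h h'
  · refine w.induction_F (p := fun b => D a b ∈ w.F (n + m + j)) (fun a a' h h' => ?_)
      (fun l i' b hi' hl hb => ?_) hb
    · rw [map_add]
      exact Submodule.add_mem _ h h'
    · exact w.mem_F_of_le (h k l i i' a b hk ha hl hb) (by omega)

theorem Shift.sub {D D' : A →ₗ[ℝ] A →ₗ[ℝ] A} {j : ℤ} (h : w.Shift D j) (h' : w.Shift D' j) :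
    w.Shift (D - D') j := fun n m a b ha hb =>
  Submodule.sub_mem _ (h n m a b ha hb) (h' n m a b ha hb)

theorem Shift.mono {D : A →ₗ[ℝ] A →ₗ[ℝ] A} {i j : ℤ} (h : w.Shift D j) (hij : i ≤ j) :
    w.Shift D i := fun n m a b ha hb => w.mem_F_of_le (h n m a b ha hb) (by omega)

theorem Shift.eq_zero {D : A →ₗ[ℝ] A →ₗ[ℝ] A} {j : ℤ} (h : w.Shift D j) (hj : w.top < j) :
    D = 0 := by
  ext a b
  exact w.eq_zero_of_mem_F (h 0 0 a b (w.mem_F_of_nonpos le_rfl a) (w.mem_F_of_nonpos le_rfl b))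
    (by omega)

variable (w)

/-- The part of `D` that raises weights by exactly `j`. -/
def lead (D : A →ₗ[ℝ] A →ₗ[ℝ] A) (j : ℤ) : A →ₗ[ℝ] A →ₗ[ℝ] A :=
  ∑ n ∈ Finset.Icc 0 w.top, ∑ m ∈ Finset.Icc 0 w.top,
    (D.compl₁₂ (w.proj n) (w.proj m)).compr₂ (w.proj (n + m + j))

variable {w}

theorem lead_apply (D : A →ₗ[ℝ] A →ₗ[ℝ] A) (j : ℤ) {n m : ℤ} {a b : A} (ha : a ∈ w.W n)
    (hb : b ∈ w.W m) : w.lead D j a b = w.proj (n + m + j) (D a b) := by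
  by_cases hn : n ∈ Finset.Icc 0 w.top
  swap
  · simp [w.eq_zero_of_notMem ha hn]
  by_cases hm : m ∈ Finset.Icc 0 w.top
  swap
  · simp [w.eq_zero_of_notMem hb hm]
  simp only [lead, LinearMap.sum_apply, LinearMap.compr₂_apply, LinearMap.compl₁₂_apply]
  rw [Finset.sum_eq_single n, Finset.sum_eq_single m, w.proj_of_mem ha, w.proj_of_mem hb]
  · intro i _ hi
    simp [w.proj_of_ne hb hi]
  · exact fun h => absurd hm h
  · intro i _ hi
    simp [w.proj_of_ne ha hi]
  · exact fun h => absurd hn h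

theorem lead_mem (D : A →ₗ[ℝ] A →ₗ[ℝ] A) (j : ℤ) {n m : ℤ} {a b : A} (ha : a ∈ w.W n)
    (hb : b ∈ w.W m) : w.lead D j a b ∈ w.W (n + m + j) := by
  rw [lead_apply D j ha hb]
  exact w.proj_mem _ _

theorem Shift.sub_lead {D : A →ₗ[ℝ] A →ₗ[ℝ] A} {j : ℤ} (h : w.Shift D j) :
    w.Shift (D - w.lead D j) (j + 1) := Shift.of_hom fun k l n m a b _ ha _ hb => by
  rw [LinearMap.sub_apply, LinearMap.sub_apply, lead_apply D j ha hb, ← add_assoc]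
  exact w.sub_proj_mem (h n m a b (w.W_le_F le_rfl ha) (w.W_le_F le_rfl hb))

theorem shift_lead (D : A →ₗ[ℝ] A →ₗ[ℝ] A) (j : ℤ) : w.Shift (w.lead D j) j :=
  Shift.of_hom fun _ _ _ _ _ _ _ ha _ hb => w.W_le_F le_rfl (lead_mem D j ha hb)

theorem lead_congr {D D' : A →ₗ[ℝ] A →ₗ[ℝ] A} {j : ℤ} (h : w.Shift (D - D') (j + 1)) :
    w.lead D j = w.lead D' j := w.bilin_ext fun k l n m a b _ ha _ hb => by
  rw [lead_apply D j ha hb, lead_apply D' j ha hb, ← sub_eq_zero, ← map_sub]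
  exact h n m a b (w.W_le_F le_rfl ha) (w.W_le_F le_rfl hb) _ (by omega)

end WeightDecomposition

end Weight

/-! ### Biderivations and mixed Jacobi identities -/

section Signs

theorem sign_mul_self (k : ℤ) : (-1 : ℝ) ^ k * (-1 : ℝ) ^ k = 1 := by
  rw [← mul_zpow]
  norm_num

theorem sign_add (k l : ℤ) : (-1 : ℝ) ^ (k + l) = (-1 : ℝ) ^ k * (-1 : ℝ) ^ l :=
  zpow_add₀ (by norm_num) k l

theorem sign_neg (k : ℤ) : (-1 : ℝ) ^ (-k) = (-1 : ℝ) ^ k := by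
  rw [zpow_neg, ← inv_zpow]
  norm_num

theorem sign_odd_mul {κ : ℤ} (hκ : κ = 1 ∨ κ = -1) (k : ℤ) : (-1 : ℝ) ^ (κ * k) = (-1 : ℝ) ^ k := by
  rcases hκ with rfl | rfl
  · rw [one_mul]
  · rw [neg_one_mul, sign_neg]

theorem sign_mul_odd {κ : ℤ} (hκ : κ = 1 ∨ κ = -1) (k : ℤ) : (-1 : ℝ) ^ (k * κ) = (-1 : ℝ) ^ k := by
  rw [mul_comm, sign_odd_mul hκ]

theorem sign_odd {κ : ℤ} (hκ : κ = 1 ∨ κ = -1) : (-1 : ℝ) ^ κ = -1 := by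
  rcases hκ with rfl | rfl <;> norm_num

end Signs

section Biderivation

variable {A : Type*} [Ring A] [Algebra ℝ A]

/-- Graded skew-symmetric biderivations of degree `0`. -/
structure IsBiderivation (𝒜 : ℤ → Submodule ℝ A) (D : A →ₗ[ℝ] A →ₗ[ℝ] A) : Prop where
  mem : ∀ {k l : ℤ} {a b : A}, a ∈ 𝒜 k → b ∈ 𝒜 l → D a b ∈ 𝒜 (k + l)
  skew : ∀ {k l : ℤ} {a b : A}, a ∈ 𝒜 k → b ∈ 𝒜 l →
    D a b = -((-1 : ℝ) ^ (k * l) • D b a)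
  leibniz : ∀ {k l : ℤ} {a b : A} (c : A), a ∈ 𝒜 k → b ∈ 𝒜 l →
    D a (b * c) = D a b * c + (-1 : ℝ) ^ (k * l) • (b * D a c)

/-- Graded derivations of degree `k`. -/
structure IsDerivation (𝒜 : ℤ → Submodule ℝ A) (k : ℤ) (Y : A →ₗ[ℝ] A) : Prop where
  mem : ∀ {l : ℤ} {b : A}, b ∈ 𝒜 l → Y b ∈ 𝒜 (k + l)
  leibniz : ∀ {l : ℤ} {b : A} (c : A), b ∈ 𝒜 l →
    Y (b * c) = Y b * c + (-1 : ℝ) ^ (k * l) • (b * Y c)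

variable {𝒜 : ℤ → Submodule ℝ A}

theorem GradedPoissonBracket.isBiderivation (B : GradedPoissonBracket 𝒜) :
    IsBiderivation 𝒜 B.br := ⟨B.br_mem, B.skew, B.leibniz⟩

namespace IsBiderivation

variable {D D' : A →ₗ[ℝ] A →ₗ[ℝ] A}

theorem sub (h : IsBiderivation 𝒜 D) (h' : IsBiderivation 𝒜 D') : IsBiderivation 𝒜 (D - D') where
  mem ha hb := Submodule.sub_mem _ (h.mem ha hb) (h'.mem ha hb)
  skew ha hb := by
    simp only [LinearMap.sub_apply]
    rw [h.skew ha hb, h'.skew ha hb, smul_sub]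
    abel
  leibniz c ha hb := by
    simp only [LinearMap.sub_apply]
    rw [h.leibniz c ha hb, h'.leibniz c ha hb, sub_mul, mul_sub, smul_sub]
    abel

theorem isDerivation (h : IsBiderivation 𝒜 D) {k : ℤ} {a : A} (ha : a ∈ 𝒜 k) :
    IsDerivation 𝒜 k (D a) := ⟨fun hb => h.mem ha hb, fun c hb => h.leibniz c ha hb⟩

theorem leibniz_left (h : IsBiderivation 𝒜 D) (w : WeightDecomposition 𝒜) {k l m : ℤ} {a b c : A}
    (ha : a ∈ 𝒜 k) (hb : b ∈ 𝒜 l) (hc : c ∈ 𝒜 m) :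
    D (a * b) c = a * D b c + (-1 : ℝ) ^ (l * m) • (D a c * b) := by
  rw [h.skew (w.deg_mul_mem ha hb) hc, h.leibniz b hc ha, h.skew ha hc, h.skew hb hc,
    add_mul, sign_add, mul_comm m k]
  simp only [smul_add, mul_neg, neg_mul, smul_neg, mul_smul_comm, smul_mul_assoc, smul_smul]
  rw [show (-1 : ℝ) ^ (k * m) * (-1) ^ (l * m) * (-1) ^ (k * m) = (-1) ^ (l * m) by
    rw [mul_right_comm, sign_mul_self, one_mul], mul_comm ((-1 : ℝ) ^ (l * m))]
  abel

theorem lead (h : IsBiderivation 𝒜 D) (w : WeightDecomposition 𝒜) (j : ℤ) :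
    IsBiderivation 𝒜 (w.lead D j) where
  mem {k l a b} ha hb := by
    have ha' := w.sum_proj a
    have hb' := w.sum_proj b
    rw [← ha', ← hb']
    simp only [map_sum, LinearMap.sum_apply]
    refine Submodule.sum_mem _ fun n _ => Submodule.sum_mem _ fun m _ => ?_
    rw [WeightDecomposition.lead_apply D j (w.proj_mem _ a) (w.proj_mem _ b)]
    exact w.proj_deg _ (h.mem (w.proj_deg _ ha) (w.proj_deg _ hb))
  skew {k l a b} ha hb := by
    rw [← w.sum_proj a, ← w.sum_proj b]
    simp only [map_sum, LinearMap.sum_apply, Finset.smul_sum]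
    rw [Finset.sum_comm, ← Finset.sum_neg_distrib]
    refine Finset.sum_congr rfl fun n _ => ?_
    rw [← Finset.sum_neg_distrib]
    refine Finset.sum_congr rfl fun m _ => ?_
    rw [WeightDecomposition.lead_apply D j (w.proj_mem _ a) (w.proj_mem _ b),
      WeightDecomposition.lead_apply D j (w.proj_mem _ b) (w.proj_mem _ a),
      h.skew (w.proj_deg _ ha) (w.proj_deg _ hb), add_comm n m]
    simp
  leibniz {k l a b} c ha hb := by
    refine w.induction_deg (p := fun a => w.lead D j a (b * c) = w.lead D j a b * c + (-1 : ℝ) ^ (k * l) • (b * w.lead D j a c))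
      (fun a a' h₁ h₂ => ?_) (fun n a ha hn => ?_) ha
    · simp only [map_add, LinearMap.add_apply, h₁, h₂, add_mul, mul_add, smul_add]
      abel
    refine w.induction_deg (p := fun b => w.lead D j a (b * c) = w.lead D j a b * c + (-1 : ℝ) ^ (k * l) • (b * w.lead D j a c))
      (fun a a' h₁ h₂ => ?_) (fun m b hb hm => ?_) hb
    · simp only [map_add, h₁, h₂, add_mul, smul_add]
      abel
    refine w.induction (p := fun c => w.lead D j a (b * c) = w.lead D j a b * c + (-1 : ℝ) ^ (k * l) • (b * w.lead D j a c))
      (fun a a' h₁ h₂ => ?_) (fun _ p c _ hp => ?_) c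
    · simp only [map_add, h₁, h₂, mul_add, smul_add]
      abel
    rw [WeightDecomposition.lead_apply D j hn (w.mul_mem hm hp),
      WeightDecomposition.lead_apply D j hn hm, WeightDecomposition.lead_apply D j hn hp,
      h.leibniz _ ha hb, map_add, map_smul, ← w.proj_mul _ hp, ← w.proj_mul' _ hm,
      show n + (m + p) + j = n + m + j + p by ring, show n + m + j + p = m + (n + p + j) by ring]

end IsBiderivation

/-- The mixed Jacobi identity of two brackets, with sign `s`, holds if this expression vanishes. -/
def mixedJacobi (B D : A →ₗ[ℝ] A →ₗ[ℝ] A) (s : ℝ) (a b c : A) : A :=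
  B a (D b c) + D a (B b c) - B (D a b) c - D (B a b) c - s • (B b (D a c) + D b (B a c))

namespace WeightDecomposition

variable {w : WeightDecomposition 𝒜} {B D : A →ₗ[ℝ] A →ₗ[ℝ] A} {s j : ℤ}

theorem Shift.sub_lead_right (hB : w.Shift B s) (hD : w.Shift D j) {n m p : ℤ} {a b c : A}
    (ha : a ∈ w.F n) (hb : b ∈ w.F m) (hc : c ∈ w.F p) :
    B a (D b c) - w.lead B s a (w.lead D j b c) ∈ w.F (n + m + p + s + j + 1) := by
  have h : B a (D b c) - w.lead B s a (w.lead D j b c) =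
      (B - w.lead B s) a (D b c) + w.lead B s a ((D - w.lead D j) b c) := by
    simp only [LinearMap.sub_apply, map_sub]
    abel
  rw [h]
  exact Submodule.add_mem _
    (w.mem_F_of_le (hB.sub_lead _ _ _ _ ha (hD _ _ _ _ hb hc)) (by omega))
    (w.mem_F_of_le (shift_lead B s _ _ _ _ ha (hD.sub_lead _ _ _ _ hb hc)) (by omega))

theorem Shift.sub_lead_left (hB : w.Shift B s) (hD : w.Shift D j) {n m p : ℤ} {a b c : A}
    (ha : a ∈ w.F n) (hb : b ∈ w.F m) (hc : c ∈ w.F p) :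
    B (D a b) c - w.lead B s (w.lead D j a b) c ∈ w.F (n + m + p + s + j + 1) := by
  have h : B (D a b) c - w.lead B s (w.lead D j a b) c =
      (B - w.lead B s) (D a b) c + w.lead B s ((D - w.lead D j) a b) c := by
    simp only [LinearMap.sub_apply, map_sub]
    abel
  rw [h]
  exact Submodule.add_mem _
    (w.mem_F_of_le (hB.sub_lead _ _ _ _ (hD _ _ _ _ ha hb) hc) (by omega))
    (w.mem_F_of_le (shift_lead B s _ _ _ _ (hD.sub_lead _ _ _ _ ha hb) hc) (by omega))

theorem mixedJacobi_lead (hB : w.Shift B s) (hD : w.Shift D j) {n m p : ℤ} {a b c : A}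
    (ha : a ∈ w.W n) (hb : b ∈ w.W m) (hc : c ∈ w.W p) (σ : ℝ)
    (h : mixedJacobi B D σ a b c ∈ w.F (n + m + p + s + j + 1)) :
    mixedJacobi (w.lead B s) (w.lead D j) σ a b c = 0 := by
  have fa := w.W_le_F le_rfl ha
  have fb := w.W_le_F le_rfl hb
  have fc := w.W_le_F le_rfl hc
  have e1 := hB.sub_lead_right hD fa fb fc
  have e2 := hD.sub_lead_right hB fa fb fc
  have e3 := hB.sub_lead_left hD fa fb fc
  have e4 := hD.sub_lead_left hB fa fb fc
  have e5 := hB.sub_lead_right hD fb fa fc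
  have e6 := hD.sub_lead_right hB fb fa fc
  have key : mixedJacobi (w.lead B s) (w.lead D j) σ a b c ∈ w.F (n + m + p + s + j + 1) := by
    have e : mixedJacobi (w.lead B s) (w.lead D j) σ a b c = mixedJacobi B D σ a b c -
        ((B a (D b c) - w.lead B s a (w.lead D j b c)) +
          (D a (B b c) - w.lead D j a (w.lead B s b c)) -
          (B (D a b) c - w.lead B s (w.lead D j a b) c) -
          (D (B a b) c - w.lead D j (w.lead B s a b) c) -
          σ • ((B b (D a c) - w.lead B s b (w.lead D j a c)) +
            (D b (B a c) - w.lead D j b (w.lead B s a c)))) := by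
      simp only [mixedJacobi]
      module
    rw [e]
    refine Submodule.sub_mem _ h (Submodule.sub_mem _ (Submodule.sub_mem _ (Submodule.sub_mem _
      (Submodule.add_mem _ e1 ?_) e3) ?_) (Submodule.smul_mem _ _ (Submodule.add_mem _ ?_ ?_)))
    · exact w.mem_F_of_le e2 (by omega)
    · exact w.mem_F_of_le e4 (by omega)
    · exact w.mem_F_of_le e5 (by omega)
    · exact w.mem_F_of_le e6 (by omega)
  refine w.eq_zero_of_mem_W_of_mem_F (n := n + m + p + s + j) ?_ key (by omega)
  have cast : ∀ {i i' : ℤ} {x : A}, x ∈ w.W i → i = i' → x ∈ w.W i' := fun hx h => h ▸ hx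
  refine Submodule.sub_mem _ (Submodule.sub_mem _ (Submodule.sub_mem _
      (Submodule.add_mem _ ?_ ?_) ?_) ?_) (Submodule.smul_mem _ _ (Submodule.add_mem _ ?_ ?_))
  · exact cast (lead_mem B s ha (lead_mem D j hb hc)) (by omega)
  · exact cast (lead_mem D j ha (lead_mem B s hb hc)) (by omega)
  · exact cast (lead_mem B s (lead_mem D j ha hb) hc) (by omega)
  · exact cast (lead_mem D j (lead_mem B s ha hb) hc) (by omega)
  · exact cast (lead_mem B s hb (lead_mem D j ha hc)) (by omega)
  · exact cast (lead_mem D j hb (lead_mem B s ha hc)) (by omega)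

end WeightDecomposition

/-- The difference of two Poisson brackets satisfies the mixed Jacobi identity with the first one
up to terms quadratic in the difference. -/
theorem GradedPoissonBracket.mixedJacobi_sub_mem (w : WeightDecomposition 𝒜)
    (B B' : GradedPoissonBracket 𝒜) {j : ℤ} (hj : 0 ≤ j) (h : w.Shift (B'.br - B.br) j)
    {k l n m p : ℤ} {a b c : A} (hka : a ∈ 𝒜 k) (hlb : b ∈ 𝒜 l) (ha : a ∈ w.W n) (hb : b ∈ w.W m)
    (hc : c ∈ w.W p) :
    mixedJacobi B.br (B'.br - B.br) ((-1 : ℝ) ^ (k * l)) a b c ∈ w.F (n + m + p + j) := by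
  have fa := w.W_le_F le_rfl ha
  have fb := w.W_le_F le_rfl hb
  have fc := w.W_le_F le_rfl hc
  have j1 := B.jacobi c hka hlb
  have j2 := B'.jacobi c hka hlb
  set D := B'.br - B.br with hD
  have hB' : B'.br = B.br + D := by rw [hD]; abel
  rw [hB'] at j2
  simp only [LinearMap.add_apply, map_add] at j2
  have e : mixedJacobi B.br D ((-1 : ℝ) ^ (k * l)) a b c =
      D (D a b) c + (-1 : ℝ) ^ (k * l) • D b (D a c) - D a (D b c) := by
    simp only [mixedJacobi]
    linear_combination (norm := module) j2 - j1
  rw [e]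
  refine Submodule.sub_mem _ (Submodule.add_mem _ ?_ (Submodule.smul_mem _ _ ?_)) ?_
  · exact w.mem_F_of_le (h _ _ _ _ (h _ _ _ _ fa fb) fc) (by omega)
  · exact w.mem_F_of_le (h _ _ _ _ fb (h _ _ _ _ fa fc)) (by omega)
  · exact w.mem_F_of_le (h _ _ _ _ fa (h _ _ _ _ fb fc)) (by omega)

end Biderivation

/-! ### Brackets along the fibres and local frames -/

section Frame

variable {A : Type*} [Ring A] [Algebra ℝ A] {𝒜 : ℤ → Submodule ℝ A}

/-- A Poisson bracket of weight `-2` that vanishes if one argument has weight `0`. -/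
structure IsFibreBracket (w : WeightDecomposition 𝒜) (G : A →ₗ[ℝ] A →ₗ[ℝ] A) : Prop
    extends IsBiderivation 𝒜 G where
  W_mem : ∀ {n m a b}, a ∈ w.W n → b ∈ w.W m → G a b ∈ w.W (n + m - 2)
  eq_zero : ∀ {f}, f ∈ w.W 0 → ∀ b, G f b = 0
  jacobi : ∀ {k l n m p a b c}, a ∈ 𝒜 k → b ∈ 𝒜 l → a ∈ w.W n → b ∈ w.W m → c ∈ w.W p →
    G a (G b c) = G (G a b) c + (-1 : ℝ) ^ (k * l) • G b (G a c)

/-- A finite family of elements `z α` of weight `1` with dual family `z (swap α)`, such that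
`∑ z α * G (z (swap α)) ·` is the Euler operator up to a cut-off function. -/
structure FibreFrame (w : WeightDecomposition 𝒜) (G : A →ₗ[ℝ] A →ₗ[ℝ] A) (ι : Type*)
    [Fintype ι] where
  /-- the elements of the frame -/
  z : ι → A
  /-- the degrees of the elements of the frame -/
  deg : ι → ℤ
  /-- the bijection with the dual frame -/
  swap : ι ≃ ι
  /-- the cut-off function -/
  cutoff : A
  deg_odd : ∀ α, deg α = 1 ∨ deg α = -1
  deg_swap : ∀ α, deg (swap α) = -deg α
  swap_swap : ∀ α, swap (swap α) = α
  z_deg : ∀ α, z α ∈ 𝒜 (deg α)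
  z_mem : ∀ α, z α ∈ w.W 1
  cutoff_mem : cutoff ∈ w.W 0
  euler : ∀ {n : ℤ} {a : A}, a ∈ w.W n →
    ∑ α, z α * G (z (swap α)) a = (n : ℝ) • (cutoff * a)

variable {w : WeightDecomposition 𝒜} {G : A →ₗ[ℝ] A →ₗ[ℝ] A}

theorem IsBiderivation.eq_zero_right {D : A →ₗ[ℝ] A →ₗ[ℝ] A} (hD : IsBiderivation 𝒜 D)
    (h : ∀ {f}, f ∈ w.W 0 → ∀ b, D f b = 0) (a : A) {f : A} (hf : f ∈ w.W 0) : D a f = 0 := by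
  refine w.induction (p := fun a => D a f = 0) (fun a b ha hb => ?_) (fun k n a hk _ => ?_) a
  · rw [map_add, LinearMap.add_apply, ha, hb, add_zero]
  · rw [hD.skew hk (w.zero_le hf), h hf, smul_zero, neg_zero]

theorem IsFibreBracket.eq_zero_right (hG : IsFibreBracket w G) (a : A) {f : A} (hf : f ∈ w.W 0) :
    G a f = 0 := hG.toIsBiderivation.eq_zero_right hG.eq_zero a hf

variable {ι : Type*} [Fintype ι] (fr : FibreFrame w G ι)

namespace FibreFrame

theorem z_swap_deg (α : ι) : fr.z (fr.swap α) ∈ 𝒜 (-fr.deg α) := fr.deg_swap α ▸ fr.z_deg _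

theorem swap_deg_odd (α : ι) : -fr.deg α = 1 ∨ -fr.deg α = -1 := fr.deg_swap α ▸ fr.deg_odd _

theorem sum_swap (f : A → A → A) :
    ∑ α, f (fr.z (fr.swap α)) (fr.z α) = ∑ α, f (fr.z α) (fr.z (fr.swap α)) := by
  rw [← Equiv.sum_comp fr.swap]
  simp only [fr.swap_swap]

theorem cutoff_mul (a : A) : fr.cutoff * a = a * fr.cutoff := w.central fr.cutoff_mem a

include fr in
/-- A derivation that vanishes on functions is determined by its values on a frame. -/
theorem derivation_eq (hG : IsFibreBracket w G) {k : ℤ} {Y : A →ₗ[ℝ] A}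
    (hY : IsDerivation 𝒜 k Y) (hY0 : ∀ f ∈ w.W 0, Y f = 0) {ρ : A} (hρ : ρ ∈ w.W 0)
    (hρf : ρ * fr.cutoff = ρ) (v : A) :
    ρ * ∑ α, Y (fr.z α) * G (fr.z (fr.swap α)) v = ρ * Y v := by
  have key : ∀ (n : ℕ) (l : ℤ) (v : A), v ∈ 𝒜 l → v ∈ w.W n →
      ρ * ∑ α, Y (fr.z α) * G (fr.z (fr.swap α)) v = ρ * Y v := by
    intro n
    induction n with
    | zero =>
      intro l v _ hv
      rw [hY0 v hv, Finset.sum_eq_zero fun α _ => by rw [hG.eq_zero_right _ hv, mul_zero]]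
    | succ n ih =>
      intro l v hl hv
      have hGW : ∀ β, G (fr.z (fr.swap β)) v ∈ w.W n := fun β => by
        have := hG.W_mem (fr.z_mem (fr.swap β)) hv
        rwa [show (1 : ℤ) + ((n + 1 : ℕ) : ℤ) - 2 = n by push_cast; ring] at this
      have hGd : ∀ β, G (fr.z (fr.swap β)) v ∈ 𝒜 (-fr.deg β + l) := fun β =>
        hG.mem (fr.z_swap_deg β) hl
      have e0 := congrArg (fun x => ρ * Y x) (fr.euler hv)
      simp only [map_sum, map_smul, mul_smul_comm] at e0
      have e1 : Y (fr.cutoff * v) = fr.cutoff * Y v := by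
        rw [hY.leibniz v (w.zero_le fr.cutoff_mem), hY0 _ fr.cutoff_mem]
        simp
      have hGG : ∀ α β, G (fr.z (fr.swap β)) (G (fr.z (fr.swap α)) v) =
          -G (fr.z (fr.swap α)) (G (fr.z (fr.swap β)) v) := fun α β => by
        have h0 : G (fr.z (fr.swap β)) (fr.z (fr.swap α)) ∈ w.W 0 := by
          simpa using hG.W_mem (fr.z_mem (fr.swap β)) (fr.z_mem (fr.swap α))
        rw [hG.jacobi (fr.z_deg (fr.swap β)) (fr.z_deg (fr.swap α)) (fr.z_mem _) (fr.z_mem _) hv,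
          hG.eq_zero h0, zero_add, sign_odd_mul (fr.deg_odd _), sign_odd (fr.deg_odd _),
          neg_one_smul]
      have e2 : ∀ α, ρ * Y (fr.z α * G (fr.z (fr.swap α)) v) =
          ρ * (Y (fr.z α) * G (fr.z (fr.swap α)) v) +
            ρ * ∑ β, Y (fr.z β) * (fr.z α * G (fr.z (fr.swap α)) (G (fr.z (fr.swap β)) v)) := by
        intro α
        rw [hY.leibniz _ (fr.z_deg α), mul_add, mul_smul_comm]
        congr 1
        rw [← mul_assoc, w.central hρ, mul_assoc, ← ih _ _ (hGd α) (hGW α), ← mul_assoc,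
          ← w.central hρ, mul_assoc, Finset.mul_sum, ← mul_smul_comm, Finset.smul_sum]
        congr 1
        refine Finset.sum_congr rfl fun β _ => ?_
        rw [hGG, ← mul_assoc, w.mul_comm (fr.z_deg α) (hY.mem (fr.z_deg β)),
          sign_mul_odd (fr.deg_odd α), sign_odd_mul (fr.deg_odd α), sign_add,
          sign_odd (fr.deg_odd β), smul_mul_assoc, smul_smul]
        rw [show (-1 : ℝ) ^ k * ((-1) ^ k * -1) = -1 by
          rw [← mul_assoc, sign_mul_self, one_mul], neg_one_smul, mul_neg, neg_neg, mul_assoc]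
      rw [Finset.mul_sum, Finset.sum_congr rfl fun α _ => e2 α, Finset.sum_add_distrib,
        ← Finset.mul_sum, ← Finset.mul_sum, Finset.sum_comm, e1] at e0
      have e3 : ∀ β, ∑ α, Y (fr.z β) *
          (fr.z α * G (fr.z (fr.swap α)) (G (fr.z (fr.swap β)) v)) =
          (n : ℝ) • (fr.cutoff * (Y (fr.z β) * G (fr.z (fr.swap β)) v)) := fun β => by
        rw [← Finset.mul_sum, fr.euler (hGW β), mul_smul_comm, ← mul_assoc, ← fr.cutoff_mul,
          mul_assoc]
        simp
      rw [Finset.sum_congr rfl fun β _ => e3 β, ← Finset.smul_sum, ← Finset.mul_sum,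
        mul_smul_comm, ← mul_assoc, hρf, ← mul_assoc, hρf] at e0
      have e4 : ((n : ℝ) + 1) • (ρ * ∑ α, Y (fr.z α) * G (fr.z (fr.swap α)) v) =
          ((n : ℝ) + 1) • (ρ * Y v) := by
        rw [add_smul, one_smul, add_comm, e0]
        simp
      exact smul_right_injective A (by positivity : (n : ℝ) + 1 ≠ 0) e4
  refine w.induction (p := fun v => ρ * ∑ α, Y (fr.z α) * G (fr.z (fr.swap α)) v = ρ * Y v)
    (fun a b ha hb => ?_) (fun l n a hl hn => ?_) v
  · simp only [map_add, mul_add, Finset.sum_add_distrib, ha, hb]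
  · rcases lt_or_ge n 0 with h | h
    · simp [w.eq_zero_of_neg hn h]
    · lift n to ℕ using h
      exact key n l a hl hn

/-- The contraction of a biderivation with the Euler vector field of a frame. -/
def contract (L : A →ₗ[ℝ] A →ₗ[ℝ] A) : A →ₗ[ℝ] A :=
  ∑ α, LinearMap.mulLeft ℝ (fr.z α) ∘ₗ L (fr.z (fr.swap α))

theorem contract_apply (L : A →ₗ[ℝ] A →ₗ[ℝ] A) (u : A) :
    fr.contract L u = ∑ α, fr.z α * L (fr.z (fr.swap α)) u := by
  simp [contract]

theorem contract_deg {L : A →ₗ[ℝ] A →ₗ[ℝ] A} (hL : IsBiderivation 𝒜 L) {k : ℤ} {u : A}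
    (hu : u ∈ 𝒜 k) : fr.contract L u ∈ 𝒜 k := by
  rw [contract_apply]
  refine Submodule.sum_mem _ fun α _ => ?_
  have := w.deg_mul_mem (fr.z_deg α) (hL.mem (fr.z_swap_deg α) hu)
  rwa [add_neg_cancel_left] at this

theorem contract_W {L : A →ₗ[ℝ] A →ₗ[ℝ] A} {j : ℤ}
    (hW : ∀ {n m a b}, a ∈ w.W n → b ∈ w.W m → L a b ∈ w.W (n + m + j)) {n : ℤ} {u : A}
    (hu : u ∈ w.W n) : fr.contract L u ∈ w.W (n + (j + 2)) := by
  rw [contract_apply]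
  refine Submodule.sum_mem _ fun α _ => ?_
  have := w.mul_mem (fr.z_mem α) (hW (fr.z_mem (fr.swap α)) hu)
  rwa [show 1 + (1 + n + j) = n + (j + 2) by ring] at this

theorem contract_mul {L : A →ₗ[ℝ] A →ₗ[ℝ] A} (hL : IsBiderivation 𝒜 L) (u v : A) :
    fr.contract L (u * v) = fr.contract L u * v + u * fr.contract L v := by
  refine w.induction (p := fun u =>
    fr.contract L (u * v) = fr.contract L u * v + u * fr.contract L v) (fun a b ha hb => ?_)
    (fun k n u hk _ => ?_) u
  · simp only [add_mul, map_add, ha, hb]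
    abel
  · simp only [contract_apply, Finset.sum_mul, Finset.mul_sum, ← Finset.sum_add_distrib]
    refine Finset.sum_congr rfl fun α _ => ?_
    rw [hL.leibniz v (fr.z_swap_deg α) hk, mul_add, ← mul_assoc, mul_smul_comm, ← mul_assoc,
      w.mul_comm (fr.z_deg α) hk, smul_mul_assoc, smul_smul, mul_assoc u,
      sign_odd_mul (fr.swap_deg_odd α), sign_odd_mul (fr.deg_odd α), sign_mul_self, one_smul]

end FibreFrame

/-- The Lie derivative of a bracket along a vector field, up to sign. -/
def lieBracket (G : A →ₗ[ℝ] A →ₗ[ℝ] A) (X : A →ₗ[ℝ] A) : A →ₗ[ℝ] A →ₗ[ℝ] A :=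
  G.compl₁₂ X LinearMap.id + G.compl₁₂ LinearMap.id X - G.compr₂ X

@[simp]
theorem lieBracket_apply (G : A →ₗ[ℝ] A →ₗ[ℝ] A) (X : A →ₗ[ℝ] A) (u v : A) :
    lieBracket G X u v = G (X u) v + G u (X v) - X (G u v) := by
  simp [lieBracket]

/-- An infinitesimal deformation of weight `j` of a bracket along the fibres. -/
structure IsFibreCocycle (w : WeightDecomposition 𝒜) (G : A →ₗ[ℝ] A →ₗ[ℝ] A) (j : ℤ)
    (L : A →ₗ[ℝ] A →ₗ[ℝ] A) : Prop extends IsBiderivation 𝒜 L where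
  W_mem : ∀ {n m a b}, a ∈ w.W n → b ∈ w.W m → L a b ∈ w.W (n + m + j)
  cocycle : ∀ {k l n m p a b c}, a ∈ 𝒜 k → b ∈ 𝒜 l → a ∈ w.W n → b ∈ w.W m → c ∈ w.W p →
    mixedJacobi G L ((-1 : ℝ) ^ (k * l)) a b c = 0

namespace FibreFrame

variable {fr} {L : A →ₗ[ℝ] A →ₗ[ℝ] A} {j : ℤ} {ρ : A}

theorem mul_apply_eq_zero (hG : IsFibreBracket w G) (hL : IsFibreCocycle w G j L) (hj : 0 < j)
    (hρf : ρ * fr.cutoff = ρ) {f g : A} (hf : f ∈ w.W 0) (hg : g ∈ w.W 0) :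
    ρ * L f g = 0 := by
  have h1 : ∀ α, G (fr.z (fr.swap α)) (L f g) = 0 := fun α => by
    have h := hL.cocycle (w.zero_le hf) (w.zero_le hg) hf hg (fr.z_mem (fr.swap α))
    simp only [mixedJacobi, hG.eq_zero hf, hG.eq_zero hg, map_zero, LinearMap.zero_apply, zero_sub,
      add_zero, smul_zero, sub_zero, neg_eq_zero] at h
    rw [hG.skew (fr.z_deg _) (hL.mem (w.zero_le hf) (w.zero_le hg)), h, smul_zero, neg_zero]
  have h2 := fr.euler (hL.W_mem hf hg)
  rw [Finset.sum_eq_zero fun α _ => by rw [h1, mul_zero]] at h2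
  have h3 : fr.cutoff * L f g = 0 := by
    refine (smul_eq_zero.1 h2.symm).resolve_left ?_
    simpa using hj.ne'
  rw [← hρf, mul_assoc, h3, mul_zero]

theorem lieBracket_contract_function (hG : IsFibreBracket w G) (hL : IsFibreCocycle w G j L)
    (hL0 : ∀ f ∈ w.W 0, ∀ g ∈ w.W 0, L f g = 0) (hρ : ρ ∈ w.W 0) (hρf : ρ * fr.cutoff = ρ)
    {f : A} (hf : f ∈ w.W 0) (v : A) :
    ρ * lieBracket G (fr.contract L) f v = ((j : ℝ) + 2) • (ρ * L f v) := by
  refine w.induction (p := fun v =>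
    ρ * lieBracket G (fr.contract L) f v = ((j : ℝ) + 2) • (ρ * L f v)) (fun a b ha hb => ?_)
    (fun l m v hl hm => ?_) v
  · rw [map_add, map_add, mul_add, mul_add, ha, hb, smul_add]
  have f0 := w.zero_le hf
  set Y := L f with hYdef
  have hY : IsDerivation 𝒜 0 Y := hL.isDerivation f0
  have hYv : Y v ∈ w.W (m + j) := by simpa using hL.W_mem hf hm
  have vert := fr.derivation_eq hG hY (hL0 f hf) hρ hρf v
  have hYG : ∀ α, Y (G (fr.z (fr.swap α)) v) =
      G (Y (fr.z (fr.swap α))) v + G (fr.z (fr.swap α)) (Y v) := fun α => by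
    have h := hL.cocycle f0 (fr.z_deg (fr.swap α)) hf (fr.z_mem (fr.swap α)) hm
    simp only [mixedJacobi, hG.eq_zero hf, map_zero, LinearMap.zero_apply, zero_add, sub_zero,
      add_zero, zero_mul, zpow_zero, one_smul] at h
    rw [sub_sub, sub_eq_zero] at h
    exact h
  have e1 : ∀ α, G (fr.z α * L (fr.z (fr.swap α)) f) v =
      fr.z α * G (fr.z (fr.swap α)) (Y v) - Y (fr.z α * G (fr.z (fr.swap α)) v) +
        Y (fr.z α) * G (fr.z (fr.swap α)) v + Y (fr.z (fr.swap α)) * G (fr.z α) v := fun α => by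
    have hz' := fr.z_swap_deg α
    have s1 : L (fr.z (fr.swap α)) f = -Y (fr.z (fr.swap α)) := by
      rw [hL.skew hz' f0]
      simp [hYdef]
    rw [s1, mul_neg, map_neg, LinearMap.neg_apply,
      hG.leibniz_left w (fr.z_deg α) (hY.mem hz') hl,
      w.mul_comm (hG.mem (fr.z_deg α) hl) (hY.mem hz'), zero_add, sign_mul_odd (fr.swap_deg_odd α),
      sign_odd_mul (fr.swap_deg_odd α), sign_add, sign_odd (fr.deg_odd α), smul_smul,
      hY.leibniz _ (fr.z_deg α), hYG, zero_mul, zpow_zero, one_smul, mul_add, mul_left_comm,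
      sign_mul_self, mul_one, neg_one_smul]
    abel
  have e2 : lieBracket G (fr.contract L) f v = (m + j : ℝ) • (fr.cutoff * Y v) -
      (m : ℝ) • (fr.cutoff * Y v) + ∑ α, Y (fr.z α) * G (fr.z (fr.swap α)) v +
      ∑ α, Y (fr.z α) * G (fr.z (fr.swap α)) v := by
    rw [lieBracket_apply, hG.eq_zero hf, hG.eq_zero hf, map_zero, add_zero, sub_zero,
      contract_apply, map_sum, LinearMap.sum_apply, Finset.sum_congr rfl fun α _ => e1 α,
      Finset.sum_add_distrib, Finset.sum_add_distrib, Finset.sum_sub_distrib, ← map_sum,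
      fr.euler hm, fr.euler hYv, fr.sum_swap fun x y => Y x * G y v, map_smul,
      hY.leibniz v (w.zero_le fr.cutoff_mem), hL0 f hf _ fr.cutoff_mem]
    simp
  rw [e2, mul_add, mul_add, mul_sub, mul_smul_comm, mul_smul_comm, ← mul_assoc, hρf, vert]
  module

theorem lieBracket_contract (hG : IsFibreBracket w G) (hL : IsFibreCocycle w G j L)
    (hL0 : ∀ {f}, f ∈ w.W 0 → ∀ b, L f b = 0) (hρ : ρ ∈ w.W 0) (hρf : ρ * fr.cutoff = ρ)
    (u v : A) :
    ρ * lieBracket G (fr.contract L) u v = ((j : ℝ) + 4) • (ρ * L u v) := by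
  refine w.induction (p := fun u =>
    ρ * lieBracket G (fr.contract L) u v = ((j : ℝ) + 4) • (ρ * L u v)) (fun a b ha hb => ?_)
    (fun k n u hk hn => ?_) u
  · simp only [map_add, LinearMap.add_apply, mul_add, ha, hb, smul_add]
  refine w.induction (p := fun v =>
    ρ * lieBracket G (fr.contract L) u v = ((j : ℝ) + 4) • (ρ * L u v)) (fun a b ha hb => ?_)
    (fun l m v hl hm => ?_) v
  · rw [map_add, map_add, mul_add, mul_add, ha, hb, smul_add]
  have hε := w.zero_le fr.cutoff_mem
  have vu := fr.derivation_eq hG (hL.isDerivation hk)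
    (fun f hf => hL.toIsBiderivation.eq_zero_right hL0 u hf) hρ hρf v
  have vv := fr.derivation_eq hG (hL.isDerivation hl)
    (fun f hf => hL.toIsBiderivation.eq_zero_right hL0 v hf) hρ hρf u
  have suv := hL.skew hk hl
  have sk := sign_mul_self k
  have sl := sign_mul_self l
  have skl := sign_mul_self (k * l)
  set σ := (-1 : ℝ) ^ (k * l) with hσ
  set κ := (-1 : ℝ) ^ k with hκ
  set τ := (-1 : ℝ) ^ l with hτ
  have t1 : ∀ α, fr.z α * L (G (fr.z (fr.swap α)) u) v =
      L (fr.z α * G (fr.z (fr.swap α)) u) v + σ • (L v (fr.z α) * G (fr.z (fr.swap α)) u) :=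
    fun α => by
    rw [hL.leibniz_left w (fr.z_deg α) (hG.mem (fr.z_swap_deg α) hk) hl,
      hL.skew (fr.z_deg α) hl, add_mul, sign_add, sign_odd_mul (fr.swap_deg_odd α),
      sign_odd_mul (fr.deg_odd α), ← hτ, ← hσ, neg_mul, smul_neg, smul_mul_assoc, smul_smul,
      mul_right_comm, sl, one_mul]
    abel
  have t2 : ∀ α, κ • (fr.z α * L u (G (fr.z (fr.swap α)) v)) =
      L u (fr.z α * G (fr.z (fr.swap α)) v) - L u (fr.z α) * G (fr.z (fr.swap α)) v := fun α => by
    rw [hL.leibniz _ hk (fr.z_deg α), sign_mul_odd (fr.deg_odd α), ← hκ]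
    abel
  have t3 : ∀ α, (τ * σ) • (G (fr.z α) v * L (fr.z (fr.swap α)) u) =
      L u (fr.z (fr.swap α)) * G (fr.z α) v := fun α => by
    rw [hL.skew (fr.z_swap_deg α) hk, sign_odd_mul (fr.swap_deg_odd α), mul_neg, mul_smul_comm,
      w.mul_comm (hG.mem (fr.z_deg α) hl) (hL.mem hk (fr.z_swap_deg α)), add_mul, mul_add, mul_add,
      sign_add, sign_add, sign_add, sign_odd_mul (fr.deg_odd α), sign_odd_mul (fr.deg_odd α),
      sign_mul_odd (fr.swap_deg_odd α), mul_comm l k, sign_odd (fr.swap_deg_odd α), ← hσ, ← hκ,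
      ← hτ, ← smul_neg, ← neg_smul, smul_smul, smul_smul,
      show τ * σ * κ * -(κ * -1 * (σ * τ)) = (κ * κ) * (τ * τ) * (σ * σ) by ring, sk, sl, skl]
    simp
  have t4 : ∀ α, G u (fr.z α) * L (fr.z (fr.swap α)) v =
      -σ • (L v (fr.z (fr.swap α)) * G (fr.z α) u) := fun α => by
    rw [hG.skew hk (fr.z_deg α), hL.skew (fr.z_swap_deg α) hl,
      sign_odd_mul (fr.swap_deg_odd α), sign_mul_odd (fr.deg_odd α), neg_mul_neg,
      smul_mul_smul_comm,
      w.mul_comm (hG.mem (fr.z_deg α) hk) (hL.mem hl (fr.z_swap_deg α)), add_mul, mul_add, mul_add,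
      sign_add, sign_add, sign_add, sign_odd_mul (fr.deg_odd α), sign_odd_mul (fr.deg_odd α),
      sign_mul_odd (fr.swap_deg_odd α), sign_odd (fr.swap_deg_odd α), ← hσ, ← hκ,
      ← hτ, smul_smul,
      show κ * τ * (τ * -1 * (σ * κ)) = (κ * κ) * (τ * τ) * -σ by ring, sk, sl]
    simp
  have e1 : ∀ α, G (fr.z α * L (fr.z (fr.swap α)) u) v +
        G u (fr.z α * L (fr.z (fr.swap α)) v) - fr.z α * L (fr.z (fr.swap α)) (G u v) =
      fr.z α * G (fr.z (fr.swap α)) (L u v) - L (fr.z α * G (fr.z (fr.swap α)) u) v -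
        L u (fr.z α * G (fr.z (fr.swap α)) v) + L u (fr.z α) * G (fr.z (fr.swap α)) v +
        L u (fr.z (fr.swap α)) * G (fr.z α) v +
        -σ • (L v (fr.z α) * G (fr.z (fr.swap α)) u) +
        -σ • (L v (fr.z (fr.swap α)) * G (fr.z α) u) := fun α => by
    have h := congrArg (fun x => fr.z α * x)
      (hL.cocycle (fr.z_swap_deg α) hk (fr.z_mem (fr.swap α)) hn hm)
    simp only [mixedJacobi, mul_add, mul_sub, mul_zero, mul_smul_comm,
      sign_odd_mul (fr.swap_deg_odd α), ← hκ] at h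
    rw [hG.leibniz_left w (fr.z_deg α) (hL.mem (fr.z_swap_deg α) hk) hl,
      hG.leibniz _ hk (fr.z_deg α), t4, sign_mul_odd (fr.deg_odd α), ← hκ, add_mul, sign_add,
      sign_odd_mul (fr.swap_deg_odd α), ← hτ, ← hσ, t3]
    linear_combination (norm := module) -h - t1 α - t2 α
  have e2 : lieBracket G (fr.contract L) u v = (n + m + j : ℝ) • (fr.cutoff * L u v) -
      (n : ℝ) • (fr.cutoff * L u v) - (m : ℝ) • (fr.cutoff * L u v) +
      ∑ α, L u (fr.z α) * G (fr.z (fr.swap α)) v + ∑ α, L u (fr.z α) * G (fr.z (fr.swap α)) v +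
      -σ • ∑ α, L v (fr.z α) * G (fr.z (fr.swap α)) u +
      -σ • ∑ α, L v (fr.z α) * G (fr.z (fr.swap α)) u := by
    rw [lieBracket_apply, contract_apply, contract_apply, contract_apply, map_sum, map_sum,
      LinearMap.sum_apply, ← Finset.sum_add_distrib, ← Finset.sum_sub_distrib,
      Finset.sum_congr rfl fun α _ => e1 α]
    simp only [Finset.sum_add_distrib, Finset.sum_sub_distrib]
    rw [← map_sum, ← LinearMap.sum_apply, ← map_sum, fr.euler hm, fr.euler hn,
      fr.euler (hL.W_mem hn hm), ← Finset.smul_sum, ← Finset.smul_sum,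
      fr.sum_swap fun x y => L u x * G y v, fr.sum_swap fun x y => L v x * G y u, map_smul,
      map_smul, LinearMap.smul_apply, hL.leibniz_left w hε hk hl, hL.leibniz v hk hε, hL0 fr.cutoff_mem,
      hL.toIsBiderivation.eq_zero_right hL0 u fr.cutoff_mem]
    simp
  rw [e2, suv]
  simp only [mul_add, mul_sub, mul_smul_comm, mul_neg, ← mul_assoc, hρf, vu, vv]
  rw [suv]
  simp only [mul_smul_comm, mul_neg]
  module

end FibreFrame

end Frame

/-! ### Exponentials of nilpotent derivations -/

section Exp

variable {A : Type*} [Ring A] [Algebra ℝ A] {𝒜 : ℤ → Submodule ℝ A}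

open IsNilpotent in
/-- If `X` is a derivation of the bilinear map `β`, then `exp X` is an automorphism of `β`. -/
theorem exp_bilinear [Module ℚ A] (β : A →ₗ[ℝ] A →ₗ[ℝ] A) {X : Module.End ℝ A}
    (hX : IsNilpotent X) (h : ∀ a b, X (β a b) = β (X a) b + β a (X b)) (a b : A) :
    exp X (β a b) = β (exp X a) (exp X b) := by
  let XL : Module.End ℝ (TensorProduct ℝ A A) := X.lTensor A
  let XR : Module.End ℝ (TensorProduct ℝ A A) := X.rTensor A
  have hL : IsNilpotent XL := hX.map <| Module.End.lTensorAlgHom ℝ A A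
  have hR : IsNilpotent XR := hX.map <| Module.End.rTensorAlgHom ℝ A A
  have hc : Commute XL XR := by ext; simp [XL, XR]
  have h₁ : exp X (β a b) = TensorProduct.lift β (exp (XL + XR) (a ⊗ₜ[ℝ] b)) := by
    suffices exp X ∘ₗ TensorProduct.lift β = TensorProduct.lift β ∘ₗ exp (XL + XR) by
      simpa using! LinearMap.congr_fun this (a ⊗ₜ[ℝ] b)
    apply Module.End.commute_exp_left_of_commute (hc.isNilpotent_add hL hR) hX
    ext
    simp [XL, XR, h, add_comm]
  have h₂ : exp XL = (exp X).lTensor A := (hX.map_exp (Module.End.lTensorAlgHom ℝ A A)).symm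
  have h₃ : exp XR = (exp X).rTensor A := (hX.map_exp (Module.End.rTensorAlgHom ℝ A A)).symm
  simp [h₁, exp_add_of_commute hc hL hR, h₂, h₃]

theorem exp_sub_mem [Module ℚ A] (w : WeightDecomposition 𝒜) {X : Module.End ℝ A} {s : ℤ}
    (hs : 1 ≤ s) (hX : ∀ n, ∀ a ∈ w.F n, X a ∈ w.F (n + s)) {n : ℤ} {a : A} (ha : a ∈ w.F n) :
    IsNilpotent X ∧ IsNilpotent.exp X a - a - X a ∈ w.F (n + 2 * s) := by
  have hpow : ∀ (i : ℕ) n, ∀ a ∈ w.F n, (X ^ i) a ∈ w.F (n + i * s) := by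
    intro i
    induction i with
    | zero => simp
    | succ i ih =>
      intro n a ha
      rw [pow_succ', Module.End.mul_apply]
      have := hX _ _ (ih n a ha)
      rwa [show n + i * s + s = n + ((i + 1 : ℕ) : ℤ) * s by push_cast; ring] at this
  have h0 : X ^ (w.top.toNat + 1 + 2) = 0 := by
    ext a
    refine w.eq_zero_of_mem_F (hpow _ 0 a (w.mem_F_of_nonpos le_rfl a)) ?_
    have h1 := Int.self_le_toNat w.top
    push_cast
    nlinarith
  refine ⟨⟨_, h0⟩, ?_⟩
  rw [IsNilpotent.exp_eq_sum h0, Finset.sum_range_succ', Finset.sum_range_succ']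
  simp only [LinearMap.add_apply, LinearMap.sum_apply, LinearMap.smul_apply]
  have e : ∀ y : A, y + ((0 + 1).factorial : ℚ)⁻¹ • (X ^ (0 + 1)) a +
      ((Nat.factorial 0 : ℕ) : ℚ)⁻¹ • (X ^ 0) a - a - X a = y := fun y => by simp
  rw [e]
  refine Submodule.sum_mem _ fun i _ => Submodule.smul_of_tower_mem _ _
    (w.mem_F_of_le (hpow _ _ _ ha) ?_)
  push_cast
  nlinarith [i.cast_nonneg (α := ℤ)]

theorem exp_mem_of_forall_mem [Module ℚ A] {X : Module.End ℝ A} (U : Submodule ℝ A)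
    (h : ∀ a ∈ U, X a ∈ U) {a : A} (ha : a ∈ U) : IsNilpotent.exp X a ∈ U := by
  have hpow : ∀ i : ℕ, (X ^ i) a ∈ U := by
    intro i
    induction i with
    | zero => simpa
    | succ i ih =>
      rw [pow_succ', Module.End.mul_apply]
      exact h _ ih
  rw [IsNilpotent.exp, LinearMap.sum_apply]
  exact Submodule.sum_mem _ fun i _ => Submodule.smul_of_tower_mem _ _ (hpow i)

/-- A derivation of degree `0` that raises weights by at least `s` integrates to an automorphism
of the algebra, and of every bilinear map that it is a derivation of. -/
theorem exists_algEquiv_of_derivation (w : WeightDecomposition 𝒜) {X : A →ₗ[ℝ] A} {s : ℤ}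
    (hs : 1 ≤ s) (hmul : ∀ a b, X (a * b) = X a * b + a * X b)
    (hdeg : ∀ k, ∀ a ∈ 𝒜 k, X a ∈ 𝒜 k) (hX : ∀ n, ∀ a ∈ w.F n, X a ∈ w.F (n + s)) :
    ∃ ψ : A ≃ₐ[ℝ] A, (∀ k a, ψ a ∈ 𝒜 k ↔ a ∈ 𝒜 k) ∧
      (∀ n, ∀ a ∈ w.F n, ψ a - a - X a ∈ w.F (n + 2 * s)) ∧
      (∀ n, ∀ a ∈ w.F n, ψ.symm a - a + X a ∈ w.F (n + 2 * s)) ∧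
      ∀ β : A →ₗ[ℝ] A →ₗ[ℝ] A, (∀ a b, X (β a b) = β (X a) b + β a (X b)) →
        ∀ a b, ψ (β a b) = β (ψ a) (ψ b) := by
  let _ : Module ℚ A := Module.compHom A (algebraMap ℚ ℝ)
  have hnil : IsNilpotent X := (exp_sub_mem w hs hX (w.mem_F_of_nonpos le_rfl (0 : A))).1
  have h1 : ∀ a, IsNilpotent.exp X (IsNilpotent.exp (-X) a) = a := fun a => by
    rw [← Module.End.mul_apply, IsNilpotent.exp_mul_exp_neg_self hnil, Module.End.one_apply]
  have h2 : ∀ a, IsNilpotent.exp (-X) (IsNilpotent.exp X a) = a := fun a => by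
    rw [← Module.End.mul_apply, IsNilpotent.exp_neg_mul_exp_self hnil, Module.End.one_apply]
  have hm : ∀ a b, IsNilpotent.exp X (a * b) = IsNilpotent.exp X a * IsNilpotent.exp X b :=
    fun a b => exp_bilinear (LinearMap.mul ℝ A) hnil (by simpa using hmul) a b
  have hone : IsNilpotent.exp X (1 : A) = 1 := by
    have := hm 1 (IsNilpotent.exp (-X) 1)
    rwa [one_mul, h1, mul_one, eq_comm] at this
  have hX' : ∀ n, ∀ a ∈ w.F n, (-X) a ∈ w.F (n + s) := fun n a ha =>
    Submodule.neg_mem _ (hX n a ha)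
  refine ⟨AlgEquiv.ofLinearEquiv (LinearEquiv.ofLinearMap (IsNilpotent.exp X) (IsNilpotent.exp (-X))
    (LinearMap.ext h1) (LinearMap.ext h2)) hone hm, fun k a => ⟨fun h => ?_, fun h => ?_⟩,
    fun n a ha => (exp_sub_mem w hs hX ha).2, fun n a ha => ?_,
    fun β hβ => exp_bilinear β hnil hβ⟩
  · rw [← h2 a]
    exact exp_mem_of_forall_mem _ (fun a ha => Submodule.neg_mem _ (hdeg k a ha)) h
  · exact exp_mem_of_forall_mem _ (hdeg k) h
  · have := (exp_sub_mem w hs hX' ha).2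
    rwa [LinearMap.neg_apply, sub_neg_eq_add] at this

/-- The transport of a graded Poisson bracket along an automorphism. -/
def GradedPoissonBracket.map (B : GradedPoissonBracket 𝒜) (ψ : A ≃ₐ[ℝ] A)
    (hψ : ∀ k a, ψ a ∈ 𝒜 k ↔ a ∈ 𝒜 k) : GradedPoissonBracket 𝒜 :=
  have hψ' : ∀ {k a}, a ∈ 𝒜 k → ψ.symm a ∈ 𝒜 k := fun {k a} ha => by
    rwa [← hψ, AlgEquiv.apply_symm_apply]
  { br := (B.br.compl₁₂ ψ.symm.toLinearMap ψ.symm.toLinearMap).compr₂ ψ.toLinearMap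
    br_mem := fun ha hb => (hψ _ _).2 (B.br_mem (hψ' ha) (hψ' hb))
    skew := fun {k l a b} ha hb => by
      simp only [LinearMap.compr₂_apply, LinearMap.compl₁₂_apply, AlgEquiv.toLinearMap_apply]
      rw [B.skew (hψ' ha) (hψ' hb), map_neg, map_smul]
    leibniz := fun {k l a b} c ha hb => by
      simp only [LinearMap.compr₂_apply, LinearMap.compl₁₂_apply, AlgEquiv.toLinearMap_apply]
      rw [map_mul, B.leibniz _ (hψ' ha) (hψ' hb), map_add, map_smul, map_mul, map_mul,
        AlgEquiv.apply_symm_apply, AlgEquiv.apply_symm_apply]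
    jacobi := fun {k l a b} c ha hb => by
      simp only [LinearMap.compr₂_apply, LinearMap.compl₁₂_apply, AlgEquiv.toLinearMap_apply,
        AlgEquiv.symm_apply_apply]
      rw [B.jacobi _ (hψ' ha) (hψ' hb), map_add, map_smul] }

theorem GradedPoissonBracket.map_br (B : GradedPoissonBracket 𝒜) (ψ : A ≃ₐ[ℝ] A)
    (hψ : ∀ k a, ψ a ∈ 𝒜 k ↔ a ∈ 𝒜 k) (a b : A) :
    (B.map ψ hψ).br a b = ψ (B.br (ψ.symm a) (ψ.symm b)) := rfl

end Exp

/-! ### Comparison of brackets -/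

section Compare

variable {A : Type*} [Ring A] [Algebra ℝ A] {𝒜 : ℤ → Submodule ℝ A}

/-- A cover by local frames along which vector fields can be glued. -/
structure FrameCover (w : WeightDecomposition 𝒜) (G : A →ₗ[ℝ] A →ₗ[ℝ] A) (I : Type*) (ι : Type*)
    [Fintype ι] where
  /-- the members of a partition of unity -/
  ρ : I → A
  /-- the local frames -/
  fr : I → FibreFrame w G ι
  ρ_mem : ∀ i, ρ i ∈ w.W 0
  ρ_cutoff : ∀ i, ρ i * (fr i).cutoff = ρ i
  separated : ∀ a, (∀ i, ρ i * a = 0) → a = 0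
  glue : ∀ (X : I → A →ₗ[ℝ] A) (j : ℤ), (∀ i a b, X i (a * b) = X i a * b + a * X i b) →
    (∀ i k, ∀ a ∈ 𝒜 k, X i a ∈ 𝒜 k) → (∀ i n, ∀ a ∈ w.W n, X i a ∈ w.W (n + j)) →
    ∃ Y : A →ₗ[ℝ] A, (∀ a b, Y (a * b) = Y a * b + a * Y b) ∧ (∀ k, ∀ a ∈ 𝒜 k, Y a ∈ 𝒜 k) ∧
      (∀ n, ∀ a ∈ w.W n, Y a ∈ w.W (n + j)) ∧
      ∀ u v t, (∀ i, ρ i * lieBracket G (X i) u v = ρ i * t) → lieBracket G Y u v = t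

variable {w : WeightDecomposition 𝒜} {G L : A →ₗ[ℝ] A →ₗ[ℝ] A} {I ι : Type*} [Fintype ι] {j : ℤ}

/-- A vector field of weight `j` and degree `0`. -/
structure IsVectorField (w : WeightDecomposition 𝒜) (j : ℤ) (Y : A →ₗ[ℝ] A) : Prop where
  map_mul : ∀ a b, Y (a * b) = Y a * b + a * Y b
  deg : ∀ k, ∀ a ∈ 𝒜 k, Y a ∈ 𝒜 k
  W_mem : ∀ n, ∀ a ∈ w.W n, Y a ∈ w.W (n + j)

theorem IsVectorField.F_mem {Y : A →ₗ[ℝ] A} (hY : IsVectorField w j Y) {n : ℤ} {a : A}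
    (ha : a ∈ w.F n) : Y a ∈ w.F (n + j) := by
  refine w.induction_F (p := fun a => Y a ∈ w.F (n + j)) (fun a b ha hb => ?_)
    (fun _ m a hm _ ha => w.W_le_F (by omega) (hY.W_mem m a ha)) ha
  rw [map_add]
  exact Submodule.add_mem _ ha hb

namespace FrameCover

variable (C : FrameCover w G I ι)

include C

theorem exists_vectorField (hL : IsFibreCocycle w G j L) {r : ℝ} (hr : r ≠ 0) (p : A → A → Prop)
    (h : ∀ i u v, p u v →
      C.ρ i * lieBracket G ((C.fr i).contract L) u v = r • (C.ρ i * L u v)) :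
    ∃ Y, IsVectorField w (j + 2) Y ∧ ∀ u v, p u v → lieBracket G Y u v = L u v := by
  obtain ⟨Y, h1, h2, h3, h4⟩ := C.glue (fun i => r⁻¹ • (C.fr i).contract L) (j + 2)
    (fun i a b => by
      simp only [LinearMap.smul_apply, (C.fr i).contract_mul hL.toIsBiderivation, smul_add,
        smul_mul_assoc, mul_smul_comm])
    (fun i k a ha => Submodule.smul_mem _ _ ((C.fr i).contract_deg hL.toIsBiderivation ha))
    (fun i n a ha => Submodule.smul_mem _ _ ((C.fr i).contract_W hL.W_mem ha))
  refine ⟨Y, ⟨h1, h2, h3⟩, fun u v huv => h4 u v _ fun i => ?_⟩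
  have e : lieBracket G (r⁻¹ • (C.fr i).contract L) u v =
      r⁻¹ • lieBracket G ((C.fr i).contract L) u v := by
    simp only [lieBracket_apply, LinearMap.smul_apply, map_smul, smul_add, smul_sub]
  rw [e, mul_smul_comm, h i u v huv, smul_smul, inv_mul_cancel₀ hr, one_smul]

theorem apply_eq_zero (hG : IsFibreBracket w G) (hL : IsFibreCocycle w G j L) (hj : 0 < j)
    {f g : A} (hf : f ∈ w.W 0) (hg : g ∈ w.W 0) : L f g = 0 :=
  C.separated _ fun i => FibreFrame.mul_apply_eq_zero hG hL hj (C.ρ_cutoff i) hf hg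

theorem exists_vectorField_function (hG : IsFibreBracket w G) (hL : IsFibreCocycle w G j L)
    (hj : 0 ≤ j) (hL0 : ∀ f ∈ w.W 0, ∀ g ∈ w.W 0, L f g = 0) :
    ∃ Y, IsVectorField w (j + 2) Y ∧ ∀ f ∈ w.W 0, ∀ v, lieBracket G Y f v = L f v := by
  have hr : (j : ℝ) + 2 ≠ 0 := by
    have : (0 : ℝ) ≤ j := by exact_mod_cast hj
    positivity
  obtain ⟨Y, hY, h⟩ := C.exists_vectorField hL hr (fun u _ => u ∈ w.W 0) fun i u v hu =>
    FibreFrame.lieBracket_contract_function hG hL hL0 (C.ρ_mem i) (C.ρ_cutoff i) hu v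
  exact ⟨Y, hY, fun f hf v => h f v hf⟩

theorem exists_vectorField_of_eq_zero (hG : IsFibreBracket w G) (hL : IsFibreCocycle w G j L)
    (hj : 0 ≤ j) (hL0 : ∀ {f}, f ∈ w.W 0 → ∀ b, L f b = 0) :
    ∃ Y, IsVectorField w (j + 2) Y ∧ lieBracket G Y = L := by
  have hr : (j : ℝ) + 4 ≠ 0 := by
    have : (0 : ℝ) ≤ j := by exact_mod_cast hj
    positivity
  obtain ⟨Y, hY, h⟩ := C.exists_vectorField hL hr (fun _ _ => True) fun i u v _ =>
    FibreFrame.lieBracket_contract hG hL hL0 (C.ρ_mem i) (C.ρ_cutoff i) u v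
  exact ⟨Y, hY, LinearMap.ext₂ fun u v => h u v trivial⟩

end FrameCover

theorem IsFibreBracket.shift (hG : IsFibreBracket w G) : w.Shift G (-2) :=
  WeightDecomposition.Shift.of_hom fun _ _ _ _ _ _ _ ha _ hb => w.W_le_F le_rfl (hG.W_mem ha hb)

theorem IsFibreBracket.shift_of_sub (hG : IsFibreBracket w G) {B : A →ₗ[ℝ] A →ₗ[ℝ] A}
    (hB : w.Shift (B - G) 0) : w.Shift B (-2) := fun n m a b ha hb => by
  have e : B a b = (B - G) a b + G a b := by simp
  rw [e]
  exact Submodule.add_mem _ (w.mem_F_of_le (hB n m a b ha hb) (by omega)) (hG.shift n m a b ha hb)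

theorem IsFibreBracket.lead_eq (hG : IsFibreBracket w G) {B : A →ₗ[ℝ] A →ₗ[ℝ] A}
    (hB : w.Shift (B - G) 0) : w.lead B (-2) = G := by
  rw [WeightDecomposition.lead_congr (hB.mono (by norm_num) : w.Shift (B - G) (-2 + 1))]
  refine w.bilin_ext fun k l n m a b _ ha _ hb => ?_
  rw [WeightDecomposition.lead_apply G _ ha hb, ← sub_eq_add_neg,
    w.proj_of_mem (hG.W_mem ha hb)]

theorem IsVectorField.shift_lieBracket {Y : A →ₗ[ℝ] A} (hG : IsFibreBracket w G)
    (hY : IsVectorField w (j + 2) Y) : w.Shift (lieBracket G Y) j := by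
  intro n m a b ha hb
  rw [lieBracket_apply]
  refine Submodule.sub_mem _ (Submodule.add_mem _ ?_ ?_) ?_
  · exact w.mem_F_of_le (hG.shift _ _ _ _ (hY.F_mem ha) hb) (by omega)
  · exact w.mem_F_of_le (hG.shift _ _ _ _ ha (hY.F_mem hb)) (by omega)
  · exact w.mem_F_of_le (hY.F_mem (hG.shift _ _ _ _ ha hb)) (by omega)

/-- Two brackets are equivalent by an automorphism that is the identity up to terms that raise
weights by at least `2`. -/
def UnipotentEquiv (w : WeightDecomposition 𝒜) (B B' : GradedPoissonBracket 𝒜) : Prop :=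
  ∃ ψ : A ≃ₐ[ℝ] A, (∀ k a, ψ a ∈ 𝒜 k ↔ a ∈ 𝒜 k) ∧ (∀ n, ∀ a ∈ w.F n, ψ a - a ∈ w.F (n + 2)) ∧
    ∀ a b, ψ (B.br a b) = B'.br (ψ a) (ψ b)

theorem UnipotentEquiv.trans {B B' B'' : GradedPoissonBracket 𝒜} (h : UnipotentEquiv w B B')
    (h' : UnipotentEquiv w B' B'') : UnipotentEquiv w B B'' := by
  obtain ⟨ψ, h1, h2, h3⟩ := h
  obtain ⟨ψ', h1', h2', h3'⟩ := h'
  refine ⟨ψ.trans ψ', fun k a => (h1' k _).trans (h1 k a), fun n a ha => ?_, fun a b => ?_⟩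
  · have e : (ψ.trans ψ') a - a = (ψ' (ψ a) - ψ a) + (ψ a - a) := by simp
    have hψ : ψ a ∈ w.F n := by
      have := Submodule.add_mem _ (w.mem_F_of_le (h2 n a ha) (by omega : n ≤ n + 2)) ha
      rwa [sub_add_cancel] at this
    rw [e]
    exact Submodule.add_mem _ (h2' n _ hψ) (h2 n a ha)
  · simp [h3, h3']

theorem exists_unipotentEquiv_sub_lieBracket (hG : IsFibreBracket w G) (hj : 0 ≤ j)
    {Y : A →ₗ[ℝ] A} (hY : IsVectorField w (j + 2) Y) (B : GradedPoissonBracket 𝒜)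
    (hB : w.Shift (B.br - G) 0) :
    ∃ B' : GradedPoissonBracket 𝒜, UnipotentEquiv w B B' ∧
      w.Shift (B'.br - B.br - lieBracket G Y) (j + 1) := by
  have hnY : IsVectorField w (j + 2) (-Y) :=
    ⟨fun a b => by simp only [LinearMap.neg_apply, hY.map_mul, neg_mul, mul_neg, neg_add],
      fun k a ha => Submodule.neg_mem _ (hY.deg k a ha),
      fun n a ha => Submodule.neg_mem _ (hY.W_mem n a ha)⟩
  obtain ⟨ψ, h1, h2, h3, -⟩ := exists_algEquiv_of_derivation w (by omega : 1 ≤ j + 2) hnY.map_mul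
    hnY.deg (fun n a ha => hnY.F_mem ha)
  have hBs : w.Shift B.br (-2) := hG.shift_of_sub hB
  refine ⟨B.map ψ h1, ⟨ψ, h1, fun n a ha => ?_, fun a b => ?_⟩, fun n m a b ha hb => ?_⟩
  · have e : ψ a - a = (ψ a - a - (-Y) a) + (-Y) a := by abel
    rw [e]
    exact Submodule.add_mem _ (w.mem_F_of_le (h2 n a ha) (by omega))
      (w.mem_F_of_le (hnY.F_mem ha) (by omega))
  · simp [GradedPoissonBracket.map_br]
  · have ra := h3 n a ha
    have rb := h3 m b hb
    simp only [LinearMap.neg_apply, ← sub_eq_add_neg, sub_neg_eq_add] at ra rb h2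
    set ra' := ψ.symm a - a - Y a with hra
    set rb' := ψ.symm b - b - Y b with hrb
    have ea : ψ.symm a = a + Y a + ra' := by rw [hra]; abel
    have eb : ψ.symm b = b + Y b + rb' := by rw [hrb]; abel
    have Ya := hY.F_mem ha
    have Yb := hY.F_mem hb
    have sa : ψ.symm a - a ∈ w.F (n + (j + 2)) := by
      rw [ea, show a + Y a + ra' - a = Y a + ra' by abel]
      exact Submodule.add_mem _ Ya (w.mem_F_of_le ra (by omega))
    have sb : ψ.symm b - b ∈ w.F (m + (j + 2)) := by
      rw [eb, show b + Y b + rb' - b = Y b + rb' by abel]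
      exact Submodule.add_mem _ Yb (w.mem_F_of_le rb (by omega))
    set c := B.br (ψ.symm a) (ψ.symm b) with hc
    have hc' : c - (B.br a b + B.br (Y a) b + B.br a (Y b)) ∈ w.F (n + m + 2 * j + 2) := by
      have e : c - (B.br a b + B.br (Y a) b + B.br a (Y b)) =
          B.br ra' b + B.br a rb' + B.br (ψ.symm a - a) (ψ.symm b - b) := by
        rw [hc, hra, hrb]
        simp only [map_sub, LinearMap.sub_apply]
        abel
      rw [e]
      refine Submodule.add_mem _ (Submodule.add_mem _ ?_ ?_) ?_
      · exact w.mem_F_of_le (hBs _ _ _ _ ra hb) (by omega)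
      · exact w.mem_F_of_le (hBs _ _ _ _ ha rb) (by omega)
      · exact w.mem_F_of_le (hBs _ _ _ _ sa sb) (by omega)
    have hBY : B.br (Y a) b + B.br a (Y b) ∈ w.F (n + m + j) := Submodule.add_mem _
      (w.mem_F_of_le (hBs _ _ _ _ Ya hb) (by omega)) (w.mem_F_of_le (hBs _ _ _ _ ha Yb) (by omega))
    have hcB : c - B.br a b ∈ w.F (n + m + j) := by
      have e : c - B.br a b = (c - (B.br a b + B.br (Y a) b + B.br a (Y b))) +
          (B.br (Y a) b + B.br a (Y b)) := by abel
      rw [e]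
      exact Submodule.add_mem _ (w.mem_F_of_le hc' (by omega)) hBY
    have hcF : c ∈ w.F (n + m - 2) := by
      have e : c = (c - B.br a b) + B.br a b := by abel
      rw [e]
      exact Submodule.add_mem _ (w.mem_F_of_le hcB (by omega)) (hBs _ _ _ _ ha hb)
    have e : ((B.map ψ h1).br - B.br - lieBracket G Y) a b =
        (ψ c - c + Y c) + (c - (B.br a b + B.br (Y a) b + B.br a (Y b))) - Y (c - B.br a b) +
          (B.br - G) (Y a) b + (B.br - G) a (Y b) - Y ((B.br - G) a b) := by
      simp only [LinearMap.sub_apply, GradedPoissonBracket.map_br, lieBracket_apply, map_sub, ← hc]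
      abel
    rw [e]
    refine Submodule.sub_mem _ (Submodule.add_mem _ (Submodule.add_mem _ (Submodule.sub_mem _
      (Submodule.add_mem _ ?_ ?_) ?_) ?_) ?_) ?_
    · exact w.mem_F_of_le (h2 _ _ hcF) (by omega)
    · exact w.mem_F_of_le hc' (by omega)
    · exact w.mem_F_of_le (hY.F_mem hcB) (by omega)
    · exact w.mem_F_of_le (hB _ _ _ _ Ya hb) (by omega)
    · exact w.mem_F_of_le (hB _ _ _ _ ha Yb) (by omega)
    · exact w.mem_F_of_le (hY.F_mem (hB _ _ _ _ ha hb)) (by omega)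

theorem isFibreCocycle_lead_sub (hG : IsFibreBracket w G) (hj : 0 ≤ j)
    (B B' : GradedPoissonBracket 𝒜) (hB : w.Shift (B.br - G) 0) (h : w.Shift (B'.br - B.br) j) :
    IsFibreCocycle w G j (w.lead (B'.br - B.br) j) where
  toIsBiderivation := (B'.isBiderivation.sub B.isBiderivation).lead w j
  W_mem := WeightDecomposition.lead_mem _ _
  cocycle {k l n m p a b c} hk hl hn hm hp := by
    have hBs : w.Shift B.br (-2) := hG.shift_of_sub hB
    rw [← hG.lead_eq hB]
    refine WeightDecomposition.mixedJacobi_lead hBs h hn hm hp _ ?_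
    exact w.mem_F_of_le (B.mixedJacobi_sub_mem w B' hj h hk hl hn hm hp) (by omega)

theorem FrameCover.unipotentEquiv (C : FrameCover w G I ι) (hG : IsFibreBracket w G)
    (B B' : GradedPoissonBracket 𝒜) (hB' : w.Shift (B'.br - G) 0) (hj : 0 ≤ j)
    (h : w.Shift (B'.br - B.br) j)
    (h0 : j = 0 → ∀ f ∈ w.W 0, ∀ g ∈ w.W 0, (B'.br - B.br) f g ∈ w.F 1) :
    UnipotentEquiv w B B' := by
  have shift0 : ∀ B : GradedPoissonBracket 𝒜, w.Shift (B'.br - B.br) j → w.Shift (B.br - G) 0 :=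
    fun B h => by
      have := hB'.sub (h.mono hj)
      rwa [show B'.br - G - (B'.br - B.br) = B.br - G by abel] at this
  obtain ⟨d, hd⟩ : ∃ d : ℕ, (d : ℤ) = max 0 (w.top + 1 - j) := ⟨_, Int.toNat_of_nonneg (by simp)⟩
  induction d generalizing j B with
  | zero =>
    have e := h.eq_zero (by simp only [Nat.cast_zero] at hd; omega)
    refine ⟨AlgEquiv.refl, fun _ _ => Iff.rfl, fun n a _ => by simp, fun a b => ?_⟩
    have e' : B'.br a b - B.br a b = 0 := LinearMap.congr_fun₂ e a b
    simp [sub_eq_zero.1 e']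
  | succ d ih =>
    have hL := isFibreCocycle_lead_sub hG hj B B' (shift0 B h) h
    have hL0 : ∀ f ∈ w.W 0, ∀ g ∈ w.W 0, w.lead (B'.br - B.br) j f g = 0 := fun f hf g hg => by
      rcases hj.eq_or_lt with hj0 | hj0
      · rw [WeightDecomposition.lead_apply _ _ hf hg]
        exact h0 hj0.symm f hf g hg _ (by omega)
      · exact C.apply_eq_zero hG hL hj0 hf hg
    obtain ⟨Y, hY, hYL⟩ := C.exists_vectorField_function hG hL hj hL0
    obtain ⟨B₁, hBB₁, hB₁⟩ := exists_unipotentEquiv_sub_lieBracket hG hj hY B (shift0 B h)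
    have e₁ : B'.br - B₁.br =
        (B'.br - B.br) - lieBracket G Y - (B₁.br - B.br - lieBracket G Y) := by abel
    have h₁ : w.Shift (B'.br - B₁.br) j := by
      rw [e₁]
      exact (h.sub (hY.shift_lieBracket hG)).sub (hB₁.mono (by omega))
    have hL₁ := isFibreCocycle_lead_sub hG hj B₁ B' (shift0 B₁ h₁) h₁
    have hL₁0 : ∀ {f}, f ∈ w.W 0 → ∀ b, w.lead (B'.br - B₁.br) j f b = 0 := fun {f} hf b => by
      refine w.induction (p := fun b => w.lead (B'.br - B₁.br) j f b = 0) (fun a b ha hb => ?_)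
        (fun _ m b _ hb => ?_) b
      · rw [map_add, ha, hb, add_zero]
      · rw [WeightDecomposition.lead_apply _ _ hf hb, e₁, LinearMap.sub_apply, LinearMap.sub_apply,
          LinearMap.sub_apply, LinearMap.sub_apply, hYL f hf b, map_sub, map_sub,
          w.proj_of_mem (hL.W_mem hf hb), ← WeightDecomposition.lead_apply _ _ hf hb, sub_self,
          zero_sub, neg_eq_zero]
        exact hB₁ 0 m f b (w.W_le_F le_rfl hf) (w.W_le_F le_rfl hb) _ (by omega)
    obtain ⟨Y₁, hY₁, hYL₁⟩ := C.exists_vectorField_of_eq_zero hG hL₁ hj hL₁0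
    obtain ⟨B₂, hBB₂, hB₂⟩ := exists_unipotentEquiv_sub_lieBracket hG hj hY₁ B₁ (shift0 B₁ h₁)
    have h₂ : w.Shift (B'.br - B₂.br) (j + 1) := by
      rw [show B'.br - B₂.br = (B'.br - B₁.br - w.lead (B'.br - B₁.br) j) -
        (B₂.br - B₁.br - lieBracket G Y₁) by rw [hYL₁]; abel]
      exact h₁.sub_lead.sub hB₂
    refine (hBB₁.trans hBB₂).trans (ih B₂ (by omega) h₂ (by omega) (fun B h => ?_) ?_)
    · have := hB'.sub (h.mono (by omega : 0 ≤ j + 1))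
      rwa [show B'.br - G - (B'.br - B.br) = B.br - G by abel] at this
    · push_cast at hd
      omega

end Compare

/-! ### Comparison of charges -/

section Charge

variable {A : Type*} [Ring A] [Algebra ℝ A] {𝒜 : ℤ → Submodule ℝ A}
  {w : WeightDecomposition 𝒜} {G : A →ₗ[ℝ] A →ₗ[ℝ] A} {I ι : Type*} [Fintype ι] {j : ℤ} {τ : A}

theorem IsBiderivation.symm_of_odd {D : A →ₗ[ℝ] A →ₗ[ℝ] A} (hD : IsBiderivation 𝒜 D) {a b : A}
    (ha : a ∈ 𝒜 1) (hb : b ∈ 𝒜 1) : D a b = D b a := by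
  rw [hD.skew ha hb]
  simp

theorem IsFibreBracket.charge_proj (hG : IsFibreBracket w G) {B : GradedPoissonBracket 𝒜}
    (hB : w.Shift (B.br - G) 0) (hτ : τ ∈ 𝒜 1) (hτW : τ ∈ w.W 1) {Ω Ω' : A} (hΩ : Ω ∈ 𝒜 1)
    (hΩ' : Ω' ∈ 𝒜 1) (mc : B.br Ω Ω = 0) (mc' : B.br Ω' Ω' = 0) (low : Ω - τ ∈ w.F 2)
    (low' : Ω' - τ ∈ w.F 2) (h : Ω' - Ω ∈ w.F j) : G τ (w.proj j (Ω' - Ω)) = 0 := by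
  have hBs := hG.shift_of_sub hB
  set θ := w.proj j (Ω' - Ω) with hθ
  have hθW : θ ∈ w.W j := w.proj_mem _ _
  have hθF := w.W_le_F le_rfl hθW
  have hθd : θ ∈ 𝒜 1 := w.proj_deg _ (Submodule.sub_mem _ hΩ' hΩ)
  have hδ : Ω' - Ω - θ ∈ w.F (j + 1) := w.sub_proj_mem h
  have hr : Ω + Ω' - (2 : ℝ) • τ ∈ w.F 2 := by
    rw [show Ω + Ω' - (2 : ℝ) • τ = (Ω - τ) + (Ω' - τ) by module]
    exact Submodule.add_mem _ low low'
  have hs : Ω + Ω' ∈ w.F 1 := by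
    rw [show Ω + Ω' = (Ω + Ω' - (2 : ℝ) • τ) + (2 : ℝ) • τ by module]
    exact Submodule.add_mem _ (w.mem_F_of_le hr (by omega))
      (Submodule.smul_mem _ _ (w.W_le_F le_rfl hτW))
  have e0 : B.br (Ω' - Ω) (Ω + Ω') = 0 := by
    simp only [map_sub, map_add, LinearMap.sub_apply, mc, mc',
      B.isBiderivation.symm_of_odd hΩ' hΩ]
    abel
  have e1 : (2 : ℝ) • G θ τ = -B.br (Ω' - Ω - θ) (Ω + Ω') - B.br θ (Ω + Ω' - (2 : ℝ) • τ) -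
      (2 : ℝ) • (B.br - G) θ τ := by
    have : B.br (Ω' - Ω - θ) (Ω + Ω') = B.br (Ω' - Ω) (Ω + Ω') - B.br θ (Ω + Ω') := by
      rw [map_sub B.br (Ω' - Ω) θ, LinearMap.sub_apply]
    rw [this, e0]
    simp only [map_sub, map_smul, LinearMap.sub_apply]
    module
  have e2 : (2 : ℝ) • G θ τ ∈ w.F j := by
    rw [e1]
    refine Submodule.sub_mem _ (Submodule.sub_mem _ (Submodule.neg_mem _ ?_) ?_)
      (Submodule.smul_mem _ _ ?_)
    · exact w.mem_F_of_le (hBs _ _ _ _ hδ hs) (by omega)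
    · exact w.mem_F_of_le (hBs _ _ _ _ hθF hr) (by omega)
    · exact w.mem_F_of_le (hB _ _ _ _ hθF (w.W_le_F le_rfl hτW)) (by omega)
  have e3 : (2 : ℝ) • G θ τ = 0 := w.eq_zero_of_mem_W_of_mem_F
    (Submodule.smul_mem _ _ (hG.W_mem hθW hτW)) e2 (by omega)
  rw [hG.symm_of_odd hτ hθd]
  exact (smul_eq_zero.1 e3).resolve_left two_ne_zero

/-- The Koszul complex of `τ` is exact in degree `1` and weight at least `2`. -/
def KoszulExact (w : WeightDecomposition 𝒜) (G : A →ₗ[ℝ] A →ₗ[ℝ] A) (τ : A) : Prop :=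
  ∀ j : ℤ, 2 ≤ j → ∀ θ ∈ 𝒜 1, θ ∈ w.W j → G τ θ = 0 →
    ∃ x ∈ 𝒜 0, x ∈ w.W (j + 1) ∧ G τ x = θ

theorem IsFibreBracket.exists_algEquiv_charge (hG : IsFibreBracket w G)
    (B : GradedPoissonBracket 𝒜) (hB : w.Shift (B.br - G) 0) (hτ : τ ∈ 𝒜 1) (hτW : τ ∈ w.W 1)
    (hK : KoszulExact w G τ) (Ω Ω' : A) (hΩ : Ω ∈ 𝒜 1) (hΩ' : Ω' ∈ 𝒜 1) (mc : B.br Ω Ω = 0)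
    (mc' : B.br Ω' Ω' = 0) (low : Ω - τ ∈ w.F 2) (low' : Ω' - τ ∈ w.F 2) (hj : 2 ≤ j)
    (h : Ω' - Ω ∈ w.F j) :
    ∃ ψ : A ≃ₐ[ℝ] A, (∀ k a, ψ a ∈ 𝒜 k ↔ a ∈ 𝒜 k) ∧
      (∀ a b, ψ (B.br a b) = B.br (ψ a) (ψ b)) ∧ ψ Ω = Ω' := by
  have hBs := hG.shift_of_sub hB
  obtain ⟨d, hd⟩ : ∃ d : ℕ, (d : ℤ) = max 0 (w.top + 1 - j) := ⟨_, Int.toNat_of_nonneg (by simp)⟩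
  induction d generalizing j Ω with
  | zero =>
    have e := w.eq_zero_of_mem_F h (by simp only [Nat.cast_zero] at hd; omega)
    exact ⟨AlgEquiv.refl, fun _ _ => Iff.rfl, fun _ _ => rfl, (sub_eq_zero.1 e).symm⟩
  | succ d ih =>
    obtain ⟨x, hx0, hxW, hx⟩ := hK j hj _ (w.proj_deg j (Submodule.sub_mem _ hΩ' hΩ))
      (w.proj_mem j _) (hG.charge_proj hB hτ hτW hΩ hΩ' mc mc' low low' h)
    have hxF := w.W_le_F le_rfl hxW
    have hy0 : -x ∈ 𝒜 0 := Submodule.neg_mem _ hx0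
    have hyF : -x ∈ w.F (j + 1) := Submodule.neg_mem _ hxF
    have hX : ∀ n, ∀ a ∈ w.F n, B.br (-x) a ∈ w.F (n + (j - 1)) := fun n a ha =>
      w.mem_F_of_le (hBs _ _ _ _ hyF ha) (by omega)
    have hΩF : Ω ∈ w.F 1 := by
      rw [← sub_add_cancel Ω τ]
      exact Submodule.add_mem _ (w.mem_F_of_le low (by omega)) (w.W_le_F le_rfl hτW)
    obtain ⟨ψ, h1, h2, -, h3⟩ := exists_algEquiv_of_derivation w (by omega : 1 ≤ j - 1)
      (fun a b => by
        refine w.induction (p := fun a => B.br (-x) (a * b) = B.br (-x) a * b + a * B.br (-x) b)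
          (fun a a' ha ha' => ?_) (fun k n a hk _ => ?_) a
        · rw [add_mul, map_add, map_add, ha, ha', add_mul, add_mul]
          abel
        · rw [B.leibniz b hy0 hk]
          simp)
      (fun k a ha => by simpa using B.br_mem hy0 ha) hX
    have hψB : ∀ a b, ψ (B.br a b) = B.br (ψ a) (ψ b) := h3 B.br fun a b => by
      refine w.induction
        (p := fun a => B.br (-x) (B.br a b) = B.br (B.br (-x) a) b + B.br a (B.br (-x) b))
        (fun a a' ha ha' => ?_) (fun k n a hk _ => ?_) a
      · simp only [map_add, LinearMap.add_apply, ha, ha']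
        abel
      · rw [B.jacobi b hy0 hk]
        simp
    have hψΩ : ψ Ω - Ω ∈ w.F j := by
      rw [← sub_add_cancel (ψ Ω - Ω) (B.br (-x) Ω)]
      exact Submodule.add_mem _ (w.mem_F_of_le (h2 1 Ω hΩF) (by omega))
        (w.mem_F_of_le (hX 1 Ω hΩF) (by omega))
    have hnew : Ω' - ψ Ω ∈ w.F (j + 1) := by
      have hGx : G (-x) τ = w.proj j (Ω' - Ω) := by
        rw [hG.skew hy0 hτ, map_neg, hx]
        simp
      have e : Ω' - ψ Ω = (Ω' - Ω - w.proj j (Ω' - Ω)) - (ψ Ω - Ω - B.br (-x) Ω) -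
          B.br (-x) (Ω - τ) - (B.br - G) (-x) τ := by
        rw [LinearMap.sub_apply, LinearMap.sub_apply, hGx, map_sub (B.br (-x))]
        abel
      rw [e]
      refine Submodule.sub_mem _ (Submodule.sub_mem _ (Submodule.sub_mem _ (w.sub_proj_mem h) ?_)
        ?_) ?_
      · exact w.mem_F_of_le (h2 1 Ω hΩF) (by omega)
      · exact w.mem_F_of_le (hBs _ _ _ _ hyF low) (by omega)
      · exact w.mem_F_of_le (hB _ _ _ _ hyF (w.W_le_F le_rfl hτW)) (by omega)
    obtain ⟨ψ', h1', h2', h3'⟩ := ih (ψ Ω) ((h1 1 Ω).2 hΩ) (by rw [← hψB, mc, map_zero])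
      (by
        rw [← sub_add_sub_cancel (ψ Ω) Ω τ]
        exact Submodule.add_mem _ (w.mem_F_of_le hψΩ hj) low)
      (by omega) hnew (by push_cast at hd; omega)
    exact ⟨ψ.trans ψ', fun k a => (h1' k _).trans (h1 k a), fun a b => by simp [hψB, h2'], h3'⟩

/-- Brackets with the same leading part along the fibres, equal up to higher order on functions,
and charges with the same leading part, are intertwined by an automorphism. -/
theorem FrameCover.exists_algEquiv (C : FrameCover w G I ι) (hG : IsFibreBracket w G)
    (B B' : GradedPoissonBracket 𝒜) (hB : w.Shift (B.br - G) 0) (hB' : w.Shift (B'.br - G) 0)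
    (h0 : ∀ f ∈ w.W 0, ∀ g ∈ w.W 0, (B'.br - B.br) f g ∈ w.F 1) (hτ : τ ∈ 𝒜 1)
    (hτW : τ ∈ w.W 1) (hK : KoszulExact w G τ) (Ω Ω' : A) (hΩ : Ω ∈ 𝒜 1) (hΩ' : Ω' ∈ 𝒜 1)
    (mc : B.br Ω Ω = 0) (mc' : B'.br Ω' Ω' = 0) (low : Ω - τ ∈ w.F 2) (low' : Ω' - τ ∈ w.F 2) :
    ∃ ψ : A ≃ₐ[ℝ] A, (∀ k a, ψ a ∈ 𝒜 k ↔ a ∈ 𝒜 k) ∧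
      (∀ a b, ψ (B.br a b) = B'.br (ψ a) (ψ b)) ∧ ψ Ω = Ω' := by
  have hd : w.Shift (B'.br - B.br) 0 := by
    have := hB'.sub hB
    rwa [show B'.br - G - (B.br - G) = B'.br - B.br by abel] at this
  obtain ⟨ψ, h1, h2, h3⟩ := C.unipotentEquiv hG B B' hB' le_rfl hd fun _ => h0
  have hΩF : Ω ∈ w.F 1 := by
    rw [← sub_add_cancel Ω τ]
    exact Submodule.add_mem _ (w.mem_F_of_le low (by omega)) (w.W_le_F le_rfl hτW)
  have low₁ : ψ Ω - τ ∈ w.F 2 := by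
    rw [← sub_add_sub_cancel (ψ Ω) Ω τ]
    exact Submodule.add_mem _ (w.mem_F_of_le (h2 1 Ω hΩF) (by omega)) low
  obtain ⟨ψ', h1', h2', h3'⟩ := hG.exists_algEquiv_charge B' hB' hτ hτW hK (ψ Ω) Ω'
    ((h1 1 Ω).2 hΩ) hΩ' (by rw [← h3, mc, map_zero]) mc' low₁ low' le_rfl (by
      rw [← sub_sub_sub_cancel_right Ω' (ψ Ω) τ]
      exact Submodule.sub_mem _ low' low₁)
  exact ⟨ψ.trans ψ', fun k a => (h1' k _).trans (h1 k a), fun a b => by simp [h3, h2'], h3'⟩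

theorem isFibreBracket_lead (B : GradedPoissonBracket 𝒜) (hB : w.Shift B.br (-2))
    (h0 : ∀ {f}, f ∈ w.W 0 → ∀ b, w.lead B.br (-2) f b = 0) :
    IsFibreBracket w (w.lead B.br (-2)) where
  toIsBiderivation := B.isBiderivation.lead w (-2)
  W_mem ha hb := WeightDecomposition.lead_mem B.br (-2) ha hb
  eq_zero := h0
  jacobi {k l n m p a b c} hk hl hn hm hp := by
    have e : mixedJacobi B.br B.br ((-1 : ℝ) ^ (k * l)) a b c = 0 := by
      simp only [mixedJacobi, B.jacobi c hk hl]
      module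
    have h := WeightDecomposition.mixedJacobi_lead hB hB hn hm hp ((-1 : ℝ) ^ (k * l))
      (by rw [e]; exact Submodule.zero_mem _)
    simp only [mixedJacobi] at h
    have h2 : (2 : ℝ) • (w.lead B.br (-2) a (w.lead B.br (-2) b c) -
        (w.lead B.br (-2) (w.lead B.br (-2) a b) c +
          (-1 : ℝ) ^ (k * l) • w.lead B.br (-2) b (w.lead B.br (-2) a c))) = 0 := by
      linear_combination (norm := module) h
    exact sub_eq_zero.1 ((smul_eq_zero.1 h2).resolve_left two_ne_zero)

end Charge

/-! ### Gradings of the fibre algebra -/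

section FibreGrading

variable {W : Type*} [AddCommGroup W] [Module ℝ W]

theorem ι_eq_ghost_add_ghostMomentum (v : W × Module.Dual ℝ W) :
    ExteriorAlgebra.ι ℝ v = ghost v.1 + ghostMomentum v.2 := by
  rw [ghost, ghostMomentum, LinearMap.comp_apply, LinearMap.comp_apply, ← map_add]
  simp

theorem ι_anticomm {M : Type*} [AddCommGroup M] [Module ℝ M] (x y : M) :
    ExteriorAlgebra.ι ℝ x * ExteriorAlgebra.ι ℝ y =
      -(ExteriorAlgebra.ι ℝ y * ExteriorAlgebra.ι ℝ x) :=
  eq_neg_of_add_eq_zero_left (ExteriorAlgebra.ι_add_mul_swap x y)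

/-- The coaction of the grading in which ghosts have degree `a` and ghost momenta degree `b`. -/
def grading (a b : ℤ) : GhostAlg W →ₐ[ℝ] AddMonoidAlgebra (GhostAlg W) ℤ :=
  ExteriorAlgebra.lift ℝ
    ⟨AddMonoidAlgebra.lsingle a ∘ₗ ghost ∘ₗ LinearMap.fst ℝ W (Module.Dual ℝ W) +
      AddMonoidAlgebra.lsingle b ∘ₗ ghostMomentum ∘ₗ LinearMap.snd ℝ W (Module.Dual ℝ W),
      fun v => by
        simp only [LinearMap.add_apply, LinearMap.comp_apply, LinearMap.fst_apply,
          LinearMap.snd_apply, AddMonoidAlgebra.lsingle_apply, mul_add, add_mul,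
          AddMonoidAlgebra.single_mul_single]
        simp only [ghost, ghostMomentum, LinearMap.comp_apply, ExteriorAlgebra.ι_sq_zero,
          AddMonoidAlgebra.single_zero, zero_add, add_zero]
        rw [ι_anticomm, add_comm b a, ← AddMonoidAlgebra.single_add]
        simp⟩

theorem grading_ghost (a b : ℤ) (v : W) :
    grading a b (ghost v) = AddMonoidAlgebra.single a (ghost v) := by
  change grading a b (ExteriorAlgebra.ι ℝ (v, 0)) = _
  rw [grading, ExteriorAlgebra.lift_ι_apply]
  simp

theorem grading_ghostMomentum (a b : ℤ) (v : Module.Dual ℝ W) :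
    grading a b (ghostMomentum v) = AddMonoidAlgebra.single b (ghostMomentum v) := by
  change grading a b (ExteriorAlgebra.ι ℝ (0, v)) = _
  rw [grading, ExteriorAlgebra.lift_ι_apply]
  simp

variable (W) in
/-- The part of degree `n` if ghosts have degree `a` and ghost momenta degree `b`. -/
def gradedPart (a b n : ℤ) : Submodule ℝ (GhostAlg W) where
  carrier := {x | grading a b x = AddMonoidAlgebra.single n x}
  add_mem' {x y} hx hy := by
    simp only [Set.mem_ofPred_eq] at hx hy ⊢
    rw [map_add, hx, hy, AddMonoidAlgebra.single_add]
  zero_mem' := by simp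
  smul_mem' r x hx := by
    simp only [Set.mem_ofPred_eq] at hx ⊢
    rw [map_smul, hx, AddMonoidAlgebra.smul_single]

theorem mem_gradedPart {a b n : ℤ} {x : GhostAlg W} :
    x ∈ gradedPart W a b n ↔ grading a b x = AddMonoidAlgebra.single n x := Iff.rfl

theorem mul_mem_gradedPart {a b n m : ℤ} {x y : GhostAlg W} (hx : x ∈ gradedPart W a b n)
    (hy : y ∈ gradedPart W a b m) : x * y ∈ gradedPart W a b (n + m) := by
  rw [mem_gradedPart] at *
  rw [map_mul, hx, hy, AddMonoidAlgebra.single_mul_single]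

theorem one_mem_gradedPart (a b : ℤ) : (1 : GhostAlg W) ∈ gradedPart W a b 0 := by
  rw [mem_gradedPart, map_one]
  rfl

theorem algebraMap_mem_gradedPart (a b : ℤ) (r : ℝ) :
    algebraMap ℝ (GhostAlg W) r ∈ gradedPart W a b 0 := by
  rw [Algebra.algebraMap_eq_smul_one]
  exact Submodule.smul_mem _ _ (one_mem_gradedPart a b)

theorem pow_le_gradedPart {a b c : ℤ} {U : Submodule ℝ (GhostAlg W)}
    (h : U ≤ gradedPart W a b c) (n : ℕ) : U ^ n ≤ gradedPart W a b (n * c) := by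
  induction n with
  | zero =>
    rw [pow_zero, Submodule.one_le]
    simpa using one_mem_gradedPart a b
  | succ n ih =>
    rw [pow_succ, Submodule.mul_le]
    intro x hx y hy
    have := mul_mem_gradedPart (ih hx) (h hy)
    rwa [show (n : ℤ) * c + c = ((n + 1 : ℕ) : ℤ) * c by push_cast; ring] at this

theorem bideg_le_gradedPart (a b : ℤ) (p q : ℕ) :
    bideg W p q ≤ gradedPart W a b (p * a + q * b) := by
  rw [bideg, Submodule.mul_le]
  intro x hx y hy
  refine mul_mem_gradedPart (pow_le_gradedPart ?_ p hx) (pow_le_gradedPart ?_ q hy)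
  · rintro _ ⟨v, rfl⟩
    exact grading_ghost a b v
  · rintro _ ⟨v, rfl⟩
    exact grading_ghostMomentum a b v

theorem commute_range_ghost :
    Commute (LinearMap.range (ghost (W := W))) (LinearMap.range (ghostMomentum (W := W))) := by
  apply le_antisymm <;> rw [Submodule.mul_le] <;> rintro _ ⟨v, rfl⟩ _ ⟨ξ, rfl⟩
  · rw [ghost, ghostMomentum, LinearMap.comp_apply, LinearMap.comp_apply, ι_anticomm]
    exact Submodule.neg_mem _ (Submodule.mul_mem_mul ⟨ξ, rfl⟩ ⟨v, rfl⟩)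
  · rw [ghost, ghostMomentum, LinearMap.comp_apply, LinearMap.comp_apply, ι_anticomm]
    exact Submodule.neg_mem _ (Submodule.mul_mem_mul ⟨ξ, rfl⟩ ⟨v, rfl⟩)

theorem bideg_mul_bideg (p q p' q' : ℕ) :
    bideg W p q * bideg W p' q' = bideg W (p + p') (q + q') := by
  rw [bideg, bideg, bideg, pow_add, pow_add, mul_assoc, mul_assoc, ← mul_assoc _ (_ ^ p') (_ ^ q'),
    ← (commute_range_ghost.pow_pow p' q).eq, mul_assoc]

variable (W) in
theorem iSup_bideg : ⨆ (p : ℕ) (q : ℕ), bideg W p q = ⊤ := by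
  rw [eq_top_iff]
  rintro x -
  have hle : ∀ p q, bideg W p q ≤ ⨆ (p : ℕ) (q : ℕ), bideg W p q := fun p q =>
    le_iSup₂ (f := fun p q => bideg W p q) p q
  induction x using ExteriorAlgebra.induction with
  | algebraMap r =>
    refine hle 0 0 ?_
    rw [bideg, pow_zero, pow_zero, one_mul]
    exact Submodule.algebraMap_mem r
  | ι v =>
    rw [ι_eq_ghost_add_ghostMomentum]
    refine Submodule.add_mem _ (hle 1 0 ?_) (hle 0 1 ?_)
    · rw [bideg, pow_zero, pow_one, mul_one]
      exact ⟨_, rfl⟩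
    · rw [bideg, pow_zero, pow_one, one_mul]
      exact ⟨_, rfl⟩
  | mul x y hx hy =>
    have : (⨆ (p : ℕ) (q : ℕ), bideg W p q) * (⨆ (p : ℕ) (q : ℕ), bideg W p q) ≤
        ⨆ (p : ℕ) (q : ℕ), bideg W p q := by
      simp only [Submodule.iSup_mul, Submodule.mul_iSup, bideg_mul_bideg]
      exact iSup₂_le fun p q => iSup₂_le fun p' q' => hle _ _
    exact this (Submodule.mul_mem_mul hx hy)
  | add x y hx hy => exact Submodule.add_mem _ hx hy

theorem bideg_induction {P : GhostAlg W → Prop} (add : ∀ x y, P x → P y → P (x + y))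
    (hom : ∀ p q x, x ∈ bideg W p q → P x) (x : GhostAlg W) : P x := by
  have hx : x ∈ ⨆ pq : ℕ × ℕ, bideg W pq.1 pq.2 := by
    rw [iSup_prod, iSup_bideg]
    trivial
  exact Submodule.iSup_induction _ (motive := P) hx (fun pq x hx => hom _ _ x hx)
    (hom 0 0 0 (Submodule.zero_mem _)) add

theorem totalDeg_induction {k : ℤ} {P : GhostAlg W → Prop} (add : ∀ x y, P x → P y → P (x + y))
    (hom : ∀ (p q : ℕ) x, (p : ℤ) - q = k → x ∈ bideg W p q → P x) {x : GhostAlg W}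
    (hx : x ∈ totalDeg W k) : P x := by
  have h0 : P 0 := hom k.toNat (-k).toNat 0 (by omega) (Submodule.zero_mem _)
  have hx' : x ∈ ⨆ i : {pq : ℕ × ℕ // (pq.1 : ℤ) - pq.2 = k}, bideg W i.1.1 i.1.2 := by
    rw [iSup_subtype, iSup_prod]
    exact hx
  exact Submodule.iSup_induction _ (motive := P) hx' (fun pq x hx => hom _ _ x pq.2 hx) h0 add

/-- The projection to the part of degree `n` if ghosts have degree `a` and ghost momenta `b`. -/
def gradedProj (a b n : ℤ) : GhostAlg W →ₗ[ℝ] GhostAlg W where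
  toFun x := (grading a b x).coeff n
  map_add' x y := by rw [map_add]; rfl
  map_smul' r x := by rw [map_smul]; rfl

theorem gradedProj_of_mem {a b n : ℤ} {x : GhostAlg W} (hx : x ∈ gradedPart W a b n) :
    gradedProj a b n x = x := by
  change (grading a b x).coeff n = x
  rw [mem_gradedPart.1 hx, AddMonoidAlgebra.coeff_single, Finsupp.single_eq_same]

theorem gradedProj_of_ne {a b n m : ℤ} {x : GhostAlg W} (hx : x ∈ gradedPart W a b n)
    (h : m ≠ n) : gradedProj a b m x = 0 := by
  change (grading a b x).coeff m = 0
  rw [mem_gradedPart.1 hx, AddMonoidAlgebra.coeff_single, Finsupp.single_eq_of_ne h]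

theorem gradedProj_mem_of_bideg (a b n : ℤ) {p q : ℕ} {x : GhostAlg W} (hx : x ∈ bideg W p q) :
    gradedProj a b n x = x ∧ n = p * a + q * b ∨ gradedProj a b n x = 0 := by
  rcases eq_or_ne n (p * a + q * b) with rfl | h
  · exact Or.inl ⟨gradedProj_of_mem (bideg_le_gradedPart a b p q hx), rfl⟩
  · exact Or.inr (gradedProj_of_ne (bideg_le_gradedPart a b p q hx) h)

theorem gradedProj_mem (a b n : ℤ) (x : GhostAlg W) : gradedProj a b n x ∈ gradedPart W a b n := by
  refine bideg_induction (P := fun x => gradedProj a b n x ∈ gradedPart W a b n)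
    (fun x y hx hy => by rw [map_add]; exact Submodule.add_mem _ hx hy) (fun p q x hx => ?_) x
  rcases gradedProj_mem_of_bideg a b n hx with ⟨h, rfl⟩ | h <;> rw [h]
  · exact bideg_le_gradedPart a b p q hx
  · exact Submodule.zero_mem _

variable (W) in
theorem totalDeg_eq (k : ℤ) : totalDeg W k = gradedPart W 1 (-1) k := by
  apply le_antisymm
  · refine iSup_le fun p => iSup_le fun q => iSup_le fun h => ?_
    rw [← h]
    have := bideg_le_gradedPart (W := W) 1 (-1) p q
    rwa [mul_one, mul_neg_one, ← sub_eq_add_neg] at this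
  · intro x hx
    rw [← gradedProj_of_mem hx]
    refine bideg_induction (P := fun x => gradedProj 1 (-1) k x ∈ totalDeg W k)
      (fun x y hx hy => by rw [map_add]; exact Submodule.add_mem _ hx hy) (fun p q x hx => ?_) x
    rcases gradedProj_mem_of_bideg 1 (-1) k hx with ⟨h, hk⟩ | h <;> rw [h]
    · exact Submodule.mem_iSup_of_mem p (Submodule.mem_iSup_of_mem q
        (Submodule.mem_iSup_of_mem (by omega) hx))
    · exact Submodule.zero_mem _

theorem gradedProj_totalDeg (n : ℤ) {k : ℤ} {x : GhostAlg W} (hx : x ∈ totalDeg W k) :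
    gradedProj 1 1 n x ∈ totalDeg W k := by
  refine totalDeg_induction (P := fun x => gradedProj 1 1 n x ∈ totalDeg W k)
    (fun x y hx hy => by rw [map_add]; exact Submodule.add_mem _ hx hy) (fun p q x hk hx => ?_) hx
  rcases gradedProj_mem_of_bideg 1 1 n hx with ⟨h, -⟩ | h <;> rw [h]
  · exact Submodule.mem_iSup_of_mem p (Submodule.mem_iSup_of_mem q
        (Submodule.mem_iSup_of_mem hk hx))
  · exact Submodule.zero_mem _

theorem mem_bideg_of_mem_totalDeg {k : ℤ} {p q : ℕ} (hk : (p : ℤ) - q = k) {x : GhostAlg W}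
    (hx : x ∈ totalDeg W k) (hx' : x ∈ gradedPart W 1 1 (p + q)) : x ∈ bideg W p q := by
  rw [← gradedProj_of_mem hx']
  refine totalDeg_induction (P := fun x => gradedProj 1 1 (p + q) x ∈ bideg W p q)
    (fun x y hx hy => by rw [map_add]; exact Submodule.add_mem _ hx hy)
    (fun p' q' x hk' hx => ?_) hx
  rcases gradedProj_mem_of_bideg 1 1 (p + q) hx with ⟨h, h'⟩ | h <;> rw [h]
  · obtain rfl : p = p' := by omega
    obtain rfl : q = q' := by omega
    exact hx
  · exact Submodule.zero_mem _

theorem eq_zero_of_mem_totalDeg {k n : ℤ} (hk : ¬∃ p q : ℕ, (p : ℤ) - q = k ∧ (p : ℤ) + q = n)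
    {x : GhostAlg W} (hx : x ∈ totalDeg W k) (hx' : x ∈ gradedPart W 1 1 n) : x = 0 := by
  rw [← gradedProj_of_mem hx']
  refine totalDeg_induction (P := fun x => gradedProj 1 1 n x = 0)
    (fun x y hx hy => by rw [map_add, hx, hy, add_zero]) (fun p q x hk' hx => ?_) hx
  rcases gradedProj_mem_of_bideg 1 1 n hx with ⟨-, h'⟩ | h
  · exact absurd ⟨p, q, hk', by omega⟩ hk
  · exact h

theorem gradedProj_higher {p q : ℕ} {n : ℤ} (hn : n < p + q + 2) {x : GhostAlg W}
    (hx : x ∈ higher W p q) : gradedProj 1 1 n x = 0 := by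
  suffices higher W p q ≤ LinearMap.ker (gradedProj (W := W) 1 1 n) from this hx
  refine iSup_le fun P => iSup_le fun Q => iSup_le fun h x hx => ?_
  exact gradedProj_of_ne (bideg_le_gradedPart 1 1 P Q hx) (by omega)

theorem bideg_le_pow (p q : ℕ) :
    bideg W p q ≤ LinearMap.range (ExteriorAlgebra.ι ℝ (M := W × Module.Dual ℝ W)) ^ (p + q) := by
  rw [bideg, pow_add]
  refine mul_le_mul' (pow_le_pow_left' ?_ p) (pow_le_pow_left' ?_ q) <;>
  · rintro _ ⟨v, rfl⟩
    exact ⟨_, rfl⟩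

theorem pow_le_gradedPart_one (n : ℕ) :
    LinearMap.range (ExteriorAlgebra.ι ℝ (M := W × Module.Dual ℝ W)) ^ n ≤ gradedPart W 1 1 n := by
  have := pow_le_gradedPart (a := 1) (b := 1) (c := 1)
    (U := LinearMap.range (ExteriorAlgebra.ι ℝ (M := W × Module.Dual ℝ W))) ?_ n
  · rwa [mul_one] at this
  · rintro _ ⟨v, rfl⟩
    rw [ι_eq_ghost_add_ghostMomentum]
    exact Submodule.add_mem _ (grading_ghost 1 1 _) (grading_ghostMomentum 1 1 _)

theorem weight_induction {n : ℤ} {P : GhostAlg W → Prop} (h0 : P 0)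
    (add : ∀ x y, P x → P y → P (x + y))
    (hom : ∀ (m : ℕ) x, (m : ℤ) = n →
      x ∈ LinearMap.range (ExteriorAlgebra.ι ℝ (M := W × Module.Dual ℝ W)) ^ m → P x)
    {x : GhostAlg W} (hx : x ∈ gradedPart W 1 1 n) : P x := by
  rw [← gradedProj_of_mem hx]
  refine bideg_induction (P := fun x => P (gradedProj 1 1 n x))
    (fun x y hx hy => by rw [map_add]; exact add _ _ hx hy) (fun p q x hx => ?_) x
  rcases gradedProj_mem_of_bideg 1 1 n hx with ⟨h, h'⟩ | h <;> rw [h]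
  · exact hom (p + q) x (by push_cast; omega) (bideg_le_pow p q hx)
  · exact h0

theorem exists_algebraMap_of_weight_zero {x : GhostAlg W} (hx : x ∈ gradedPart W 1 1 0) :
    ∃ r : ℝ, x = algebraMap ℝ _ r := by
  refine weight_induction (P := fun x => ∃ r : ℝ, x = algebraMap ℝ _ r) ⟨0, by simp⟩ ?_ ?_ hx
  · rintro _ _ ⟨r, rfl⟩ ⟨s, rfl⟩
    exact ⟨r + s, by rw [map_add]⟩
  · intro m x hm hx
    obtain rfl : m = 0 := by omega
    rw [pow_zero] at hx
    obtain ⟨r, hr⟩ := Submodule.mem_one.1 hx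
    exact ⟨r, hr.symm⟩

theorem contractLeft_mem (d : Module.Dual ℝ (W × Module.Dual ℝ W)) {n : ℤ} {x : GhostAlg W}
    (hx : x ∈ gradedPart W 1 1 n) :
    CliffordAlgebra.contractLeft d x ∈ gradedPart W 1 1 (n - 1) := by
  refine weight_induction
    (P := fun x => CliffordAlgebra.contractLeft d x ∈ gradedPart W 1 1 (n - 1))
    (by rw [map_zero]; exact Submodule.zero_mem _)
    (fun x y hx hy => by rw [map_add]; exact Submodule.add_mem _ hx hy) (fun m x hm hx' => ?_) hx
  subst hm
  clear hx
  rename _ ∈ _ => hx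
  induction m generalizing x with
  | zero =>
    rw [pow_zero] at hx
    obtain ⟨r, rfl⟩ := Submodule.mem_one.1 hx
    rw [CliffordAlgebra.contractLeft_algebraMap]
    exact Submodule.zero_mem _
  | succ m ih =>
    rw [pow_succ'] at hx
    induction hx using Submodule.mul_induction_on' with
    | mem_mul_mem v hv y hy =>
      obtain ⟨v, rfl⟩ := hv
      rw [CliffordAlgebra.contractLeft_ι_mul]
      refine Submodule.sub_mem _ (Submodule.smul_mem _ _ ?_) ?_
      · have := pow_le_gradedPart_one m hy
        rwa [show (m : ℤ) = ((m + 1 : ℕ) : ℤ) - 1 by push_cast; ring] at this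
      · have h1 := pow_le_gradedPart_one (W := W) 1 (x := ExteriorAlgebra.ι ℝ v) (by
          rw [pow_one]
          exact ⟨v, rfl⟩)
        have := mul_mem_gradedPart h1 (ih y hy)
        rwa [show ((1 : ℕ) : ℤ) + (m - 1) = ((m + 1 : ℕ) : ℤ) - 1 by push_cast; ring] at this
    | add x _ y _ hx hy => rw [map_add]; exact Submodule.add_mem _ hx hy

theorem contractRight_mem (d : Module.Dual ℝ (W × Module.Dual ℝ W)) {n : ℤ} {x : GhostAlg W}
    (hx : x ∈ gradedPart W 1 1 n) :
    CliffordAlgebra.contractRight x d ∈ gradedPart W 1 1 (n - 1) := by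
  refine weight_induction
    (P := fun x => CliffordAlgebra.contractRight x d ∈ gradedPart W 1 1 (n - 1))
    (by rw [map_zero]; exact Submodule.zero_mem _)
    (fun x y hx hy => by rw [map_add]; exact Submodule.add_mem _ hx hy) (fun m x hm hx' => ?_) hx
  subst hm
  clear hx
  rename _ ∈ _ => hx
  induction m generalizing x with
  | zero =>
    rw [pow_zero] at hx
    obtain ⟨r, rfl⟩ := Submodule.mem_one.1 hx
    rw [CliffordAlgebra.contractRight_algebraMap]
    exact Submodule.zero_mem _
  | succ m ih =>
    rw [pow_succ] at hx
    induction hx using Submodule.mul_induction_on' with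
    | mem_mul_mem y hy v hv =>
      obtain ⟨v, rfl⟩ := hv
      rw [CliffordAlgebra.contractRight_mul_ι]
      refine Submodule.sub_mem _ (Submodule.smul_mem _ _ ?_) ?_
      · have := pow_le_gradedPart_one m hy
        rwa [show (m : ℤ) = ((m + 1 : ℕ) : ℤ) - 1 by push_cast; ring] at this
      · have h1 := pow_le_gradedPart_one (W := W) 1 (x := ExteriorAlgebra.ι ℝ v) (by
          rw [pow_one]
          exact ⟨v, rfl⟩)
        have := mul_mem_gradedPart (ih y hy) h1
        rwa [show ((m : ℤ) - 1) + (1 : ℕ) = ((m + 1 : ℕ) : ℤ) - 1 by push_cast; ring] at this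
    | add x _ y _ hx hy => rw [map_add]; exact Submodule.add_mem _ hx hy

theorem pairingBracket_mem {ι : Type*} [Fintype ι] (w : Module.Basis ι ℝ W) {n m : ℤ}
    {x y : GhostAlg W} (hx : x ∈ gradedPart W 1 1 n) (hy : y ∈ gradedPart W 1 1 m) :
    pairingBracket w x y ∈ gradedPart W 1 1 (n + m - 2) := by
  rw [show n + m - 2 = (n - 1) + (m - 1) by ring]
  exact Submodule.sum_mem _ fun i _ => Submodule.add_mem _
    (mul_mem_gradedPart (contractRight_mem _ hx) (contractLeft_mem _ hy))
    (mul_mem_gradedPart (contractRight_mem _ hx) (contractLeft_mem _ hy))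

/-- Graded commutativity of the fibre algebra. -/
theorem mul_comm_of_mem_pow {M : Type*} [AddCommGroup M] [Module ℝ M] {n m : ℕ}
    {x y : ExteriorAlgebra ℝ M} (hx : x ∈ LinearMap.range (ExteriorAlgebra.ι ℝ (M := M)) ^ n)
    (hy : y ∈ LinearMap.range (ExteriorAlgebra.ι ℝ (M := M)) ^ m) :
    x * y = (-1 : ℝ) ^ (n * m) • (y * x) := by
  have key : ∀ (v : M) (m : ℕ) (y : ExteriorAlgebra ℝ M),
      y ∈ LinearMap.range (ExteriorAlgebra.ι ℝ (M := M)) ^ m →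
      ExteriorAlgebra.ι ℝ v * y = (-1 : ℝ) ^ m • (y * ExteriorAlgebra.ι ℝ v) := by
    intro v m
    induction m with
    | zero =>
      intro y hy
      rw [pow_zero] at hy
      obtain ⟨r, rfl⟩ := Submodule.mem_one.1 hy
      rw [pow_zero, one_smul, Algebra.commutes]
    | succ m ih =>
      intro y hy
      rw [pow_succ] at hy
      induction hy using Submodule.mul_induction_on' with
      | mem_mul_mem y hy u hu =>
        obtain ⟨u, rfl⟩ := hu
        rw [← mul_assoc, ih y hy, smul_mul_assoc, mul_assoc, ι_anticomm v u, mul_neg, ← mul_assoc,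
          pow_succ, mul_neg_one, neg_smul, smul_neg]
      | add x _ y _ hx hy => rw [mul_add, add_mul, hx, hy, smul_add]
  induction n generalizing x with
  | zero =>
    rw [pow_zero] at hx
    obtain ⟨r, rfl⟩ := Submodule.mem_one.1 hx
    rw [zero_mul, pow_zero, one_smul, Algebra.commutes]
  | succ n ih =>
    rw [pow_succ] at hx
    induction hx using Submodule.mul_induction_on' with
    | mem_mul_mem x hx v hv =>
      obtain ⟨v, rfl⟩ := hv
      rw [mul_assoc, key v m y hy, mul_smul_comm, ← mul_assoc, ih hx, smul_mul_assoc, smul_smul,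
        mul_assoc, ← pow_add]
      congr 2
      ring
    | add x _ y _ hx hy => rw [mul_add, add_mul, hx, hy, smul_add]

theorem totalDeg_mul_comm {k l : ℤ} {x y : GhostAlg W} (hx : x ∈ totalDeg W k)
    (hy : y ∈ totalDeg W l) : x * y = (-1 : ℝ) ^ (k * l) • (y * x) := by
  refine totalDeg_induction (P := fun x => x * y = (-1 : ℝ) ^ (k * l) • (y * x))
    (fun x x' h h' => by rw [add_mul, mul_add, h, h', smul_add]) (fun p q x hk hx => ?_) hx
  refine totalDeg_induction (P := fun y => x * y = (-1 : ℝ) ^ (k * l) • (y * x))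
    (fun x x' h h' => by rw [add_mul, mul_add, h, h', smul_add]) (fun p' q' y hl hy => ?_) hy
  rw [mul_comm_of_mem_pow (bideg_le_pow p q hx) (bideg_le_pow p' q' hy), ← zpow_natCast]
  congr 1
  have e : ((p + q) * (p' + q') : ℕ) = k * l + 2 * ((p : ℤ) * q' + q * p') := by
    subst hk hl
    push_cast
    ring
  rw [e, sign_add, zpow_mul (-1 : ℝ) 2]
  norm_num

theorem eq_zero_of_weight_gt [FiniteDimensional ℝ W] {n : ℤ}
    (hn : (Module.finrank ℝ (W × Module.Dual ℝ W) : ℤ) < n) {x : GhostAlg W}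
    (hx : x ∈ gradedPart W 1 1 n) : x = 0 := by
  refine weight_induction (P := fun x => x = 0) rfl (fun x y hx hy => by rw [hx, hy, add_zero])
    (fun m x hm hx => ?_) hx
  have h := exteriorPower.finrank_eq (R := ℝ) (M := W × Module.Dual ℝ W) (n := m)
  rw [Nat.choose_eq_zero_of_lt (by omega)] at h
  have hb : ⋀[ℝ]^m (W × Module.Dual ℝ W) = ⊥ := Submodule.finrank_eq_zero.1 h
  have hx' : x ∈ ⋀[ℝ]^m (W × Module.Dual ℝ W) := hx
  rw [hb] at hx'
  simpa using hx'

theorem sum_gradedProj [FiniteDimensional ℝ W] {N : ℤ}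
    (hN : (Module.finrank ℝ (W × Module.Dual ℝ W) : ℤ) ≤ N) (x : GhostAlg W) :
    ∑ n ∈ Finset.Icc 0 N, gradedProj 1 1 n x = x := by
  refine bideg_induction (P := fun x => ∑ n ∈ Finset.Icc 0 N, gradedProj 1 1 n x = x)
    (fun x y hx hy => by simp only [map_add, Finset.sum_add_distrib, hx, hy])
    (fun p q x hx => ?_) x
  have hx' := bideg_le_gradedPart 1 1 p q hx
  by_cases h : (p * 1 + q * 1 : ℤ) ∈ Finset.Icc 0 N
  · rw [Finset.sum_eq_single _ (fun m _ hm => gradedProj_of_ne hx' hm) (fun h' => absurd h h'),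
      gradedProj_of_mem hx']
  · have : x = 0 := eq_zero_of_weight_gt (by
      rw [Finset.mem_Icc, not_and, not_le] at h
      have := h (by positivity)
      omega) hx'
    simp [this]

end FibreGrading

/-! ### The pairing bracket and derivations of the fibre algebra -/

section Derivations

variable {M : Type*} [AddCommGroup M] [Module ℝ M] {κ : Type*} [Fintype κ]

/-- The operator `x ↦ ∑ᵢ tᵢ ∧ (dᵢ ⌟ x)` on the exterior algebra. -/
def wedgeContract (t : κ → M) (d : κ → Module.Dual ℝ M) :
    ExteriorAlgebra ℝ M →ₗ[ℝ] ExteriorAlgebra ℝ M :=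
  ∑ i, LinearMap.mulLeft ℝ (ExteriorAlgebra.ι ℝ (t i)) ∘ₗ
    CliffordAlgebra.contractLeft (Q := (0 : QuadraticForm ℝ M)) (d i)

theorem wedgeContract_apply (t : κ → M) (d : κ → Module.Dual ℝ M) (x : ExteriorAlgebra ℝ M) :
    wedgeContract t d x = ∑ i, ExteriorAlgebra.ι ℝ (t i) *
      CliffordAlgebra.contractLeft (Q := (0 : QuadraticForm ℝ M)) (d i) x := by
  simp [wedgeContract]

theorem wedgeContract_algebraMap (t : κ → M) (d : κ → Module.Dual ℝ M) (r : ℝ) :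
    wedgeContract t d (algebraMap ℝ _ r) = 0 := by
  rw [wedgeContract_apply]
  refine Finset.sum_eq_zero fun i _ => ?_
  have : CliffordAlgebra.contractLeft (Q := (0 : QuadraticForm ℝ M)) (d i)
    (algebraMap ℝ (ExteriorAlgebra ℝ M) r) = 0 := CliffordAlgebra.contractLeft_algebraMap _ _ _
  rw [this, mul_zero]

theorem wedgeContract_ι_mul (t : κ → M) (d : κ → Module.Dual ℝ M) (v : M)
    (x : ExteriorAlgebra ℝ M) :
    wedgeContract t d (ExteriorAlgebra.ι ℝ v * x) =
      ExteriorAlgebra.ι ℝ (∑ i, d i v • t i) * x +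
        ExteriorAlgebra.ι ℝ v * wedgeContract t d x := by
  simp only [wedgeContract_apply, map_sum, map_smul, Finset.sum_mul, Finset.mul_sum,
    ← Finset.sum_add_distrib]
  refine Finset.sum_congr rfl fun i _ => ?_
  have : CliffordAlgebra.contractLeft (Q := (0 : QuadraticForm ℝ M)) (d i)
    (ExteriorAlgebra.ι ℝ v * x) = d i v • x - ExteriorAlgebra.ι ℝ v *
      CliffordAlgebra.contractLeft (Q := (0 : QuadraticForm ℝ M)) (d i) x :=
    CliffordAlgebra.contractLeft_ι_mul _ v x
  rw [this, mul_sub, mul_smul_comm, smul_mul_assoc, ← mul_assoc, ι_anticomm, neg_mul, sub_neg_eq_add,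
    mul_assoc]

theorem wedgeContract_ι (t : κ → M) (d : κ → Module.Dual ℝ M) (v : M) :
    wedgeContract t d (ExteriorAlgebra.ι ℝ v) = ExteriorAlgebra.ι ℝ (∑ i, d i v • t i) := by
  have h := wedgeContract_ι_mul t d v 1
  have h1 := wedgeContract_algebraMap t d 1
  rw [map_one] at h1
  rwa [mul_one, h1, mul_zero, add_zero, mul_one] at h

theorem wedgeContract_mul (t : κ → M) (d : κ → Module.Dual ℝ M) (x y : ExteriorAlgebra ℝ M) :
    wedgeContract t d (x * y) = wedgeContract t d x * y + x * wedgeContract t d y := by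
  induction x using ExteriorAlgebra.induction generalizing y with
  | algebraMap r =>
    rw [wedgeContract_algebraMap, zero_mul, zero_add, ← Algebra.smul_def, map_smul,
      Algebra.smul_def]
  | ι v => rw [wedgeContract_ι_mul, wedgeContract_ι]
  | mul x x' hx hx' => rw [mul_assoc, hx, hx', hx, mul_add, add_mul, mul_assoc, mul_assoc, mul_assoc,
      add_assoc]
  | add x x' hx hx' =>
    rw [add_mul, map_add, hx, hx', map_add, add_mul, add_mul]
    abel

theorem derivationExt_eq {κ : Type*} [Fintype κ] (m : Module.Basis κ ℝ M) (T : M →ₗ[ℝ] M)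
    (x : ExteriorAlgebra ℝ M) :
    derivationExt m T x = wedgeContract (fun i => T (m i)) m.coord x := by
  rw [wedgeContract_apply]
  rfl

variable {W : Type*} [AddCommGroup W] [Module ℝ W]

theorem wedgeContract_weight (t : κ → W × Module.Dual ℝ W)
    (d : κ → Module.Dual ℝ (W × Module.Dual ℝ W)) {n : ℤ} {x : GhostAlg W}
    (hx : x ∈ gradedPart W 1 1 n) : wedgeContract t d x ∈ gradedPart W 1 1 n := by
  rw [wedgeContract_apply]
  refine Submodule.sum_mem _ fun i _ => ?_
  have h1 := pow_le_gradedPart_one (W := W) 1 (x := ExteriorAlgebra.ι ℝ (t i)) (by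
    rw [pow_one]
    exact ⟨_, rfl⟩)
  have := mul_mem_gradedPart h1 (contractLeft_mem (d i) hx)
  rwa [show ((1 : ℕ) : ℤ) + (n - 1) = n by push_cast; ring] at this

theorem wedgeContract_bideg {t : κ → W × Module.Dual ℝ W}
    {d : κ → Module.Dual ℝ (W × Module.Dual ℝ W)} {a b : ℝ}
    (h : ∀ v : W × Module.Dual ℝ W, ∑ i, d i v • t i = (a • v.1, b • v.2)) {p q : ℕ}
    {x : GhostAlg W} (hx : x ∈ bideg W p q) : wedgeContract t d x = (p * a + q * b : ℝ) • x := by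
  have key : ∀ (c : ℝ) (U : Submodule ℝ (GhostAlg W)), (∀ x ∈ U, wedgeContract t d x = c • x) →
      ∀ n : ℕ, ∀ x ∈ U ^ n, wedgeContract t d x = (n * c : ℝ) • x := by
    intro c U hU n
    induction n with
    | zero =>
      intro x hx
      rw [pow_zero] at hx
      obtain ⟨r, rfl⟩ := Submodule.mem_one.1 hx
      rw [wedgeContract_algebraMap]
      simp
    | succ n ih =>
      intro x hx
      rw [pow_succ] at hx
      induction hx using Submodule.mul_induction_on' with
      | mem_mul_mem x hx y hy =>
        rw [wedgeContract_mul, ih x hx, hU y hy, smul_mul_assoc, mul_smul_comm, ← add_smul]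
        push_cast
        ring_nf
      | add x _ y _ hx hy => rw [map_add, hx, hy, smul_add]
  rw [bideg] at hx
  induction hx using Submodule.mul_induction_on' with
  | mem_mul_mem x hx y hy =>
    rw [wedgeContract_mul, key a _ ?_ p x hx, key b _ ?_ q y hy, smul_mul_assoc, mul_smul_comm,
      ← add_smul]
    · rintro _ ⟨v, rfl⟩
      change wedgeContract t d (ExteriorAlgebra.ι ℝ (0, v)) = b • ExteriorAlgebra.ι ℝ (0, v)
      rw [wedgeContract_ι, h, ← map_smul]
      simp
    · rintro _ ⟨v, rfl⟩
      change wedgeContract t d (ExteriorAlgebra.ι ℝ (v, 0)) = a • ExteriorAlgebra.ι ℝ (v, 0)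
      rw [wedgeContract_ι, h, ← map_smul]
      simp
  | add x _ y _ hx hy => rw [map_add, hx, hy, smul_add]

/-- Contraction with a vector, as a derivation with respect to the ghost momenta. -/
def contractVector : W →ₗ[ℝ] GhostAlg W →ₗ[ℝ] GhostAlg W :=
  CliffordAlgebra.contractLeft ∘ₗ (LinearMap.snd ℝ W (Module.Dual ℝ W)).dualMap ∘ₗ
    Module.Dual.eval ℝ W

/-- Contraction with a covector, as a derivation with respect to the ghosts. -/
def contractCovector : Module.Dual ℝ W →ₗ[ℝ] GhostAlg W →ₗ[ℝ] GhostAlg W :=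
  CliffordAlgebra.contractLeft ∘ₗ (LinearMap.fst ℝ W (Module.Dual ℝ W)).dualMap

variable {κ : Type*} [Fintype κ] (w : Module.Basis κ ℝ W)

theorem contractRight_ghost (v : W) (d : Module.Dual ℝ (W × Module.Dual ℝ W)) :
    CliffordAlgebra.contractRight (ghost v) d = algebraMap ℝ (GhostAlg W) (d (v, 0)) :=
  CliffordAlgebra.contractRight_ι _ _ _

theorem contractRight_ghostMomentum (ξ : Module.Dual ℝ W)
    (d : Module.Dual ℝ (W × Module.Dual ℝ W)) :
    CliffordAlgebra.contractRight (ghostMomentum ξ) d = algebraMap ℝ (GhostAlg W) (d (0, ξ)) :=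
  CliffordAlgebra.contractRight_ι _ _ _

theorem sum_apply_smul_coord (ξ : Module.Dual ℝ W) : ∑ i, ξ (w i) • w.coord i = ξ := by
  refine w.ext fun j => ?_
  simp only [LinearMap.sum_apply, LinearMap.smul_apply, Module.Basis.coord_apply,
    Module.Basis.repr_self, smul_eq_mul]
  rw [Finset.sum_eq_single j] <;> simp +contextual [eq_comm]

theorem pairingBracket_ghost (v : W) (x : GhostAlg W) :
    pairingBracket w (ghost v) x = contractVector v x := by
  conv_rhs => rw [← w.sum_repr v, map_sum, LinearMap.sum_apply]
  rw [pairingBracket]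
  refine Finset.sum_congr rfl fun i _ => ?_
  rw [contractRight_ghost, contractRight_ghost, map_smul, LinearMap.smul_apply, Algebra.smul_def]
  simp only [LinearMap.comp_apply, LinearMap.snd_apply, map_zero, zero_mul, add_zero]
  rfl

theorem pairingBracket_ghostMomentum (ξ : Module.Dual ℝ W) (x : GhostAlg W) :
    pairingBracket w (ghostMomentum ξ) x = contractCovector ξ x := by
  conv_rhs => rw [← sum_apply_smul_coord w ξ, map_sum, LinearMap.sum_apply]
  rw [pairingBracket]
  refine Finset.sum_congr rfl fun i _ => ?_
  rw [contractRight_ghostMomentum, contractRight_ghostMomentum, map_smul, LinearMap.smul_apply,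
    Algebra.smul_def]
  simp only [LinearMap.comp_apply, LinearMap.fst_apply, map_zero, zero_mul, zero_add]
  rfl

theorem pairingBracket_algebraMap (r : ℝ) (x : GhostAlg W) :
    pairingBracket w (algebraMap ℝ _ r) x = 0 := by
  refine Finset.sum_eq_zero fun i _ => ?_
  have h : ∀ d, CliffordAlgebra.contractRight (algebraMap ℝ (GhostAlg W) r) d = 0 :=
    fun d => CliffordAlgebra.contractRight_algebraMap _ _ _
  rw [h, h, zero_mul, zero_mul, add_zero]

/-- The pairing bracket as a bilinear map. -/
def pairingBilin : GhostAlg W →ₗ[ℝ] GhostAlg W →ₗ[ℝ] GhostAlg W :=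
  LinearMap.mk₂ ℝ (pairingBracket w)
    (fun x x' y => by
      simp only [pairingBracket, map_add, LinearMap.add_apply, add_mul, ← Finset.sum_add_distrib]
      exact Finset.sum_congr rfl fun i _ => by abel)
    (fun r x y => by
      simp only [pairingBracket, map_smul, LinearMap.smul_apply, smul_mul_assoc, ← smul_add,
        Finset.smul_sum])
    (fun x y y' => by
      simp only [pairingBracket, map_add, mul_add, ← Finset.sum_add_distrib]
      exact Finset.sum_congr rfl fun i _ => by abel)
    (fun r x y => by
      simp only [pairingBracket, map_smul, mul_smul_comm, ← smul_add, Finset.smul_sum])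

theorem pairingBilin_apply (x y : GhostAlg W) : pairingBilin w x y = pairingBracket w x y := rfl

/-- The Euler operator counts the ghosts and the ghost momenta. -/
theorem sum_ghost_mul_contract {n : ℤ} {x : GhostAlg W} (hx : x ∈ gradedPart W 1 1 n) :
    ∑ i, (ghost (w i) * contractCovector (w.coord i) x +
      ghostMomentum (w.coord i) * contractVector (w i) x) = (n : ℝ) • x := by
  let t : κ ⊕ κ → W × Module.Dual ℝ W := Sum.elim (fun i => (w i, 0)) (fun i => (0, w.coord i))
  let d : κ ⊕ κ → Module.Dual ℝ (W × Module.Dual ℝ W) :=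
    Sum.elim (fun i => w.coord i ∘ₗ LinearMap.fst ℝ W (Module.Dual ℝ W))
      (fun i => Module.Dual.eval ℝ W (w i) ∘ₗ LinearMap.snd ℝ W (Module.Dual ℝ W))
  have e : ∀ x : GhostAlg W, ∑ i, (ghost (w i) * contractCovector (w.coord i) x +
      ghostMomentum (w.coord i) * contractVector (w i) x) = wedgeContract t d x := fun x => by
    rw [wedgeContract_apply, Fintype.sum_sum_type, Finset.sum_add_distrib]
    rfl
  have h : ∀ v : W × Module.Dual ℝ W, ∑ i, d i v • t i = ((1 : ℝ) • v.1, (1 : ℝ) • v.2) := by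
    intro v
    rw [Fintype.sum_sum_type, one_smul, one_smul]
    refine Prod.ext ?_ ?_
    · simp [t, d, Prod.fst_sum, w.sum_repr]
    · simp [t, d, Prod.snd_sum]
  rw [e, ← gradedProj_of_mem hx]
  refine bideg_induction
    (P := fun x => wedgeContract t d (gradedProj 1 1 n x) = (n : ℝ) • gradedProj 1 1 n x)
    (fun x y hx hy => by rw [map_add, map_add, hx, hy, smul_add]) (fun p q x hx => ?_) x
  rcases gradedProj_mem_of_bideg 1 1 n hx with ⟨h', h''⟩ | h' <;> rw [h']
  · rw [wedgeContract_bideg h hx, h'']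
    push_cast
    rfl
  · simp

/-- The number operator of the ghost momenta. -/
theorem sum_ghostMomentum_mul_contract {p q : ℕ} {x : GhostAlg W} (hx : x ∈ bideg W p q) :
    ∑ i, ghostMomentum (w.coord i) * contractVector (w i) x = (q : ℝ) • x := by
  let t : κ → W × Module.Dual ℝ W := fun i => (0, w.coord i)
  let d : κ → Module.Dual ℝ (W × Module.Dual ℝ W) := fun i =>
    Module.Dual.eval ℝ W (w i) ∘ₗ LinearMap.snd ℝ W (Module.Dual ℝ W)
  have e : ∑ i, ghostMomentum (w.coord i) * contractVector (w i) x = wedgeContract t d x := by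
    rw [wedgeContract_apply]
    rfl
  have h : ∀ v : W × Module.Dual ℝ W, ∑ i, d i v • t i = ((0 : ℝ) • v.1, (1 : ℝ) • v.2) := by
    intro v
    rw [zero_smul, one_smul]
    refine Prod.ext ?_ ?_
    · simp [t, d, Prod.fst_sum]
    · simp [t, d, Prod.snd_sum]
  rw [e, wedgeContract_bideg h hx]
  simp

theorem contractVector_ghostMomentum_mul (v : W) (ξ : Module.Dual ℝ W) (x : GhostAlg W) :
    contractVector v (ghostMomentum ξ * x) = ξ v • x - ghostMomentum ξ * contractVector v x :=
  CliffordAlgebra.contractLeft_ι_mul _ _ _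

end Derivations

section GhostMap

variable {W W' W'' : Type*} [AddCommGroup W] [Module ℝ W] [AddCommGroup W'] [Module ℝ W']
  [AddCommGroup W''] [Module ℝ W'']

theorem ghostMap_ghost (f : W →ₗ[ℝ] W') (g : W' →ₗ[ℝ] W) (v : W) :
    ghostMap f g (ghost v) = ghost (f v) := by
  change ExteriorAlgebra.map _ (ExteriorAlgebra.ι ℝ (v, 0)) = ExteriorAlgebra.ι ℝ (f v, 0)
  rw [ExteriorAlgebra.map_apply_ι]
  simp

theorem ghostMap_ghostMomentum (f : W →ₗ[ℝ] W') (g : W' →ₗ[ℝ] W) (ξ : Module.Dual ℝ W) :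
    ghostMap f g (ghostMomentum ξ) = ghostMomentum (ξ ∘ₗ g) := by
  change ExteriorAlgebra.map _ (ExteriorAlgebra.ι ℝ (0, ξ)) = ExteriorAlgebra.ι ℝ (0, ξ ∘ₗ g)
  rw [ExteriorAlgebra.map_apply_ι]
  simp [LinearMap.dualMap_apply']

theorem ghostMap_comp (f : W →ₗ[ℝ] W') (g : W' →ₗ[ℝ] W) (f' : W' →ₗ[ℝ] W'')
    (g' : W'' →ₗ[ℝ] W') (x : GhostAlg W) :
    ghostMap f' g' (ghostMap f g x) = ghostMap (f' ∘ₗ f) (g ∘ₗ g') x := by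
  rw [ghostMap, ghostMap, ghostMap, ← AlgHom.comp_apply, ExteriorAlgebra.map_comp_map]
  rfl

theorem ghostMap_id (x : GhostAlg W) : ghostMap LinearMap.id LinearMap.id x = x := by
  have : (LinearMap.id : W →ₗ[ℝ] W).prodMap (LinearMap.id : W →ₗ[ℝ] W).dualMap =
      LinearMap.id := by
    ext <;> simp
  rw [ghostMap, this, ExteriorAlgebra.map_id]
  rfl

theorem grading_ghostMap (a b : ℤ) (f : W →ₗ[ℝ] W') (g : W' →ₗ[ℝ] W) (x : GhostAlg W) :
    grading a b (ghostMap f g x) =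
      AddMonoidAlgebra.mapAlgHom ℤ (ghostMap f g) (grading a b x) := by
  suffices (grading a b).comp (ghostMap f g) =
      (AddMonoidAlgebra.mapAlgHom ℤ (ghostMap f g)).comp (grading a b) from
    AlgHom.congr_fun this x
  refine ExteriorAlgebra.hom_ext (LinearMap.ext fun v => ?_)
  simp only [LinearMap.comp_apply, AlgHom.toLinearMap_apply, AlgHom.comp_apply]
  rw [ι_eq_ghost_add_ghostMomentum]
  simp only [map_add, ghostMap_ghost, ghostMap_ghostMomentum, grading_ghost, grading_ghostMomentum]
  rw [AddMonoidAlgebra.mapAlgHom_single, AddMonoidAlgebra.mapAlgHom_single, ghostMap_ghost, ghostMap_ghostMomentum]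

theorem gradedProj_ghostMap (a b n : ℤ) (f : W →ₗ[ℝ] W') (g : W' →ₗ[ℝ] W) (x : GhostAlg W) :
    gradedProj a b n (ghostMap f g x) = ghostMap f g (gradedProj a b n x) := by
  change (grading a b (ghostMap f g x)).coeff n = _
  rw [grading_ghostMap, AddMonoidAlgebra.coeff_mapAlgHom]
  rfl

theorem ghostMap_mem_gradedPart {a b n : ℤ} (f : W →ₗ[ℝ] W') (g : W' →ₗ[ℝ] W) {x : GhostAlg W}
    (hx : x ∈ gradedPart W a b n) : ghostMap f g x ∈ gradedPart W' a b n := by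
  rw [← gradedProj_of_mem hx, ← gradedProj_ghostMap]
  exact gradedProj_mem _ _ _ _

theorem ghostMap_mem_bideg {p q : ℕ} (f : W →ₗ[ℝ] W') (g : W' →ₗ[ℝ] W) {x : GhostAlg W}
    (hx : x ∈ bideg W p q) : ghostMap f g x ∈ bideg W' p q := by
  have h : (bideg W p q).map (ghostMap f g).toLinearMap ≤ bideg W' p q := by
    rw [bideg, bideg, Submodule.map_mul, Submodule.map_pow, Submodule.map_pow]
    refine mul_le_mul' (pow_le_pow_left' ?_ p) (pow_le_pow_left' ?_ q)
    · rintro _ ⟨_, ⟨v, rfl⟩, rfl⟩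
      exact ⟨f v, (ghostMap_ghost f g v).symm⟩
    · rintro _ ⟨_, ⟨v, rfl⟩, rfl⟩
      exact ⟨_, (ghostMap_ghostMomentum f g v).symm⟩
  exact h (Submodule.mem_map_of_mem hx)

theorem contractVector_algebraMap (v : W) (r : ℝ) :
    contractVector v (algebraMap ℝ (GhostAlg W) r) = 0 :=
  CliffordAlgebra.contractLeft_algebraMap _ _ _

theorem contractVector_ι_mul (v : W) (u : W × Module.Dual ℝ W) (x : GhostAlg W) :
    contractVector v (ExteriorAlgebra.ι ℝ u * x) =
      u.2 v • x - ExteriorAlgebra.ι ℝ u * contractVector v x :=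
  CliffordAlgebra.contractLeft_ι_mul _ _ _

theorem contractVector_ghostMap (f : W →ₗ[ℝ] W') (g : W' →ₗ[ℝ] W) (v : W') (x : GhostAlg W) :
    contractVector v (ghostMap f g x) = ghostMap f g (contractVector (g v) x) := by
  refine CliffordAlgebra.left_induction (Q := (0 : QuadraticForm ℝ (W × Module.Dual ℝ W)))
    (P := fun x => contractVector v (ghostMap f g x) = ghostMap f g (contractVector (g v) x))
    (fun r => ?_) (fun x y hx hy => by simp only [map_add, hx, hy]) (fun x u hx => ?_) x
  · have e : ghostMap f g (algebraMap ℝ (GhostAlg W) r) = algebraMap ℝ (GhostAlg W') r :=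
      (ghostMap f g).commutes r
    have e' := contractVector_algebraMap (g v) r
    calc contractVector v (ghostMap f g (algebraMap ℝ (GhostAlg W) r)) = 0 := by
          rw [e, contractVector_algebraMap]
      _ = ghostMap f g (contractVector (g v) (algebraMap ℝ (GhostAlg W) r)) := by
          rw [e', map_zero]
  · change contractVector v (ghostMap f g (ExteriorAlgebra.ι ℝ u * x)) =
      ghostMap f g (contractVector (g v) (ExteriorAlgebra.ι ℝ u * x))
    have e : ghostMap f g (ExteriorAlgebra.ι ℝ u) =
        ExteriorAlgebra.ι ℝ (f u.1, u.2 ∘ₗ g) := ExteriorAlgebra.map_apply_ι _ _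
    rw [contractVector_ι_mul, map_sub, map_smul, map_mul (ghostMap f g), map_mul (ghostMap f g), e,
      contractVector_ι_mul, hx]
    rfl

end GhostMap

/-! ### The algebra of sections -/

section Sections

variable {EB : Type*} [NormedAddCommGroup EB] [NormedSpace ℝ EB]
  {S : Type*} [TopologicalSpace S] [ChartedSpace EB S]
  {F : Type*} [NormedAddCommGroup F] [NormedSpace ℝ F] [FiniteDimensional ℝ F]
  {V : S → Type*} [TopologicalSpace (TotalSpace F V)]
  [∀ x, AddCommGroup (V x)] [∀ x, Module ℝ (V x)] [∀ x, TopologicalSpace (V x)]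
  [FiberBundle F V] [VectorBundle ℝ F V]

/-- Evaluation of a section at a point of the total space. -/
def evalAt (e : TotalSpace F V) : BFVAlg EB F V →ₐ[ℝ] GhostAlg (V e.proj) :=
  (Pi.evalAlgHom ℝ (fun e : TotalSpace F V => GhostAlg (V e.proj)) e).comp
    (smoothSections EB F V).val

theorem evalAt_apply (e : TotalSpace F V) (a : BFVAlg EB F V) : evalAt e a = a.1 e := rfl

/-- A smooth section as an element of the algebra of sections. -/
def mkSection (a : RawSection F V) (h : IsSmooth EB a) : BFVAlg EB F V := ⟨a, h⟩

@[simp]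
theorem evalAt_mkSection (e : TotalSpace F V) (a : RawSection F V) (h : IsSmooth EB a) :
    evalAt e (mkSection a h) = a e := rfl

theorem section_ext {a b : BFVAlg EB F V} (h : ∀ e, evalAt e a = evalAt e b) : a = b :=
  Subtype.ext (funext h)

variable (F V) in
/-- The trivialization around `x` as an isomorphism from the fibre at `y`. -/
def fibreEquiv (x : S) {y : S} (hy : y ∈ (trivializationAt F V x).baseSet) : V y ≃ₗ[ℝ] F :=
  (trivializationAt F V x).linearEquivAt ℝ y hy

variable (F) in
include F in
theorem finiteDimensional_fibre (x : S) : FiniteDimensional ℝ (V x) :=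
  (fibreEquiv F V x (FiberBundle.mem_baseSet_trivializationAt F V x)).symm.finiteDimensional

omit [FiniteDimensional ℝ F] in
variable (F) in
theorem finrank_fibre (x : S) : Module.finrank ℝ (V x × Module.Dual ℝ (V x)) =
    Module.finrank ℝ (F × Module.Dual ℝ F) := by
  have e := fibreEquiv F V x (FiberBundle.mem_baseSet_trivializationAt F V x)
  exact (e.prodCongr e.symm.dualMap).finrank_eq

/-- The projection of sections to the part of degree `n`, where ghosts have degree `a` and ghost
momenta degree `b`. -/
def sectionProj (a b n : ℤ) : BFVAlg EB F V →ₗ[ℝ] BFVAlg EB F V where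
  toFun x := mkSection (fun e => gradedProj a b n (evalAt e x)) fun y ℓ =>
    (x.2 y (ℓ ∘ₗ gradedProj a b n)).congr fun e _ =>
      congrArg ℓ (gradedProj_ghostMap a b n _ _ _).symm
  map_add' x y := section_ext fun e => by
    simp only [map_add, evalAt_mkSection]
    rfl
  map_smul' r x := section_ext fun e => by
    simp only [map_smul, evalAt_mkSection, RingHom.id_apply]
    rfl

theorem evalAt_sectionProj (a b n : ℤ) (e : TotalSpace F V) (x : BFVAlg EB F V) :
    evalAt e (sectionProj a b n x) = gradedProj a b n (evalAt e x) := rfl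

variable (EB F V) in
/-- The sections of degree `n`, where ghosts have degree `a` and ghost momenta degree `b`. -/
def sectionPart (a b n : ℤ) : Submodule ℝ (BFVAlg EB F V) where
  carrier := {x | ∀ e, evalAt e x ∈ gradedPart (V e.proj) a b n}
  add_mem' ha hb e := by rw [map_add]; exact Submodule.add_mem _ (ha e) (hb e)
  zero_mem' e := by rw [map_zero]; exact Submodule.zero_mem _
  smul_mem' r _ ha e := by rw [map_smul]; exact Submodule.smul_mem _ r (ha e)

theorem mem_sectionPart {a b n : ℤ} {x : BFVAlg EB F V} :
    x ∈ sectionPart EB F V a b n ↔ ∀ e, evalAt e x ∈ gradedPart (V e.proj) a b n := Iff.rfl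

theorem mem_bfvDeg {k : ℤ} {x : BFVAlg EB F V} :
    x ∈ bfvDeg EB F V k ↔ ∀ e, evalAt e x ∈ totalDeg (V e.proj) k := Iff.rfl

theorem bfvDeg_eq (k : ℤ) : bfvDeg EB F V k = sectionPart EB F V 1 (-1) k := by
  ext x
  rw [mem_bfvDeg, mem_sectionPart]
  simp only [totalDeg_eq]

theorem sum_degree_gradedProj {W : Type*} [AddCommGroup W] [Module ℝ W] [FiniteDimensional ℝ W]
    {N : ℤ} (hN : (Module.finrank ℝ (W × Module.Dual ℝ W) : ℤ) ≤ N) (x : GhostAlg W) :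
    ∑ k ∈ Finset.Icc (-N) N, gradedProj 1 (-1) k x = x := by
  refine bideg_induction (P := fun x => ∑ k ∈ Finset.Icc (-N) N, gradedProj 1 (-1) k x = x)
    (fun x y hx hy => by simp only [map_add, Finset.sum_add_distrib, hx, hy])
    (fun p q x hx => ?_) x
  have hx' := bideg_le_gradedPart 1 (-1) p q hx
  by_cases h : (p + q : ℤ) ≤ N
  · rw [Finset.sum_eq_single_of_mem (p * 1 + q * (-1) : ℤ)
      (Finset.mem_Icc.2 ⟨by omega, by omega⟩)
      (fun k _ hk => gradedProj_of_ne hx' hk), gradedProj_of_mem hx']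
  · have h0 : x = 0 := eq_zero_of_weight_gt (n := p * 1 + q * 1) (by omega)
      (bideg_le_gradedPart 1 1 p q hx)
    simp [h0]

variable (EB F V) in
/-- The decomposition of the sections by the total number of ghosts and ghost momenta. -/
def bfvWeight : WeightDecomposition (bfvDeg EB F V) where
  W n := sectionPart EB F V 1 1 n
  proj n := sectionProj 1 1 n
  top := Module.finrank ℝ (F × Module.Dual ℝ F)
  proj_mem n a e := gradedProj_mem _ _ _ _
  proj_of_mem ha := section_ext fun e => gradedProj_of_mem (ha e)
  proj_of_ne ha h := section_ext fun e => by
    rw [evalAt_sectionProj, map_zero]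
    exact gradedProj_of_ne (ha e) h
  sum_proj a := section_ext fun e => by
    have := finiteDimensional_fibre (V := V) F e.proj
    rw [map_sum]
    exact sum_gradedProj (by rw [finrank_fibre F]) _
  proj_deg n ha e := gradedProj_totalDeg n (ha e)
  mul_mem ha hb e := by
    rw [map_mul]
    exact mul_mem_gradedPart (ha e) (hb e)
  deg_mul_mem ha hb := by
    rw [bfvDeg_eq] at *
    exact fun e => by
      rw [map_mul]
      exact mul_mem_gradedPart (ha e) (hb e)
  iSup_deg := by
    rw [eq_top_iff]
    rintro a -
    have h : ∑ k ∈ Finset.Icc (-(Module.finrank ℝ (F × Module.Dual ℝ F) : ℤ))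
        (Module.finrank ℝ (F × Module.Dual ℝ F)), sectionProj 1 (-1) k a = a :=
      section_ext fun e => by
        have := finiteDimensional_fibre (V := V) F e.proj
        rw [map_sum]
        exact sum_degree_gradedProj (by rw [finrank_fibre F]) _
    rw [← h]
    refine Submodule.sum_mem _ fun k _ => Submodule.mem_iSup_of_mem k ?_
    rw [bfvDeg_eq]
    exact fun e => gradedProj_mem _ _ _ _
  zero_le a ha e := by
    obtain ⟨r, hr⟩ := exists_algebraMap_of_weight_zero (ha e)
    change evalAt e a ∈ _
    rw [hr, totalDeg_eq]
    exact algebraMap_mem_gradedPart _ _ _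
  mul_comm ha hb := section_ext fun e => by
    rw [map_smul, map_mul, map_mul]
    exact totalDeg_mul_comm (ha e) (hb e)

theorem evalAt_proj (n : ℤ) (e : TotalSpace F V) (x : BFVAlg EB F V) :
    evalAt e ((bfvWeight EB F V).proj n x) = gradedProj 1 1 n (evalAt e x) := rfl

/-- A section that is homogeneous for the degree and the weight is homogeneous for the
bidegree. -/
theorem mem_bfvBideg_of_homogeneous {k n : ℤ} {x : BFVAlg EB F V} (hk : x ∈ bfvDeg EB F V k)
    (hn : x ∈ (bfvWeight EB F V).W n) :
    x = 0 ∨ ∃ p q : ℕ, (p : ℤ) - q = k ∧ (p : ℤ) + q = n ∧ x ∈ bfvBideg EB F V p q := by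
  by_cases h : ∃ p q : ℕ, (p : ℤ) - q = k ∧ (p : ℤ) + q = n
  · obtain ⟨p, q, rfl, rfl⟩ := h
    exact Or.inr ⟨p, q, rfl, rfl, fun e => mem_bideg_of_mem_totalDeg rfl (hk e) (hn e)⟩
  · exact Or.inl (section_ext fun e => by
      rw [map_zero]
      exact eq_zero_of_mem_totalDeg h (hk e) (hn e))

end Sections

set_option linter.unusedSectionVars false

open scoped Topology

/-! ### Smoothness of functions with values in finite-dimensional vector spaces -/

section WeakSmooth

variable {EM : Type*} [NormedAddCommGroup EM] [NormedSpace ℝ EM] {HM : Type*} [TopologicalSpace HM]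
  {I : ModelWithCorners ℝ EM HM} {M : Type*} [TopologicalSpace M] [ChartedSpace HM M]
  {X Y Z : Type*} [AddCommGroup X] [Module ℝ X] [AddCommGroup Y] [Module ℝ Y]
  [AddCommGroup Z] [Module ℝ Z]

variable (I) in
/-- Smoothness at a point of all the coordinates of a vector-valued function. -/
def WeakSmoothAt (u : M → X) (e : M) : Prop :=
  ∀ ℓ : Module.Dual ℝ X, ContMDiffAt I 𝓘(ℝ, ℝ) ∞ (fun e => ℓ (u e)) e

variable {e : M}

theorem WeakSmoothAt.congr {u v : M → X} (hu : WeakSmoothAt I u e) (h : ∀ᶠ e' in 𝓝 e, v e' = u e') :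
    WeakSmoothAt I v e := fun ℓ =>
  (hu ℓ).congr_of_eventuallyEq (h.mono fun e' he => by simp only [he])

theorem weakSmoothAt_const (x : X) : WeakSmoothAt I (fun _ : M => x) e := fun _ => contMDiffAt_const

theorem WeakSmoothAt.add {u v : M → X} (hu : WeakSmoothAt I u e) (hv : WeakSmoothAt I v e) :
    WeakSmoothAt I (fun e => u e + v e) e := fun ℓ => by
  simp only [map_add]
  exact (hu ℓ).add (hv ℓ)

theorem WeakSmoothAt.sum {ι : Type*} {s : Finset ι} {u : ι → M → X}
    (hu : ∀ i ∈ s, WeakSmoothAt I (u i) e) : WeakSmoothAt I (fun e => ∑ i ∈ s, u i e) e := by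
  intro ℓ
  simp only [map_sum]
  exact contMDiffAt_finsetSum fun i hi => hu i hi ℓ

theorem WeakSmoothAt.smul {c : M → ℝ} {u : M → X} (hc : ContMDiffAt I 𝓘(ℝ, ℝ) ∞ c e)
    (hu : WeakSmoothAt I u e) : WeakSmoothAt I (fun e => c e • u e) e := fun ℓ => by
  simp only [map_smul, smul_eq_mul]
  exact hc.mul (hu ℓ)

theorem WeakSmoothAt.map {u : M → X} (hu : WeakSmoothAt I u e) (f : X →ₗ[ℝ] Y) :
    WeakSmoothAt I (fun e => f (u e)) e := fun ℓ => hu (ℓ ∘ₗ f)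

/-- The value of a field of linear maps at a smooth function is smooth if the values at constants
are. -/
theorem WeakSmoothAt.apply [FiniteDimensional ℝ X] {f : M → X →ₗ[ℝ] Y} {u : M → X}
    (hu : WeakSmoothAt I u e) (hf : ∀ x, WeakSmoothAt I (fun e => f e x) e) :
    WeakSmoothAt I (fun e => f e (u e)) e := by
  have h : (fun e => f e (u e)) = fun e => ∑ i, (Module.finBasis ℝ X).coord i (u e) •
      f e (Module.finBasis ℝ X i) := by
    funext e
    conv_lhs => rw [← (Module.finBasis ℝ X).sum_repr (u e), map_sum]
    simp
  rw [h]
  exact WeakSmoothAt.sum fun i _ => WeakSmoothAt.smul (hu _) (hf _)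

theorem WeakSmoothAt.bilin [FiniteDimensional ℝ X] [FiniteDimensional ℝ Y]
    (β : X →ₗ[ℝ] Y →ₗ[ℝ] Z) {u : M → X} {v : M → Y} (hu : WeakSmoothAt I u e)
    (hv : WeakSmoothAt I v e) : WeakSmoothAt I (fun e => β (u e) (v e)) e :=
  hv.apply (f := fun e => β (u e)) fun y => hu.map (β.flip y)

theorem ContMDiffAt.weakSmoothAt {X : Type*} [NormedAddCommGroup X] [NormedSpace ℝ X]
    [FiniteDimensional ℝ X] {u : M → X} (hu : ContMDiffAt I 𝓘(ℝ, X) ∞ u e) :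
    WeakSmoothAt I u e := fun ℓ =>
  (LinearMap.toContinuousLinearMap ℓ).contMDiff.contMDiffAt.comp e hu

variable {F : Type*} [AddCommGroup F] [Module ℝ F] [FiniteDimensional ℝ F]

instance : FiniteDimensional ℝ (GhostAlg F) := (ghostBasis F).finiteDimensional_of_finite

theorem WeakSmoothAt.mul {u v : M → GhostAlg F} (hu : WeakSmoothAt I u e)
    (hv : WeakSmoothAt I v e) : WeakSmoothAt I (fun e => u e * v e) e :=
  WeakSmoothAt.bilin (LinearMap.mul ℝ (GhostAlg F)) hu hv

theorem WeakSmoothAt.ghostMap {f g : M → F →ₗ[ℝ] F} {u : M → GhostAlg F}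
    (hf : ∀ v, WeakSmoothAt I (fun e => f e v) e) (hg : ∀ v, WeakSmoothAt I (fun e => g e v) e)
    (hu : WeakSmoothAt I u e) : WeakSmoothAt I (fun e => ghostMap (f e) (g e) (u e)) e := by
  refine hu.apply (f := fun e => (BFV.ghostMap (f e) (g e)).toLinearMap) fun ξ => ?_
  simp only [AlgHom.toLinearMap_apply]
  induction ξ using ExteriorAlgebra.induction with
  | algebraMap r =>
    simp only [AlgHom.commutes]
    exact weakSmoothAt_const _
  | ι v =>
    simp only [ι_eq_ghost_add_ghostMomentum, map_add, ghostMap_ghost, ghostMap_ghostMomentum]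
    refine ((hf v.1).map ghost).add (WeakSmoothAt.map ?_ ghostMomentum)
    have h : (fun e => v.2 ∘ₗ g e) = fun e => ∑ i, v.2 (g e (Module.finBasis ℝ F i)) •
        (Module.finBasis ℝ F).coord i := by
      funext e
      exact (sum_apply_smul_coord (Module.finBasis ℝ F) (v.2 ∘ₗ g e)).symm
    rw [h]
    exact WeakSmoothAt.sum fun i _ => WeakSmoothAt.smul (hg _ v.2) (weakSmoothAt_const _)
  | mul a b ha hb =>
    simp only [map_mul]
    exact ha.mul hb
  | add a b ha hb =>
    simp only [map_add]
    exact ha.add hb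

end WeakSmooth

/-! ### Construction of smooth sections -/

section Local

variable {EB : Type*} [NormedAddCommGroup EB] [NormedSpace ℝ EB]
  {S : Type*} [TopologicalSpace S] [ChartedSpace EB S]
  {F : Type*} [NormedAddCommGroup F] [NormedSpace ℝ F] [FiniteDimensional ℝ F]
  {V : S → Type*} [TopologicalSpace (TotalSpace F V)]
  [∀ x, AddCommGroup (V x)] [∀ x, Module ℝ (V x)] [∀ x, TopologicalSpace (V x)]
  [FiberBundle F V] [VectorBundle ℝ F V]

variable (F V) in
/-- The part of the total space over the domain of the trivialization around `x`. -/
def trivDomain (x : S) : Set (TotalSpace F V) :=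
  TotalSpace.proj ⁻¹' (trivializationAt F V x).baseSet

theorem isOpen_trivDomain (x : S) : IsOpen (trivDomain F V x) :=
  (trivializationAt F V x).open_baseSet.preimage (FiberBundle.continuous_proj F V)

theorem mem_trivDomain (e : TotalSpace F V) : e ∈ trivDomain F V e.proj :=
  FiberBundle.mem_baseSet_trivializationAt F V e.proj

theorem IsSmooth.weakSmoothAt {a : RawSection F V} (ha : IsSmooth EB a) {x : S}
    {e : TotalSpace F V} (he : e ∈ trivDomain F V x) :
    WeakSmoothAt (𝓘(ℝ, EB).prod 𝓘(ℝ, F)) (inTriv x a) e := fun ℓ =>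
  (ha x ℓ).contMDiffAt ((isOpen_trivDomain x).mem_nhds he)

/-- The section with local representative `g` in the trivialization around `x`. -/
def ofTriv (x : S) (g : TotalSpace F V → GhostAlg F) : RawSection F V := fun e =>
  ghostMap ((trivializationAt F V x).symmₗ ℝ e.proj)
    ((trivializationAt F V x).linearMapAt ℝ e.proj) (g e)

theorem inTriv_ofTriv {x : S} (g : TotalSpace F V → GhostAlg F) {e : TotalSpace F V}
    (he : e ∈ trivDomain F V x) : inTriv x (ofTriv x g) e = g e := by
  rw [inTriv, ofTriv, ghostMap_comp]
  have h : (trivializationAt F V x).linearMapAt ℝ e.proj ∘ₗ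
      (trivializationAt F V x).symmₗ ℝ e.proj = LinearMap.id :=
    LinearMap.ext fun v => (trivializationAt F V x).linearMapAt_symmₗ he v
  rw [h, ghostMap_id]

theorem ofTriv_inTriv {x : S} (a : RawSection F V) {e : TotalSpace F V}
    (he : e ∈ trivDomain F V x) : ofTriv x (inTriv x a) e = a e := by
  rw [ofTriv, inTriv, ghostMap_comp]
  have h : (trivializationAt F V x).symmₗ ℝ e.proj ∘ₗ
      (trivializationAt F V x).linearMapAt ℝ e.proj = LinearMap.id :=
    LinearMap.ext fun v => (trivializationAt F V x).symmₗ_linearMapAt he v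
  rw [h, ghostMap_id]

variable [ContMDiffVectorBundle ∞ F V 𝓘(ℝ, EB)]

theorem contMDiff_bundle_proj :
    ContMDiff (𝓘(ℝ, EB).prod 𝓘(ℝ, F)) 𝓘(ℝ, EB) ∞ (TotalSpace.proj : TotalSpace F V → S) :=
  contMDiff_proj V

theorem weakSmoothAt_coordChange (x y : S) {e : TotalSpace F V} (hx : e ∈ trivDomain F V x)
    (hy : e ∈ trivDomain F V y) (v : F) :
    WeakSmoothAt (𝓘(ℝ, EB).prod 𝓘(ℝ, F)) (fun e : TotalSpace F V =>
      ((trivializationAt F V y).linearMapAt ℝ e.proj ∘ₗ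
        (trivializationAt F V x).symmₗ ℝ e.proj) v) e := by
  have h := (contMDiffAt_coordChangeL (n := ∞) (IB := 𝓘(ℝ, EB)) (e := trivializationAt F V x)
    (e' := trivializationAt F V y) hx hy).comp e
      (contMDiff_bundle_proj (EB := EB) (F := F) (V := V)).contMDiffAt
  have h2 : ContMDiffAt (𝓘(ℝ, EB).prod 𝓘(ℝ, F)) 𝓘(ℝ, F) ∞ (fun e : TotalSpace F V =>
      ((trivializationAt F V x).coordChangeL ℝ (trivializationAt F V y) e.proj : F →L[ℝ] F) v) e :=
    h.clm_apply contMDiffAt_const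
  refine (ContMDiffAt.weakSmoothAt h2).congr ?_
  filter_upwards [(isOpen_trivDomain x).mem_nhds hx, (isOpen_trivDomain y).mem_nhds hy]
    with e' hx' hy'
  change _ = (trivializationAt F V x).coordChangeL ℝ (trivializationAt F V y) e'.proj v
  rw [Trivialization.coordChangeL_apply _ _ ⟨hx', hy'⟩, LinearMap.comp_apply,
    Trivialization.linearMapAt_apply, if_pos (show e'.proj ∈ _ from hy'), Trivialization.symmₗ_apply (R := ℝ) (e := trivializationAt F V x) (hb := hx')]

/-- Smoothness of a section can be checked near each point in one trivialization. -/
theorem isSmooth_of_weakSmoothAt {a : RawSection F V}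
    (h : ∀ e : TotalSpace F V, ∃ x, e ∈ trivDomain F V x ∧
      WeakSmoothAt (𝓘(ℝ, EB).prod 𝓘(ℝ, F)) (inTriv x a) e) : IsSmooth EB a := by
  intro y ℓ e hy
  obtain ⟨x, hx, hs⟩ := h e
  refine ContMDiffAt.contMDiffWithinAt ?_
  refine (WeakSmoothAt.ghostMap (weakSmoothAt_coordChange x y hx hy)
    (weakSmoothAt_coordChange y x hy hx) hs).congr ?_ ℓ
  filter_upwards [(isOpen_trivDomain x).mem_nhds hx] with e' hx'
  rw [← ghostMap_comp]
  change inTriv y a e' = inTriv y (ofTriv x (inTriv x a)) e'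
  rw [inTriv, inTriv, ofTriv_inTriv a hx']

theorem isSmooth_of_eventuallyEq {a : RawSection F V}
    (h : ∀ e : TotalSpace F V, ∃ b : BFVAlg EB F V, ∀ᶠ e' in 𝓝 e, a e' = evalAt e' b) :
    IsSmooth EB a := by
  refine isSmooth_of_weakSmoothAt fun e => ?_
  obtain ⟨b, hb⟩ := h e
  refine ⟨e.proj, mem_trivDomain e, (b.2.weakSmoothAt (mem_trivDomain e)).congr ?_⟩
  filter_upwards [hb] with e' he
  rw [inTriv, inTriv, he, evalAt_apply]

theorem isSmooth_smul_ofTriv {x : S} {χ : S → ℝ} (hχ : ContMDiff 𝓘(ℝ, EB) 𝓘(ℝ, ℝ) ∞ χ)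
    (hsupp : tsupport χ ⊆ (trivializationAt F V x).baseSet) {g : TotalSpace F V → GhostAlg F}
    (hg : ∀ e ∈ trivDomain F V x, WeakSmoothAt (𝓘(ℝ, EB).prod 𝓘(ℝ, F)) g e) :
    IsSmooth EB (fun e : TotalSpace F V => χ e.proj • ofTriv x g e) := by
  refine isSmooth_of_weakSmoothAt fun e => ?_
  by_cases he : e.proj ∈ tsupport χ
  · have hx : e ∈ trivDomain F V x := hsupp he
    refine ⟨x, hx, (WeakSmoothAt.smul (c := fun e : TotalSpace F V => χ e.proj)
      (hχ.contMDiffAt.comp e contMDiff_bundle_proj.contMDiffAt) (hg e hx)).congr ?_⟩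
    filter_upwards [(isOpen_trivDomain x).mem_nhds hx] with e' hx'
    rw [inTriv, map_smul]
    exact congrArg _ (inTriv_ofTriv g hx')
  · refine ⟨e.proj, mem_trivDomain e, (weakSmoothAt_const 0).congr ?_⟩
    have h0 : ∀ᶠ e' : TotalSpace F V in 𝓝 e, χ e'.proj = 0 :=
      (FiberBundle.continuous_proj F V).continuousAt.eventually
        (notMem_tsupport_iff_eventuallyEq.1 he)
    filter_upwards [h0] with e' h'
    rw [inTriv, h', zero_smul, map_zero]

/-- A smooth function on the base as an element of the algebra of sections. -/
def baseFunction (χ : S → ℝ) (hχ : ContMDiff 𝓘(ℝ, EB) 𝓘(ℝ, ℝ) ∞ χ) : BFVAlg EB F V :=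
  mkSection (fun e => algebraMap ℝ _ (χ e.proj)) fun x ℓ => by
    have h : (fun e : TotalSpace F V => ℓ (inTriv x (fun e => algebraMap ℝ _ (χ e.proj)) e)) =
        fun e => χ e.proj * ℓ 1 := by
      funext e
      rw [inTriv, AlgHom.commutes, Algebra.algebraMap_eq_smul_one, map_smul, smul_eq_mul]
    rw [h]
    exact ((hχ.comp contMDiff_bundle_proj).mul contMDiff_const).contMDiffOn

end Local

/-! ### Partitions of unity and local frames -/

section Cover

variable {EB : Type*} [NormedAddCommGroup EB] [NormedSpace ℝ EB]
  {S : Type*} [TopologicalSpace S] [ChartedSpace EB S]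
  {F : Type*} [NormedAddCommGroup F] [NormedSpace ℝ F] [FiniteDimensional ℝ F]
  {V : S → Type*} [TopologicalSpace (TotalSpace F V)]
  [∀ x, AddCommGroup (V x)] [∀ x, Module ℝ (V x)] [∀ x, TopologicalSpace (V x)]
  [FiberBundle F V] [VectorBundle ℝ F V]

variable (EB F V) in
/-- A partition of unity subordinate to the cover by the domains of trivializations, together with
cut-off functions that are `1` on the supports of its members. -/
structure TrivCover where
  /-- the partition of unity -/
  ρ : SmoothPartitionOfUnity S 𝓘(ℝ, EB) S Set.univ
  /-- the cut-off functions -/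
  η : S → S → ℝ
  η_smooth : ∀ x, ContMDiff 𝓘(ℝ, EB) 𝓘(ℝ, ℝ) ∞ (η x)
  η_supp : ∀ x, tsupport (η x) ⊆ (trivializationAt F V x).baseSet
  ρ_mul_η : ∀ x y, ρ x y * η x y = ρ x y

variable (EB F V) in
theorem exists_trivCover [FiniteDimensional ℝ EB] [T2Space S] [SigmaCompactSpace S]
    [IsManifold 𝓘(ℝ, EB) ∞ S] : Nonempty (TrivCover EB F V) := by
  obtain ⟨ρ, hρ⟩ := SmoothPartitionOfUnity.exists_isSubordinate 𝓘(ℝ, EB) (s := Set.univ)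
    isClosed_univ (fun x : S => (trivializationAt F V x).baseSet)
    (fun x => (trivializationAt F V x).open_baseSet)
    (fun x _ => Set.mem_iUnion_of_mem x (FiberBundle.mem_baseSet_trivializationAt F V x))
  have : LocallyCompactSpace S := ChartedSpace.locallyCompactSpace EB S
  have h : ∀ x : S, ∃ η : S → ℝ, ContMDiff 𝓘(ℝ, EB) 𝓘(ℝ, ℝ) ∞ η ∧
      tsupport η ⊆ (trivializationAt F V x).baseSet ∧ ∀ y, ρ x y * η y = ρ x y := by
    intro x
    obtain ⟨η, h0, h1, -⟩ := exists_contMDiffMap_zero_one_nhds_of_isClosed (n := ⊤) 𝓘(ℝ, EB)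
      (s := (trivializationAt F V x).baseSetᶜ) (t := tsupport (ρ x))
      (trivializationAt F V x).open_baseSet.isClosed_compl (isClosed_tsupport _)
      (Set.disjoint_left.2 fun y hy hy' => hy (hρ x hy'))
    refine ⟨η, η.contMDiff, fun y hy => ?_, fun y => ?_⟩
    · by_contra hb
      exact notMem_tsupport_iff_eventuallyEq.2 (h0.filter_mono (nhds_le_nhdsSet hb)) hy
    · by_cases hy : y ∈ tsupport (ρ x)
      · rw [h1.self_of_nhdsSet y hy, mul_one]
      · rw [image_eq_zero_of_notMem_tsupport hy, zero_mul]
  choose η h1 h2 h3 using h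
  exact ⟨⟨ρ, η, h1, h2, h3⟩⟩

/-- A bilinear bracket on sections that is the fibrewise pairing. -/
def IsPairing (G : BFVAlg EB F V →ₗ[ℝ] BFVAlg EB F V →ₗ[ℝ] BFVAlg EB F V) : Prop :=
  ∀ a b e, evalAt e (G a b) = pairingBracket (fibreBasis F V e.proj) (evalAt e a) (evalAt e b)

variable [ContMDiffVectorBundle ∞ F V 𝓘(ℝ, EB)]

theorem evalAt_baseFunction {χ : S → ℝ} (hχ : ContMDiff 𝓘(ℝ, EB) 𝓘(ℝ, ℝ) ∞ χ)
    (e : TotalSpace F V) : evalAt e (baseFunction (F := F) (V := V) χ hχ) =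
      algebraMap ℝ _ (χ e.proj) := rfl

theorem baseFunction_mem {χ : S → ℝ} (hχ : ContMDiff 𝓘(ℝ, EB) 𝓘(ℝ, ℝ) ∞ χ) :
    baseFunction (F := F) (V := V) χ hχ ∈ (bfvWeight EB F V).W 0 := fun _ =>
  algebraMap_mem_gradedPart _ _ _

theorem evalAt_baseFunction_mul {χ : S → ℝ} (hχ : ContMDiff 𝓘(ℝ, EB) 𝓘(ℝ, ℝ) ∞ χ)
    (e : TotalSpace F V) (a : BFVAlg EB F V) :
    evalAt e (baseFunction (F := F) (V := V) χ hχ * a) = χ e.proj • evalAt e a := by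
  rw [map_mul, evalAt_baseFunction, Algebra.smul_def]

namespace TrivCover

variable (C : TrivCover EB F V)

theorem smooth (x : S) : ContMDiff 𝓘(ℝ, EB) 𝓘(ℝ, ℝ) ∞ (C.ρ x) := (C.ρ x).contMDiff

/-- Sections glued with the partition of unity. -/
def glueSections (s : S → BFVAlg EB F V) : BFVAlg EB F V :=
  mkSection (fun e => ∑ i ∈ C.ρ.finsupport e.proj, C.ρ i e.proj • evalAt e (s i))
    (isSmooth_of_eventuallyEq fun e =>
      ⟨∑ i ∈ C.ρ.fintsupport e.proj, baseFunction (C.ρ i) (C.smooth i) * s i, by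
        have h := (FiberBundle.continuous_proj F V).continuousAt.eventually
          (C.ρ.eventually_finsupport_subset e.proj)
        filter_upwards [h] with e' he
        rw [map_sum]
        simp only [evalAt_baseFunction_mul]
        refine Finset.sum_subset he fun i _ hi => ?_
        have : C.ρ i e'.proj = 0 := by simpa using hi
        rw [this, zero_smul]⟩)

theorem evalAt_glueSections (s : S → BFVAlg EB F V) (e : TotalSpace F V) :
    evalAt e (C.glueSections s) = ∑ i ∈ C.ρ.finsupport e.proj, C.ρ i e.proj • evalAt e (s i) := rfl

theorem sum_smul_eq {e : TotalSpace F V} {g : S → GhostAlg (V e.proj)} {x : GhostAlg (V e.proj)}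
    (h : ∀ i, C.ρ i e.proj • g i = C.ρ i e.proj • x) :
    ∑ i ∈ C.ρ.finsupport e.proj, C.ρ i e.proj • g i = x := by
  rw [Finset.sum_congr rfl fun i _ => h i, ← Finset.sum_smul,
    C.ρ.sum_finsupport _ (Set.mem_univ e.proj), one_smul]

/-- The basis of the fibre over `y` given by the trivialization around `x`. -/
def frameBasis (x : S) {y : S} (hy : y ∈ (trivializationAt F V x).baseSet) :
    Module.Basis (Fin (Module.finrank ℝ F)) ℝ (V y) :=
  (Module.finBasis ℝ F).map (fibreEquiv F V x hy).symm

/-- The ghosts of the local frame around `x`, cut off. -/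
def frameGhost (x : S) (i : Fin (Module.finrank ℝ F)) : BFVAlg EB F V :=
  mkSection (fun e => C.η x e.proj • ofTriv x (fun _ => ghost (Module.finBasis ℝ F i)) e)
    (isSmooth_smul_ofTriv (C.η_smooth x) (C.η_supp x) fun _ _ => weakSmoothAt_const _)

/-- The ghost momenta of the local frame around `x`, cut off. -/
def frameMomentum (x : S) (i : Fin (Module.finrank ℝ F)) : BFVAlg EB F V :=
  mkSection (fun e => C.η x e.proj •
      ofTriv x (fun _ => ghostMomentum ((Module.finBasis ℝ F).coord i)) e)
    (isSmooth_smul_ofTriv (C.η_smooth x) (C.η_supp x) fun _ _ => weakSmoothAt_const _)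

theorem evalAt_frameGhost {x : S} (i : Fin (Module.finrank ℝ F)) {e : TotalSpace F V}
    (he : e ∈ trivDomain F V x) :
    evalAt e (C.frameGhost x i) = C.η x e.proj • ghost (frameBasis x he i) := by
  rw [frameGhost, evalAt_mkSection, ofTriv, ghostMap_ghost,
    Trivialization.symmₗ_apply (R := ℝ) (e := trivializationAt F V x) (hb := he)]
  rfl

theorem evalAt_frameMomentum {x : S} (i : Fin (Module.finrank ℝ F)) {e : TotalSpace F V}
    (he : e ∈ trivDomain F V x) :
    evalAt e (C.frameMomentum x i) =
      C.η x e.proj • ghostMomentum ((frameBasis x he).coord i) := by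
  rw [frameMomentum, evalAt_mkSection, ofTriv, ghostMap_ghostMomentum]
  congr 2
  ext v
  rw [LinearMap.comp_apply, Trivialization.linearMapAt_def_of_mem _ he]
  simp [frameBasis, fibreEquiv]

theorem η_eq_zero {x : S} {e : TotalSpace F V} (he : e ∉ trivDomain F V x) :
    C.η x e.proj = 0 := image_eq_zero_of_notMem_tsupport fun h => he (C.η_supp x h)

theorem evalAt_frameGhost_of_notMem {x : S} (i : Fin (Module.finrank ℝ F)) {e : TotalSpace F V}
    (he : e ∉ trivDomain F V x) : evalAt e (C.frameGhost x i) = 0 := by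
  rw [frameGhost, evalAt_mkSection, C.η_eq_zero he, zero_smul]

theorem evalAt_frameMomentum_of_notMem {x : S} (i : Fin (Module.finrank ℝ F))
    {e : TotalSpace F V} (he : e ∉ trivDomain F V x) : evalAt e (C.frameMomentum x i) = 0 := by
  rw [frameMomentum, evalAt_mkSection, C.η_eq_zero he, zero_smul]

theorem _root_.BFV.ghost_mem_bideg {W : Type*} [AddCommGroup W] [Module ℝ W] (v : W) :
    ghost v ∈ bideg W 1 0 := by
  rw [bideg, pow_one, pow_zero, mul_one]
  exact ⟨v, rfl⟩

theorem _root_.BFV.ghostMomentum_mem_bideg {W : Type*} [AddCommGroup W] [Module ℝ W]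
    (ξ : Module.Dual ℝ W) : ghostMomentum ξ ∈ bideg W 0 1 := by
  rw [bideg, pow_one, pow_zero, one_mul]
  exact ⟨ξ, rfl⟩

theorem frameGhost_mem (x : S) (i : Fin (Module.finrank ℝ F)) :
    C.frameGhost x i ∈ bfvBideg EB F V 1 0 := fun _ =>
  Submodule.smul_mem _ _ (ghostMap_mem_bideg _ _ (ghost_mem_bideg _))

theorem frameMomentum_mem (x : S) (i : Fin (Module.finrank ℝ F)) :
    C.frameMomentum x i ∈ bfvBideg EB F V 0 1 := fun _ =>
  Submodule.smul_mem _ _ (ghostMap_mem_bideg _ _ (ghostMomentum_mem_bideg _))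

theorem _root_.BFV.bfvBideg_le_weight (p q : ℕ) :
    bfvBideg EB F V p q ≤ (bfvWeight EB F V).W (p + q) := fun a ha e => by
  have := bideg_le_gradedPart 1 1 p q (ha e)
  rwa [mul_one, mul_one] at this

theorem _root_.BFV.bfvBideg_le_deg (p q : ℕ) :
    bfvBideg EB F V p q ≤ bfvDeg EB F V (p - q) := fun a ha e => by
  have := bideg_le_gradedPart 1 (-1) p q (ha e)
  rw [totalDeg_eq]
  rwa [mul_one, mul_neg_one, ← sub_eq_add_neg] at this

variable {G : BFVAlg EB F V →ₗ[ℝ] BFVAlg EB F V →ₗ[ℝ] BFVAlg EB F V}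

/-- The local frame around `x`. -/
def fibreFrame (hG : IsPairing G) (x : S) :
    FibreFrame (bfvWeight EB F V) G (Fin (Module.finrank ℝ F) ⊕ Fin (Module.finrank ℝ F)) where
  z := Sum.elim (C.frameGhost x) (C.frameMomentum x)
  deg := Sum.elim (fun _ => 1) (fun _ => -1)
  swap := Equiv.sumComm _ _
  cutoff := baseFunction (C.η x) (C.η_smooth x) * baseFunction (C.η x) (C.η_smooth x)
  deg_odd := by rintro (i | i) <;> simp
  deg_swap := by rintro (i | i) <;> simp
  swap_swap := by rintro (i | i) <;> simp
  z_deg := by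
    rintro (i | i)
    · simpa using bfvBideg_le_deg 1 0 (C.frameGhost_mem x i)
    · simpa using bfvBideg_le_deg 0 1 (C.frameMomentum_mem x i)
  z_mem := by
    rintro (i | i)
    · simpa using bfvBideg_le_weight 1 0 (C.frameGhost_mem x i)
    · simpa using bfvBideg_le_weight 0 1 (C.frameMomentum_mem x i)
  cutoff_mem := (bfvWeight EB F V).mul_mem (baseFunction_mem _) (baseFunction_mem _)
  euler {n a} ha := section_ext fun e => by
    rw [map_sum, map_smul, mul_assoc, evalAt_baseFunction_mul, evalAt_baseFunction_mul,
      Fintype.sum_sum_type]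
    simp only [map_mul, hG _ _ e, Sum.elim_inl, Sum.elim_inr, Equiv.sumComm_apply, Sum.swap_inl,
      Sum.swap_inr]
    by_cases he : e ∈ trivDomain F V x
    · simp only [C.evalAt_frameGhost _ he, C.evalAt_frameMomentum _ he, ← pairingBilin_apply,
        map_smul, LinearMap.smul_apply]
      simp only [pairingBilin_apply, pairingBracket_ghost, pairingBracket_ghostMomentum,
        smul_mul_assoc, mul_smul_comm, ← Finset.smul_sum]
      rw [← smul_add, ← smul_add, ← Finset.sum_add_distrib,
        sum_ghost_mul_contract (frameBasis x he) (ha e), smul_comm (n : ℝ),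
        smul_comm (n : ℝ)]
    · simp only [C.evalAt_frameGhost_of_notMem _ he, C.evalAt_frameMomentum_of_notMem _ he,
        C.η_eq_zero he, zero_smul, zero_mul, Finset.sum_const_zero, add_zero, smul_zero]

/-- The cover by local frames. -/
def frameCover (hG : IsPairing G) : FrameCover (bfvWeight EB F V) G S
    (Fin (Module.finrank ℝ F) ⊕ Fin (Module.finrank ℝ F)) where
  ρ x := baseFunction (C.ρ x) (C.smooth x)
  fr := C.fibreFrame hG
  ρ_mem x := baseFunction_mem _
  ρ_cutoff x := section_ext fun e => by
    change evalAt e (baseFunction _ _ * (baseFunction _ _ * baseFunction _ _)) = _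
    rw [evalAt_baseFunction_mul, evalAt_baseFunction_mul, evalAt_baseFunction, evalAt_baseFunction,
      smul_smul, C.ρ_mul_η, Algebra.smul_def, ← map_mul, C.ρ_mul_η]
  separated a h := section_ext fun e => by
    rw [map_zero, ← C.sum_smul_eq (e := e) (g := fun _ => 0) (x := evalAt e a) fun i => ?_]
    · simp
    · rw [smul_zero, ← evalAt_baseFunction_mul (C.smooth i), h i, map_zero]
  glue X j hmul hdeg hW := by
    refine ⟨{ toFun := fun a => C.glueSections fun i => X i a
              map_add' := fun a b => section_ext fun e => ?_
              map_smul' := fun r a => section_ext fun e => ?_ },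
      fun a b => section_ext fun e => ?_, fun k a ha e => ?_, fun n a ha e => ?_,
      fun u v t h => section_ext fun e => ?_⟩
    · simp only [C.evalAt_glueSections, map_add, smul_add, Finset.sum_add_distrib]
    · simp only [C.evalAt_glueSections, map_smul, RingHom.id_apply, Finset.smul_sum]
      exact Finset.sum_congr rfl fun i _ => smul_comm _ _ _
    · simp only [LinearMap.coe_mk, AddHom.coe_mk, map_add, map_mul, C.evalAt_glueSections, hmul, Finset.sum_mul,
        Finset.mul_sum, smul_add, Finset.sum_add_distrib, smul_mul_assoc, mul_smul_comm]
    · exact Submodule.sum_mem _ fun i _ => Submodule.smul_mem _ _ (hdeg i k a ha e)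
    · exact Submodule.sum_mem _ fun i _ => Submodule.smul_mem _ _ (hW i n a ha e)
    · rw [← C.sum_smul_eq (e := e) (g := fun i => evalAt e (lieBracket G (X i) u v))
        (x := evalAt e t) fun i => ?_]
      · simp only [lieBracket_apply, map_add, map_sub, hG _ _ e, LinearMap.coe_mk, AddHom.coe_mk,
          C.evalAt_glueSections, ← pairingBilin_apply, map_sum, map_smul, LinearMap.sum_apply, LinearMap.smul_apply,
          smul_add, smul_sub, Finset.sum_add_distrib, Finset.sum_sub_distrib]
      · rw [← evalAt_baseFunction_mul (C.smooth i), h i, evalAt_baseFunction_mul]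

end TrivCover

end Cover

section Homogeneous

variable {A : Type*} [Ring A] [Algebra ℝ A] {𝒜 : ℤ → Submodule ℝ A} {w : WeightDecomposition 𝒜}
  {G : A →ₗ[ℝ] A →ₗ[ℝ] A} {I ι : Type*} [Fintype ι] {τ : A}

/-- The isomorphism theorem, with the conditions on the brackets stated for homogeneous
elements. -/
theorem FrameCover.exists_algEquiv_of_homogeneous (C : FrameCover w G I ι)
    (hG : IsFibreBracket w G) (B B' : GradedPoissonBracket 𝒜)
    (hB : ∀ k l n m a b, a ∈ 𝒜 k → a ∈ w.W n → b ∈ 𝒜 l → b ∈ w.W m →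
      B.br a b - G a b ∈ w.F (n + m))
    (hB' : ∀ k l n m a b, a ∈ 𝒜 k → a ∈ w.W n → b ∈ 𝒜 l → b ∈ w.W m →
      B'.br a b - G a b ∈ w.F (n + m))
    (h0 : ∀ f ∈ w.W 0, ∀ g ∈ w.W 0, B'.br f g - B.br f g ∈ w.F 1) (hτ : τ ∈ 𝒜 1)
    (hτW : τ ∈ w.W 1) (hK : KoszulExact w G τ) (Ω Ω' : A) (hΩ : Ω ∈ 𝒜 1) (hΩ' : Ω' ∈ 𝒜 1)
    (mc : B.br Ω Ω = 0) (mc' : B'.br Ω' Ω' = 0) (low : Ω - τ ∈ w.F 2) (low' : Ω' - τ ∈ w.F 2) :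
    ∃ ψ : A ≃ₐ[ℝ] A, (∀ k a, ψ a ∈ 𝒜 k ↔ a ∈ 𝒜 k) ∧
      (∀ a b, ψ (B.br a b) = B'.br (ψ a) (ψ b)) ∧ ψ Ω = Ω' :=
  C.exists_algEquiv hG B B'
    (WeightDecomposition.Shift.of_hom fun k l n m a b h1 h2 h3 h4 => by
      rw [add_zero]
      exact hB k l n m a b h1 h2 h3 h4)
    (WeightDecomposition.Shift.of_hom fun k l n m a b h1 h2 h3 h4 => by
      rw [add_zero]
      exact hB' k l n m a b h1 h2 h3 h4)
    h0 hτ hτW hK Ω Ω' hΩ hΩ' mc mc' low low'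

end Homogeneous

/-! ### The leading terms of the brackets -/

section Derivative

variable {EM : Type*} [NormedAddCommGroup EM] [NormedSpace ℝ EM] {HM : Type*} [TopologicalSpace HM]
  {I : ModelWithCorners ℝ EM HM} {M : Type*} [TopologicalSpace M] [ChartedSpace HM M]

theorem mvfderiv_sum_mul {ι : Type*} (T : Finset ι) {f : ι → M → ℝ} (c : ι → ℝ) {e : M}
    (hf : ∀ s, MDifferentiableAt I 𝓘(ℝ, ℝ) (f s) e) :
    MDifferentiableAt I 𝓘(ℝ, ℝ) (fun e => ∑ s ∈ T, f s e * c s) e ∧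
      mvfderiv I (fun e => ∑ s ∈ T, f s e * c s) e = ∑ s ∈ T, c s • mvfderiv I (f s) e := by
  classical
  induction T using Finset.induction with
  | empty =>
    simp only [Finset.sum_empty]
    exact ⟨mdifferentiableAt_const, mvfderiv_const _⟩
  | insert s T hs ih =>
    simp only [Finset.sum_insert hs]
    have hc : MDifferentiableAt I 𝓘(ℝ, ℝ) (fun _ : M => c s) e := mdifferentiableAt_const
    have h1 : MDifferentiableAt I 𝓘(ℝ, ℝ) (fun e => f s e * c s) e := (hf s).mul hc
    have h2 : mvfderiv I (fun e => f s e * c s) e = c s • mvfderiv I (f s) e := by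
      have h := mvfderiv_mul (hf s) hc
      rw [mvfderiv_const, smul_zero, zero_add] at h
      exact h
    refine ⟨h1.add ih.1, ?_⟩
    have h := mvfderiv_add h1 ih.1
    rw [h2, ih.2] at h
    exact h

variable {X : Type*} [AddCommGroup X] [Module ℝ X]

/-- A functional applied to the derivative of a vector-valued function, computed in coordinates. -/
theorem apply_sum_mvfderiv {κ : Type*} [Fintype κ] (w : Module.Basis κ ℝ X) {u : M → X} {e : M}
    (hu : WeakSmoothAt I u e) (Y : TangentSpace I e) (ℓ : Module.Dual ℝ X) :
    ℓ (∑ s, mvfderiv I (fun e => w.coord s (u e)) e Y • w s) =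
      mvfderiv I (fun e => ℓ (u e)) e Y := by
  have h : (fun e => ℓ (u e)) = fun e => ∑ s, w.coord s (u e) * ℓ (w s) := by
    funext e
    conv_lhs => rw [← w.sum_repr (u e), map_sum]
    simp
  rw [h, (mvfderiv_sum_mul Finset.univ (fun s => ℓ (w s)) fun s =>
    (hu (w.coord s)).mdifferentiableAt (by simp)).2]
  simp [mul_comm]

theorem sum_mvfderiv_mem {κ : Type*} [Fintype κ] (w : Module.Basis κ ℝ X) {u : M → X} {e : M}
    (hu : WeakSmoothAt I u e) (Y : TangentSpace I e) {p : X →ₗ[ℝ] X} (hp : ∀ e, p (u e) = u e) :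
    p (∑ s, mvfderiv I (fun e => w.coord s (u e)) e Y • w s) =
      ∑ s, mvfderiv I (fun e => w.coord s (u e)) e Y • w s := by
  refine w.ext_elem fun t => ?_
  have h1 := apply_sum_mvfderiv w hu Y (w.coord t ∘ₗ p)
  have h2 := apply_sum_mvfderiv w hu Y (w.coord t)
  simp only [LinearMap.comp_apply, hp] at h1
  exact h1.trans h2.symm

end Derivative

section Brackets

variable {EB : Type*} [NormedAddCommGroup EB] [NormedSpace ℝ EB]
  {S : Type*} [TopologicalSpace S] [ChartedSpace EB S]
  {F : Type*} [NormedAddCommGroup F] [NormedSpace ℝ F] [FiniteDimensional ℝ F]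
  {V : S → Type*} [TopologicalSpace (TotalSpace F V)]
  [∀ x, AddCommGroup (V x)] [∀ x, Module ℝ (V x)] [∀ x, TopologicalSpace (V x)]
  [FiberBundle F V] [VectorBundle ℝ F V]
  [∀ x, IsTopologicalAddGroup (V x)] [∀ x, ContinuousSMul ℝ (V x)]

theorem inTriv_mem {a : BFVAlg EB F V} {n : ℤ} (ha : a ∈ (bfvWeight EB F V).W n) (x : S)
    (e : TotalSpace F V) : inTriv x a.1 e ∈ gradedPart F 1 1 n := ghostMap_mem_gradedPart _ _ (ha e)

theorem nabla_mem (cov : CovariantDerivative 𝓘(ℝ, EB) F V) {a : BFVAlg EB F V} {n : ℤ}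
    (ha : a ∈ (bfvWeight EB F V).W n) (e : TotalSpace F V)
    (Y : TangentSpace (𝓘(ℝ, EB).prod 𝓘(ℝ, F)) e) :
    nabla cov a.1 e Y ∈ gradedPart (V e.proj) 1 1 n := by
  refine ghostMap_mem_gradedPart _ _ (Submodule.add_mem _ ?_ ?_)
  · rw [← sum_mvfderiv_mem (ghostBasis F) (a.2.weakSmoothAt (mem_trivDomain e)) Y
      (p := gradedProj 1 1 n) fun e' => gradedProj_of_mem (inTriv_mem ha _ e')]
    exact gradedProj_mem _ _ _ _
  · rw [derivationExt_eq]
    exact wedgeContract_weight _ _ (inTriv_mem ha _ e)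

theorem nabla_function (cov cov' : CovariantDerivative 𝓘(ℝ, EB) F V) {a : BFVAlg EB F V}
    (ha : a ∈ (bfvWeight EB F V).W 0) (e : TotalSpace F V)
    (Y : TangentSpace (𝓘(ℝ, EB).prod 𝓘(ℝ, F)) e) : nabla cov a.1 e Y = nabla cov' a.1 e Y := by
  obtain ⟨r, hr⟩ := exists_algebraMap_of_weight_zero (inTriv_mem ha e.proj e)
  rw [nabla, nabla, hr, derivationExt_eq, derivationExt_eq, wedgeContract_algebraMap,
    wedgeContract_algebraMap]

variable [FiniteDimensional ℝ EB]
  {P : PoissonBivector (𝓘(ℝ, EB).prod 𝓘(ℝ, F)) (TotalSpace F V)}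

theorem horizontalLift_mem (cov : CovariantDerivative 𝓘(ℝ, EB) F V) {a b : BFVAlg EB F V}
    {n m : ℤ} (ha : a ∈ (bfvWeight EB F V).W n) (hb : b ∈ (bfvWeight EB F V).W m)
    (e : TotalSpace F V) :
    horizontalLift cov P a.1 b.1 e ∈ gradedPart (V e.proj) 1 1 (n + m) :=
  Submodule.sum_mem _ fun _ _ => Submodule.sum_mem _ fun _ _ => Submodule.smul_mem _ _
    (mul_mem_gradedPart (nabla_mem cov ha e _) (nabla_mem cov hb e _))

theorem horizontalLift_function (cov cov' : CovariantDerivative 𝓘(ℝ, EB) F V)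
    {a b : BFVAlg EB F V} (ha : a ∈ (bfvWeight EB F V).W 0) (hb : b ∈ (bfvWeight EB F V).W 0)
    (e : TotalSpace F V) :
    horizontalLift cov P a.1 b.1 e = horizontalLift cov' P a.1 b.1 e := by
  simp only [horizontalLift, nabla_function cov cov' ha, nabla_function cov cov' hb]

variable {cov : CovariantDerivative 𝓘(ℝ, EB) F V} {B : GradedPoissonBracket (bfvDeg EB F V)}

theorem IsBFVBracket.gradedProj_br (hB : IsBFVBracket cov P B) {p q p' q' : ℕ}
    {a b : BFVAlg EB F V} (ha : a ∈ bfvBideg EB F V p q) (hb : b ∈ bfvBideg EB F V p' q') {N : ℤ}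
    (hN : N < p + q + (p' + q') + 2) (e : TotalSpace F V) :
    gradedProj 1 1 N (evalAt e (B.br a b)) =
      gradedProj 1 1 N (pairingBracket (fibreBasis F V e.proj) (evalAt e a) (evalAt e b)) +
        gradedProj 1 1 N (horizontalLift cov P a.1 b.1 e) := by
  have h := gradedProj_higher (n := N) (by push_cast; omega) (hB p q p' q' a ha b hb e)
  rw [map_sub, map_sub, sub_sub, sub_eq_zero] at h
  exact h

theorem IsBFVBracket.shift (hB : IsBFVBracket cov P B) :
    (bfvWeight EB F V).Shift B.br (-2) :=
  WeightDecomposition.Shift.of_hom fun k l n m a b hk hn hl hm => by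
    rcases mem_bfvBideg_of_homogeneous hk hn with rfl | ⟨p, q, -, rfl, ha⟩
    · simp
    rcases mem_bfvBideg_of_homogeneous hl hm with rfl | ⟨p', q', -, rfl, hb⟩
    · simp
    refine fun N hN => section_ext fun e => ?_
    rw [evalAt_proj, map_zero, hB.gradedProj_br ha hb (by omega),
      gradedProj_of_ne (pairingBracket_mem _ (hn e) (hm e)) (by omega),
      gradedProj_of_ne (horizontalLift_mem cov hn hm e) (by omega), add_zero]

theorem IsBFVBracket.isPairing_lead (hB : IsBFVBracket cov P B) :
    IsPairing ((bfvWeight EB F V).lead B.br (-2)) := by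
  intro a b e
  rw [← pairingBilin_apply]
  refine (bfvWeight EB F V).induction (p := fun a => evalAt e
    ((bfvWeight EB F V).lead B.br (-2) a b) = pairingBilin _ (evalAt e a) (evalAt e b))
    (fun a a' h h' => by simp only [map_add, LinearMap.add_apply, h, h'])
    (fun k n a hk hn => ?_) a
  refine (bfvWeight EB F V).induction (p := fun b => evalAt e
    ((bfvWeight EB F V).lead B.br (-2) a b) = pairingBilin _ (evalAt e a) (evalAt e b))
    (fun a a' h h' => by simp only [map_add, h, h'])
    (fun l m b hl hm => ?_) b
  rcases mem_bfvBideg_of_homogeneous hk hn with rfl | ⟨p, q, -, rfl, ha⟩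
  · simp
  rcases mem_bfvBideg_of_homogeneous hl hm with rfl | ⟨p', q', -, rfl, hb⟩
  · simp
  have h := pairingBracket_mem (fibreBasis F V e.proj) (hn e) (hm e)
  rw [WeightDecomposition.lead_apply B.br (-2) hn hm, evalAt_proj,
    hB.gradedProj_br ha hb (by omega), gradedProj_of_ne (horizontalLift_mem cov hn hm e) (by omega),
    add_zero]
  exact gradedProj_of_mem h

theorem IsBFVBracket.sub_pairing_mem (hB : IsBFVBracket cov P B)
    {G : BFVAlg EB F V →ₗ[ℝ] BFVAlg EB F V →ₗ[ℝ] BFVAlg EB F V} (hG : IsPairing G) {k l n m : ℤ}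
    {a b : BFVAlg EB F V} (hk : a ∈ bfvDeg EB F V k) (hn : a ∈ (bfvWeight EB F V).W n)
    (hl : b ∈ bfvDeg EB F V l) (hm : b ∈ (bfvWeight EB F V).W m) :
    B.br a b - G a b ∈ (bfvWeight EB F V).F (n + m) := by
  rcases mem_bfvBideg_of_homogeneous hk hn with rfl | ⟨p, q, -, rfl, ha⟩
  · simp
  rcases mem_bfvBideg_of_homogeneous hl hm with rfl | ⟨p', q', -, rfl, hb⟩
  · simp
  refine fun N hN => section_ext fun e => ?_
  rw [evalAt_proj, map_zero, map_sub, map_sub, hG, hB.gradedProj_br ha hb (by omega),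
    gradedProj_of_ne (horizontalLift_mem cov hn hm e) (by omega), add_zero, sub_self]

theorem IsPairing.eq_zero {G : BFVAlg EB F V →ₗ[ℝ] BFVAlg EB F V →ₗ[ℝ] BFVAlg EB F V}
    (hG : IsPairing G) {f : BFVAlg EB F V} (hf : f ∈ (bfvWeight EB F V).W 0) (b : BFVAlg EB F V) :
    G f b = 0 := section_ext fun e => by
  obtain ⟨r, hr⟩ := exists_algebraMap_of_weight_zero (hf e)
  rw [hG, hr, pairingBracket_algebraMap, map_zero]

theorem IsBFVBracket.isFibreBracket (hB : IsBFVBracket cov P B) :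
    IsFibreBracket (bfvWeight EB F V) ((bfvWeight EB F V).lead B.br (-2)) :=
  isFibreBracket_lead B hB.shift fun hf b => hB.isPairing_lead.eq_zero hf b

theorem IsBFVBracket.sub_mem {cov' : CovariantDerivative 𝓘(ℝ, EB) F V}
    {B' : GradedPoissonBracket (bfvDeg EB F V)} (hB : IsBFVBracket cov P B)
    (hB' : IsBFVBracket cov' P B') {f g : BFVAlg EB F V} (hf : f ∈ (bfvWeight EB F V).W 0)
    (hg : g ∈ (bfvWeight EB F V).W 0) : B'.br f g - B.br f g ∈ (bfvWeight EB F V).F 1 := by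
  have key : ∀ {f}, f ∈ (bfvWeight EB F V).W 0 → f ∈ bfvBideg EB F V 0 0 := fun hf e =>
    mem_bideg_of_mem_totalDeg (k := 0) (by simp) ((bfvWeight EB F V).zero_le hf e)
      (show _ ∈ gradedPart _ _ _ ((0 : ℕ) + (0 : ℕ)) by rw [Nat.cast_zero, add_zero]; exact hf e)
  refine fun N hN => section_ext fun e => ?_
  rw [evalAt_proj, map_zero, map_sub, map_sub,
    hB.gradedProj_br (key hf) (key hg) (by push_cast; omega),
    hB'.gradedProj_br (key hf) (key hg) (by push_cast; omega),
    horizontalLift_function cov cov' hf hg, sub_self]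

end Brackets

/-! ### The radial homotopy of the Koszul complex -/

section Radial

open MeasureTheory

variable {Q : Type*} [NormedAddCommGroup Q] [NormedSpace ℝ Q]
  {F : Type*} [NormedAddCommGroup F] [NormedSpace ℝ F]
  {X : Type*} [NormedAddCommGroup X] [NormedSpace ℝ X] [CompleteSpace X]

theorem contDiffOn_intervalIntegral {s : Set Q} (hs : IsOpen s) {u : Q → ℝ → X}
    (hu : ContDiffOn ℝ ∞ (fun z : Q × ℝ => u z.1 z.2) (s ×ˢ Set.univ)) :
    ContDiffOn ℝ ∞ (fun p => ∫ t in (0 : ℝ)..1, u p t) s := by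
  let φ : ContDiffBump (0 : ℝ) := ⟨1, 2, one_pos, one_lt_two⟩
  let f : ℝ → ℝ := (Set.Ioc 0 1).indicator fun _ => 1
  let g : Q → ℝ → X := fun p x => φ x • u p (-x)
  have hf : LocallyIntegrable f volume :=
    ((integrable_indicator_iff measurableSet_Ioc).2
      (integrableOn_const (by simp))).locallyIntegrable
  have hg : ContDiffOn ℝ ∞ (fun z : Q × ℝ => g z.1 z.2) (s ×ˢ Set.univ) := by
    refine ContDiffOn.smul (φ.contDiff.comp contDiff_snd).contDiffOn ?_
    have h : ContDiffOn ℝ ∞ (fun z : Q × ℝ => (z.1, -z.2)) (s ×ˢ Set.univ) := by fun_prop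
    exact hu.comp h fun z hz => ⟨hz.1, Set.mem_univ _⟩
  have h := contDiffOn_convolution_right_with_param (n := ⊤) (μ := volume)
    (ContinuousLinearMap.lsmul ℝ ℝ) hs (isCompact_closedBall (0 : ℝ) 2)
    (g := g) (f := f) (fun p x _ hx => by
      have : φ x = 0 := φ.zero_of_le_dist (by
        have h := Metric.mem_closedBall.not.1 hx
        exact (not_le.1 h).le)
      simp only [g, this, zero_smul]) hf hg
  have h2 := h.comp (contDiff_id.prodMk (contDiff_const (c := (0 : ℝ)))).contDiffOn
    (fun p hp => ⟨hp, Set.mem_univ _⟩)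
  refine h2.congr fun p _ => ?_
  simp only [Function.comp_def, MeasureTheory.convolution_def, id_eq, zero_sub]
  rw [intervalIntegral.integral_of_le zero_le_one, ← integral_indicator measurableSet_Ioc]
  refine integral_congr_ae (Filter.Eventually.of_forall fun t => ?_)
  simp only [f, g, neg_neg, ContinuousLinearMap.lsmul_apply]
  by_cases ht : t ∈ Set.Ioc (0 : ℝ) 1
  · have : φ (-t) = 1 := φ.one_of_mem_closedBall (by
      rw [Metric.mem_closedBall, dist_zero_right, norm_neg, Real.norm_of_nonneg ht.1.le]
      exact ht.2)
    rw [Set.indicator_of_mem ht, Set.indicator_of_mem ht, this, one_smul, one_smul]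
  · rw [Set.indicator_of_notMem ht, Set.indicator_of_notMem ht, zero_smul]

/-- The radial homotopy: if `c` is a contraction, `m i` are the multiplications with the dual
coordinates and `g` is a cycle of degree `q`, then the radial integral of the derivative of `g` is
a primitive of `g`. -/
theorem contract_radial_integral {κ : Type*} [Fintype κ] (b : Module.Basis κ ℝ F)
    (c : F →L[ℝ] X →L[ℝ] X) (m : κ → X →L[ℝ] X)
    (hcm : ∀ v i x, c v (m i x) = b.coord i v • x - m i (c v x)) {g : F → X}
    (hg : ContDiff ℝ ∞ g) {q : ℕ} (hq : 0 < q)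
    (heul : ∀ y, ∑ i, m i (c (b i) (g y)) = (q : ℝ) • g y) (hcg : ∀ y, c y (g y) = 0) (y : F) :
    c y (∑ i, m i (∫ t in (0 : ℝ)..1, t ^ q • fderiv ℝ g (t • y) (b i))) = g y := by
  have hd : Differentiable ℝ g := hg.differentiable (by simp)
  have hc' : Continuous (fderiv ℝ g) := hg.continuous_fderiv (by simp)
  have hcont : ∀ i, Continuous fun t : ℝ => t ^ q • fderiv ℝ g (t • y) (b i) := fun i => by
    fun_prop
  have hcyc : ∀ (t : ℝ) i, t • c y (fderiv ℝ g (t • y) (b i)) = -c (b i) (g (t • y)) := by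
    intro t i
    have h1 : HasFDerivAt (fun z => c z (g z))
        ((c (t • y)).comp (fderiv ℝ g (t • y)) + c.flip (g (t • y))) (t • y) := by
      have := c.hasFDerivAt_of_bilinear (hasFDerivAt_id (t • y)) (hd (t • y)).hasFDerivAt
      convert! this using 1
    have h2 : (fun z => c z (g z)) = fun _ => 0 := funext hcg
    rw [h2] at h1
    have h3 := congrArg (fun L => L (b i)) (h1.unique (hasFDerivAt_const (0 : X) (t • y)))
    simp only [add_apply, ContinuousLinearMap.comp_apply, map_smul,
      smul_apply, ContinuousLinearMap.flip_apply,
      zero_apply] at h3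
    exact eq_neg_of_add_eq_zero_left h3
  have hder : ∀ t : ℝ, HasDerivAt (fun t : ℝ => t ^ q • g (t • y))
      (t ^ q • fderiv ℝ g (t • y) y + (q * t ^ (q - 1)) • g (t • y)) t := by
    intro t
    have h1 : HasDerivAt (fun t : ℝ => t • y) y t := by
      simpa using (hasDerivAt_id t).smul_const y
    have h2 : HasDerivAt (fun t : ℝ => g (t • y)) (fderiv ℝ g (t • y) y) t :=
      (hd (t • y)).hasFDerivAt.comp_hasDerivAt t h1
    exact (hasDerivAt_pow q t).smul h2
  have hfun : ∀ t : ℝ, t ^ q • fderiv ℝ g (t • y) y + (q * t ^ (q - 1)) • g (t • y) =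
      ∑ i, c y (m i (t ^ q • fderiv ℝ g (t • y) (b i))) := by
    intro t
    obtain ⟨r, rfl⟩ : ∃ r, q = r + 1 := ⟨q - 1, by omega⟩
    have e1 : fderiv ℝ g (t • y) y = ∑ i, b.coord i y • fderiv ℝ g (t • y) (b i) := by
      conv_lhs => rw [← b.sum_repr y, map_sum]
      simp
    simp only [hcm, map_smul, smul_sub, Finset.sum_sub_distrib]
    rw [e1, Finset.smul_sum, sub_eq_add_neg]
    congr 1
    · rw [mul_comm, mul_smul, ← heul, Finset.smul_sum, ← Finset.sum_neg_distrib, Nat.add_sub_cancel]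
      refine Finset.sum_congr rfl fun i _ => ?_
      have h := congrArg (m i) (hcyc t i)
      rw [map_smul, map_neg] at h
      rw [pow_succ, mul_smul, h, smul_neg, neg_neg]
  have hint := intervalIntegral.integral_eq_sub_of_hasDerivAt (a := 0) (b := 1)
    (fun t _ => hder t) (Continuous.intervalIntegrable (by
      have := hd.continuous
      fun_prop) 0 1)
  simp only [one_pow, one_smul, zero_pow hq.ne', zero_smul, sub_zero] at hint
  rw [← hint, map_sum]
  simp only [hfun]
  rw [intervalIntegral.integral_finsetSum fun i _ => Continuous.intervalIntegrable (by
    exact ((c y).comp (m i)).continuous.comp (hcont i)) 0 1]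
  refine Finset.sum_congr rfl fun i _ => ?_
  exact (((c y).comp (m i)).intervalIntegral_comp_comm ((hcont i).intervalIntegrable 0 1)).symm

theorem integral_fderiv_mem [FiniteDimensional ℝ X] {p : Submodule ℝ X} {g : F → X}
    (hg : ContDiff ℝ ∞ g) (hmem : ∀ y, g y ∈ p) (q : ℕ) (y v : F) :
    ∫ t in (0 : ℝ)..1, t ^ q • fderiv ℝ g (t • y) v ∈ p := by
  have hd : Differentiable ℝ g := hg.differentiable (by simp)
  have hc' : Continuous (fderiv ℝ g) := hg.continuous_fderiv (by simp)
  have hcont : Continuous fun t : ℝ => t ^ q • fderiv ℝ g (t • y) v := by fun_prop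
  rw [← Subspace.forall_mem_dualAnnihilator_apply_eq_zero_iff]
  intro f hf
  have h0 : ∀ x ∈ p, f x = 0 := fun x hx => (Submodule.mem_dualAnnihilator f).1 hf x hx
  let f' : X →L[ℝ] ℝ := LinearMap.toContinuousLinearMap f
  have h1 : ∀ z w, f' (fderiv ℝ g z w) = 0 := by
    intro z w
    have h := (f'.hasFDerivAt (x := g z)).comp z (hd z).hasFDerivAt
    have h2 : f' ∘ g = fun _ => 0 := funext fun z => h0 _ (hmem z)
    rw [h2] at h
    exact congrArg (fun L => L w) (h.unique (hasFDerivAt_const (0 : ℝ) z))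
  change f' _ = 0
  rw [← f'.intervalIntegral_comp_comm (hcont.intervalIntegrable 0 1)]
  simp only [map_smul, h1, smul_zero, intervalIntegral.integral_zero]

end Radial

section RadialGhost

variable {F : Type*} [NormedAddCommGroup F] [NormedSpace ℝ F] [FiniteDimensional ℝ F]

variable (F) in
/-- The coordinates of elements of the fibre algebra. -/
def ghostCoords : GhostAlg F ≃ₗ[ℝ]
    (Finset (Fin (Module.finrank ℝ (F × Module.Dual ℝ F))) → ℝ) := (ghostBasis F).equivFun

/-- The radial integral of a derivative of a function with values in the fibre algebra. -/
def radialIntegral (q : ℕ) (g : F → GhostAlg F) (i : Fin (Module.finrank ℝ F)) (y : F) :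
    Finset (Fin (Module.finrank ℝ (F × Module.Dual ℝ F))) → ℝ :=
  ∫ t in (0 : ℝ)..1, t ^ q • fderiv ℝ (fun y => ghostCoords F (g y)) (t • y)
    (Module.finBasis ℝ F i)

/-- The radial primitive for the contraction with the Euler vector field. -/
def radialPrimitive (q : ℕ) (g : F → GhostAlg F) (y : F) : GhostAlg F :=
  ∑ i, ghostMomentum ((Module.finBasis ℝ F).coord i) *
    (ghostCoords F).symm (radialIntegral q g i y)

theorem radialPrimitive_mem {g : F → GhostAlg F}
    (hg : ContDiff ℝ ∞ fun y => ghostCoords F (g y)) {p q : ℕ} (hmem : ∀ y, g y ∈ bideg F p q)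
    (y : F) : radialPrimitive q g y ∈ bideg F p (q + 1) := by
  refine Submodule.sum_mem _ fun i _ => ?_
  have h := integral_fderiv_mem (p := (bideg F p q).map (ghostCoords F).toLinearMap) hg
    (fun y => Submodule.mem_map_of_mem (hmem y)) q y (Module.finBasis ℝ F i)
  obtain ⟨x, hx, hx'⟩ := h
  have e : (ghostCoords F).symm (radialIntegral q g i y) = x := by
    rw [radialIntegral, ← hx']
    exact (ghostCoords F).symm_apply_apply x
  rw [e]
  have := Submodule.mul_mem_mul (ghostMomentum_mem_bideg ((Module.finBasis ℝ F).coord i)) hx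
  rwa [bideg_mul_bideg, zero_add, add_comm 1 q] at this

theorem contractVector_radialPrimitive {g : F → GhostAlg F}
    (hg : ContDiff ℝ ∞ fun y => ghostCoords F (g y)) {p q : ℕ} (hq : 0 < q)
    (hmem : ∀ y, g y ∈ bideg F p q) (hc : ∀ y, contractVector y (g y) = 0) (y : F) :
    contractVector y (radialPrimitive q g y) = g y := by
  let Φ := ghostCoords F
  let b := Module.finBasis ℝ F
  let conj : (GhostAlg F →ₗ[ℝ] GhostAlg F) →ₗ[ℝ] _ :=
    (LinearMap.toContinuousLinearMap (𝕜 := ℝ)).toLinearMap ∘ₗ Φ.conj.toLinearMap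
  have hconj : ∀ f x, conj f x = Φ (f (Φ.symm x)) := fun f x => rfl
  have h := contract_radial_integral b
    (LinearMap.toContinuousLinearMap (conj ∘ₗ contractVector))
    (fun i => conj (LinearMap.mulLeft ℝ (ghostMomentum (b.coord i))))
    (g := fun y => Φ (g y)) (q := q) ?_ hg hq ?_ ?_ y
  · apply Φ.injective
    rw [← h]
    simp only [LinearMap.coe_toContinuousLinearMap', LinearMap.comp_apply, hconj,
      LinearMap.mulLeft_apply, map_sum, LinearEquiv.symm_apply_apply, radialPrimitive]
    rfl
  · intro v i x
    simp only [LinearMap.coe_toContinuousLinearMap', LinearMap.comp_apply, hconj,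
      LinearMap.mulLeft_apply, LinearEquiv.symm_apply_apply, contractVector_ghostMomentum_mul,
      map_sub, map_smul, LinearEquiv.apply_symm_apply]
  · intro y
    simp only [LinearMap.coe_toContinuousLinearMap', LinearMap.comp_apply, hconj,
      LinearMap.mulLeft_apply, LinearEquiv.symm_apply_apply]
    rw [← map_sum, sum_ghostMomentum_mul_contract b (hmem y), map_smul]
  · intro y
    simp only [LinearMap.coe_toContinuousLinearMap', LinearMap.comp_apply, hconj,
      LinearEquiv.symm_apply_apply, hc, map_zero]

end RadialGhost

/-! ### Exactness of the Koszul complex of the tautological section -/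

section Koszul

variable {EB : Type*} [NormedAddCommGroup EB] [NormedSpace ℝ EB]
  {S : Type*} [TopologicalSpace S] [ChartedSpace EB S]
  {F : Type*} [NormedAddCommGroup F] [NormedSpace ℝ F] [FiniteDimensional ℝ F]
  {V : S → Type*} [TopologicalSpace (TotalSpace F V)]
  [∀ x, AddCommGroup (V x)] [∀ x, Module ℝ (V x)] [∀ x, TopologicalSpace (V x)]
  [FiberBundle F V] [VectorBundle ℝ F V]

/-- The representative of a section in the trivialization around `x`, on the fibre over `z`. -/
def fibreSlice (x : S) (a : RawSection F V) (z : S) (y : F) : GhostAlg F :=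
  inTriv x a ⟨z, (trivializationAt F V x).symmₗ ℝ z y⟩

/-- The local primitive of a section in the trivialization around `x`. -/
def localPrimitive (x : S) (q : ℕ) (a : RawSection F V) (e : TotalSpace F V) : GhostAlg F :=
  radialPrimitive q (fibreSlice x a e.proj) ((trivializationAt F V x).linearMapAt ℝ e.proj e.2)

theorem fibreSlice_linearMapAt {x : S} (a : RawSection F V) {e : TotalSpace F V}
    (he : e ∈ trivDomain F V x) :
    fibreSlice x a e.proj ((trivializationAt F V x).linearMapAt ℝ e.proj e.2) = inTriv x a e := by
  rw [fibreSlice, (trivializationAt F V x).symmₗ_linearMapAt he]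

theorem contractVector_fibreSlice {x : S} {a : RawSection F V}
    (ha : ∀ e : TotalSpace F V, contractVector e.2 (a e) = 0) (z : S)
    (y : F) :
    contractVector y (fibreSlice x a z y) = 0 := by
  rw [fibreSlice, inTriv, contractVector_ghostMap]
  have h := ha ⟨z, (trivializationAt F V x).symmₗ ℝ z y⟩
  dsimp only at h ⊢
  rw [h, map_zero]

theorem contractVector_ofTriv {x : S} (g : TotalSpace F V → GhostAlg F) (e : TotalSpace F V) :
    contractVector e.2 (ofTriv x g e) = ofTriv x (fun e =>
      contractVector ((trivializationAt F V x).linearMapAt ℝ e.proj e.2) (g e)) e :=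
  contractVector_ghostMap _ _ _ _

variable [IsManifold 𝓘(ℝ, EB) ∞ S] [ContMDiffVectorBundle ∞ F V 𝓘(ℝ, EB)]

variable (EB F V) in
/-- The domain of the trivialization around `x` in the chart around `z`. -/
def chartDomain (x z : S) : Set EB :=
  (extChartAt 𝓘(ℝ, EB) z).target ∩
    (extChartAt 𝓘(ℝ, EB) z).symm ⁻¹' (trivializationAt F V x).baseSet

theorem isOpen_chartDomain (x z : S) : IsOpen (chartDomain EB F V x z) :=
  (continuousOn_extChartAt_symm z).isOpen_inter_preimage (isOpen_extChartAt_target z)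
    (trivializationAt F V x).open_baseSet

theorem mem_chartDomain {x z y : S} (hz : y ∈ (extChartAt 𝓘(ℝ, EB) z).source)
    (hx : y ∈ (trivializationAt F V x).baseSet) :
    extChartAt 𝓘(ℝ, EB) z y ∈ chartDomain EB F V x z :=
  ⟨(extChartAt 𝓘(ℝ, EB) z).map_source hz, by
    rw [Set.mem_preimage, (extChartAt 𝓘(ℝ, EB) z).left_inv hz]
    exact hx⟩

theorem contMDiffAt_ghostCoords {a : RawSection F V} (ha : IsSmooth EB a) {x : S}
    {e : TotalSpace F V} (he : e ∈ trivDomain F V x) :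
    ContMDiffAt (𝓘(ℝ, EB).prod 𝓘(ℝ, F)) 𝓘(ℝ, Finset (Fin (Module.finrank ℝ (F × Module.Dual ℝ F))) → ℝ) ∞
      (fun e => ghostCoords F (inTriv x a e)) e :=
  contMDiffAt_pi_space.2 fun s => ha.weakSmoothAt he ((ghostBasis F).coord s)

theorem contDiffOn_fibreSlice {a : RawSection F V} (ha : IsSmooth EB a) (x z : S) :
    ContDiffOn ℝ ∞ (fun w : EB × F =>
        ghostCoords F (fibreSlice x a ((extChartAt 𝓘(ℝ, EB) z).symm w.1) w.2))
      (chartDomain EB F V x z ×ˢ Set.univ) := by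
  rintro ⟨p, y⟩ ⟨hp, -⟩
  refine ContDiffAt.contDiffWithinAt (contMDiffAt_iff_contDiffAt.1 ?_)
  have h1 : ContMDiffAt 𝓘(ℝ, EB × F) 𝓘(ℝ, EB) ∞
      (fun w : EB × F => (extChartAt 𝓘(ℝ, EB) z).symm w.1) (p, y) :=
    ((contMDiffOn_extChartAt_symm z).contMDiffAt
      ((isOpen_extChartAt_target z).mem_nhds hp.1)).comp (p, y)
        (contDiff_fst.contMDiff.contMDiffAt)
  have h2 : ContMDiffAt 𝓘(ℝ, EB × F) (𝓘(ℝ, EB).prod 𝓘(ℝ, F)) ∞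
      (fun w : EB × F => ((extChartAt 𝓘(ℝ, EB) z).symm w.1, w.2)) (p, y) :=
    h1.prodMk contDiff_snd.contMDiff.contMDiffAt
  have h3 : ContMDiffAt 𝓘(ℝ, EB × F) (𝓘(ℝ, EB).prod 𝓘(ℝ, F)) ∞
      (fun w : EB × F => (trivializationAt F V x).toOpenPartialHomeomorph.symm
        ((extChartAt 𝓘(ℝ, EB) z).symm w.1, w.2)) (p, y) :=
    ((Trivialization.contMDiffOn_symm (IB := 𝓘(ℝ, EB)) (n := ∞)
      (trivializationAt F V x)).contMDiffAt
        ((trivializationAt F V x).open_target.mem_nhds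
          ((trivializationAt F V x).mem_target.2 (show (extChartAt 𝓘(ℝ, EB) z).symm p ∈ _ from hp.2)))).comp (p, y) h2
  have h4 : ∀ {w : EB × F}, w.1 ∈ chartDomain EB F V x z →
      (trivializationAt F V x).toOpenPartialHomeomorph.symm
        ((extChartAt 𝓘(ℝ, EB) z).symm w.1, w.2) =
      ⟨(extChartAt 𝓘(ℝ, EB) z).symm w.1,
        (trivializationAt F V x).symmₗ ℝ ((extChartAt 𝓘(ℝ, EB) z).symm w.1) w.2⟩ := by
    intro w hw
    rw [Trivialization.symmₗ_apply (R := ℝ) (e := trivializationAt F V x) (hb := hw.2)]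
    exact ((trivializationAt F V x).mk_symm hw.2 w.2).symm
  have h5 : ContMDiffAt 𝓘(ℝ, EB × F) (𝓘(ℝ, EB).prod 𝓘(ℝ, F)) ∞
      (fun w : EB × F => (⟨(extChartAt 𝓘(ℝ, EB) z).symm w.1,
        (trivializationAt F V x).symmₗ ℝ ((extChartAt 𝓘(ℝ, EB) z).symm w.1) w.2⟩ :
          TotalSpace F V)) (p, y) := by
    refine h3.congr_of_eventuallyEq ?_
    filter_upwards [((isOpen_chartDomain x z).prod isOpen_univ).mem_nhds
      (show (p, y) ∈ chartDomain EB F V x z ×ˢ Set.univ from ⟨hp, Set.mem_univ _⟩)] with w hw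
    exact (h4 hw.1).symm
  exact ContMDiffAt.comp (g := fun e => ghostCoords F (inTriv x a e)) (p, y)
    (contMDiffAt_ghostCoords ha (show _ ∈ trivDomain F V x from hp.2)) h5

theorem contDiff_fibreSlice {a : RawSection F V} (ha : IsSmooth EB a) {x z : S}
    (hz : z ∈ (trivializationAt F V x).baseSet) :
    ContDiff ℝ ∞ fun y => ghostCoords F (fibreSlice x a z y) := by
  have h := (contDiffOn_fibreSlice ha x z).comp
    (contDiff_const (c := extChartAt 𝓘(ℝ, EB) z z) |>.prodMk (contDiff_id (E := F))).contDiffOn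
    (s := Set.univ)
    (fun y _ => ⟨mem_chartDomain (mem_extChartAt_source z) hz, Set.mem_univ _⟩)
  rw [contDiffOn_univ] at h
  simpa only [Function.comp_def, extChartAt_to_inv, id_eq] using h

theorem contDiffOn_radialIntegral {a : RawSection F V} (ha : IsSmooth EB a) (x z : S) (q : ℕ)
    (i : Fin (Module.finrank ℝ F)) :
    ContDiffOn ℝ ∞ (fun w : EB × F =>
        radialIntegral q (fibreSlice x a ((extChartAt 𝓘(ℝ, EB) z).symm w.1)) i w.2)
      (chartDomain EB F V x z ×ˢ Set.univ) := by
  have hopen : IsOpen (chartDomain EB F V x z ×ˢ (Set.univ : Set F)) :=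
    (isOpen_chartDomain x z).prod isOpen_univ
  have hs := contDiffOn_fibreSlice ha x z
  refine (contDiffOn_intervalIntegral hopen (u := fun w t => t ^ q • fderiv ℝ (fun w : EB × F =>
    ghostCoords F (fibreSlice x a ((extChartAt 𝓘(ℝ, EB) z).symm w.1) w.2)) (w.1, t • w.2)
      (0, Module.finBasis ℝ F i)) ?_).congr fun w hw => ?_
  · have h1 : ContDiffOn ℝ ∞ (fun v : (EB × F) × ℝ => (v.1.1, v.2 • v.1.2))
        ((chartDomain EB F V x z ×ˢ (Set.univ : Set F)) ×ˢ (Set.univ : Set ℝ)) := by fun_prop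
    have h2 := (hs.fderiv_of_isOpen (m := ∞) hopen (by simp)).comp h1
      (fun v hv => ⟨hv.1.1, Set.mem_univ _⟩)
    have h3 : ContDiffOn ℝ ∞ (fun v : (EB × F) × ℝ => v.2 ^ q)
        ((chartDomain EB F V x z ×ˢ (Set.univ : Set F)) ×ˢ (Set.univ : Set ℝ)) := by fun_prop
    exact h3.smul (h2.clm_apply contDiffOn_const)
  · refine intervalIntegral.integral_congr fun t _ => ?_
    have hd := (hs.contDiffAt (hopen.mem_nhds
      (show (w.1, t • w.2) ∈ chartDomain EB F V x z ×ˢ (Set.univ : Set F) from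
        ⟨hw.1, Set.mem_univ _⟩))).differentiableAt (by simp)
    have h := hd.hasFDerivAt.comp (t • w.2) (hasFDerivAt_prodMk_right w.1 (t • w.2))
    have h' := h.fderiv
    simp only [Function.comp_def] at h'
    rw [h']
    simp

theorem weakSmoothAt_localPrimitive {a : RawSection F V} (ha : IsSmooth EB a) (x : S) (q : ℕ)
    {e : TotalSpace F V} (he : e ∈ trivDomain F V x) :
    WeakSmoothAt (𝓘(ℝ, EB).prod 𝓘(ℝ, F)) (localPrimitive x q a) e := by
  refine WeakSmoothAt.sum (I := 𝓘(ℝ, EB).prod 𝓘(ℝ, F)) (s := Finset.univ) (e := e)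
    (u := fun i (e : TotalSpace F V) => ghostMomentum ((Module.finBasis ℝ F).coord i) *
    (ghostCoords F).symm (radialIntegral q (fibreSlice x a e.proj) i
      ((trivializationAt F V x).linearMapAt ℝ e.proj e.2))) fun i _ => ?_
  refine WeakSmoothAt.map (f := LinearMap.mulLeft ℝ (ghostMomentum ((Module.finBasis ℝ F).coord i))
    ∘ₗ (ghostCoords F).symm.toLinearMap) (ContMDiffAt.weakSmoothAt ?_)
  have hT : ContMDiffAt (𝓘(ℝ, EB).prod 𝓘(ℝ, F)) 𝓘(ℝ, F) ∞
      (fun e : TotalSpace F V => (trivializationAt F V x).linearMapAt ℝ e.proj e.2) e := by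
    have h := ((Trivialization.contMDiffAt_iff (IB := 𝓘(ℝ, EB)) (n := ∞)
      (e := trivializationAt F V x) (f := id) ((trivializationAt F V x).mem_source.2 he)).1
        contMDiffAt_id).2
    refine h.congr_of_eventuallyEq ?_
    filter_upwards [(isOpen_trivDomain x).mem_nhds he] with e' he'
    rw [Trivialization.linearMapAt_apply, if_pos (show e'.proj ∈ _ from he')]
    rfl
  have hφ : ContMDiffAt (𝓘(ℝ, EB).prod 𝓘(ℝ, F)) 𝓘(ℝ, EB) ∞
      (fun e' : TotalSpace F V => extChartAt 𝓘(ℝ, EB) e.proj e'.proj) e :=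
    ContMDiffAt.comp e contMDiffAt_extChartAt contMDiff_bundle_proj.contMDiffAt
  have hopen : IsOpen (chartDomain EB F V x e.proj ×ˢ (Set.univ : Set F)) :=
    (isOpen_chartDomain x e.proj).prod isOpen_univ
  have hK := (contDiffOn_radialIntegral ha x e.proj q i).contDiffAt (hopen.mem_nhds
    (show (extChartAt 𝓘(ℝ, EB) e.proj e.proj,
      (trivializationAt F V x).linearMapAt ℝ e.proj e.2) ∈ _ from
        ⟨mem_chartDomain (mem_extChartAt_source e.proj) he, Set.mem_univ _⟩))
  refine (hK.contMDiffAt.comp e (hφ.prodMk_space hT)).congr_of_eventuallyEq ?_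
  filter_upwards [(FiberBundle.continuous_proj F V).continuousAt.eventually
    (extChartAt_source_mem_nhds (I := 𝓘(ℝ, EB)) e.proj)] with e' he'
  simp only [Function.comp_apply]
  rw [(extChartAt 𝓘(ℝ, EB) e.proj).left_inv he']

variable {G : BFVAlg EB F V →ₗ[ℝ] BFVAlg EB F V →ₗ[ℝ] BFVAlg EB F V} {τ : BFVAlg EB F V}

theorem IsPairing.tautological (hG : IsPairing G) (hτ : ∀ e : TotalSpace F V, evalAt e τ = ghost e.2)
    (a : BFVAlg EB F V) (e : TotalSpace F V) :
    evalAt e (G τ a) = contractVector e.2 (evalAt e a) := by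
  rw [hG, hτ, pairingBracket_ghost]

namespace TrivCover

variable (C : TrivCover EB F V)

/-- The local primitive around `x`, cut off. -/
def cutoffPrimitive (q : ℕ) (a : BFVAlg EB F V) (x : S) : BFVAlg EB F V :=
  mkSection (fun e => C.η x e.proj • ofTriv x (localPrimitive x q a.1) e)
    (isSmooth_smul_ofTriv (C.η_smooth x) (C.η_supp x) fun _ he =>
      weakSmoothAt_localPrimitive a.2 x q he)

theorem localPrimitive_mem {a : BFVAlg EB F V} {p q : ℕ} (ha : a ∈ bfvBideg EB F V p q) {x : S}
    {e : TotalSpace F V} (he : e ∈ trivDomain F V x) :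
    localPrimitive x q a.1 e ∈ bideg F p (q + 1) :=
  radialPrimitive_mem (contDiff_fibreSlice a.2 he) (fun _ => ghostMap_mem_bideg _ _ (ha _)) _

theorem cutoffPrimitive_mem {a : BFVAlg EB F V} {p q : ℕ} (ha : a ∈ bfvBideg EB F V p q) (x : S) :
    C.cutoffPrimitive q a x ∈ bfvBideg EB F V p (q + 1) := by
  intro e
  change evalAt e (C.cutoffPrimitive q a x) ∈ _
  rw [cutoffPrimitive, evalAt_mkSection]
  by_cases he : e ∈ trivDomain F V x
  · exact Submodule.smul_mem _ _ (ghostMap_mem_bideg _ _ (localPrimitive_mem ha he))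
  · rw [C.η_eq_zero he, zero_smul]
    exact Submodule.zero_mem _

theorem contractVector_cutoffPrimitive {a : BFVAlg EB F V} {p q : ℕ} (hq : 0 < q)
    (ha : a ∈ bfvBideg EB F V p q)
    (hc : ∀ e : TotalSpace F V, contractVector e.2 (evalAt e a) = 0) (x : S)
    (e : TotalSpace F V) :
    contractVector e.2 (evalAt e (C.cutoffPrimitive q a x)) = C.η x e.proj • evalAt e a := by
  rw [cutoffPrimitive, evalAt_mkSection, map_smul]
  by_cases he : e ∈ trivDomain F V x
  · rw [contractVector_ofTriv, ofTriv, localPrimitive,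
      contractVector_radialPrimitive (contDiff_fibreSlice a.2 he) hq
        (fun _ => ghostMap_mem_bideg _ _ (ha _)) (contractVector_fibreSlice hc e.proj),
      fibreSlice_linearMapAt _ he]
    exact congrArg _ (ofTriv_inTriv a.1 he)
  · rw [C.η_eq_zero he, zero_smul, zero_smul]

theorem koszulExact (C : TrivCover EB F V) (hG : IsPairing G)
    (hτ : ∀ e : TotalSpace F V, evalAt e τ = ghost e.2) :
    KoszulExact (bfvWeight EB F V) G τ := by
  intro j hj θ hθ hθW hcyc
  rcases mem_bfvBideg_of_homogeneous hθ hθW with rfl | ⟨p, q, hpq, rfl, ha⟩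
  · exact ⟨0, Submodule.zero_mem _, Submodule.zero_mem _, map_zero _⟩
  have hc : ∀ e : TotalSpace F V, contractVector e.2 (evalAt e θ) = 0 := fun e => by
    rw [← hG.tautological hτ, hcyc, map_zero]
  have hmem : C.glueSections (C.cutoffPrimitive q θ) ∈ bfvBideg EB F V p (q + 1) := fun e =>
    Submodule.sum_mem _ fun i _ => Submodule.smul_mem _ _ (C.cutoffPrimitive_mem ha i e)
  refine ⟨C.glueSections (C.cutoffPrimitive q θ), ?_, ?_, section_ext fun e => ?_⟩
  · have h := bfvBideg_le_deg _ _ hmem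
    rwa [show (p : ℤ) - (q + 1 : ℕ) = 0 by push_cast; omega] at h
  · have h := bfvBideg_le_weight _ _ hmem
    rwa [show (p : ℤ) + (q + 1 : ℕ) = p + q + 1 by push_cast; omega] at h
  · rw [hG.tautological hτ, evalAt_glueSections, map_sum]
    simp only [map_smul, C.contractVector_cutoffPrimitive (by omega) ha hc]
    exact C.sum_smul_eq fun i => by rw [smul_smul, C.ρ_mul_η]

end TrivCover

end Koszul

/-! ### Charges -/

section Charge

variable {EB : Type*} [NormedAddCommGroup EB] [NormedSpace ℝ EB]
  {S : Type*} [TopologicalSpace S] [ChartedSpace EB S]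
  {F : Type*} [NormedAddCommGroup F] [NormedSpace ℝ F] [FiniteDimensional ℝ F]
  {V : S → Type*} [TopologicalSpace (TotalSpace F V)]
  [∀ x, AddCommGroup (V x)] [∀ x, Module ℝ (V x)] [∀ x, TopologicalSpace (V x)]
  [FiberBundle F V] [VectorBundle ℝ F V]
  {B : GradedPoissonBracket (bfvDeg EB F V)} {Ω τ : BFVAlg EB F V}

theorem ghost_mem_weight {W : Type*} [AddCommGroup W] [Module ℝ W] (v : W) :
    ghost v ∈ gradedPart W 1 1 1 := by
  simpa using bideg_le_gradedPart 1 1 1 0 (ghost_mem_bideg v)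

theorem IsBFVCharge.gradedProj_sub_ghost (hΩ : IsBFVCharge B Ω) {n : ℤ} (hn : n < 3)
    (e : TotalSpace F V) : gradedProj 1 1 n (evalAt e Ω) = gradedProj 1 1 n (ghost e.2) := by
  rw [← sub_eq_zero, ← map_sub]
  exact gradedProj_higher (by push_cast; omega) (hΩ.lowest e)

theorem IsBFVCharge.evalAt_proj_one (hΩ : IsBFVCharge B Ω) (e : TotalSpace F V) :
    evalAt e ((bfvWeight EB F V).proj 1 Ω) = ghost e.2 := by
  rw [evalAt_proj, hΩ.gradedProj_sub_ghost (by norm_num), gradedProj_of_mem (ghost_mem_weight _)]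

theorem IsBFVCharge.sub_tautological_mem (hΩ : IsBFVCharge B Ω)
    (hτ : ∀ e : TotalSpace F V, evalAt e τ = ghost e.2) :
    Ω - τ ∈ (bfvWeight EB F V).F 2 := fun n hn => section_ext fun e => by
  rw [evalAt_proj, map_sub, map_sub, hτ, hΩ.gradedProj_sub_ghost (by omega), sub_self, map_zero]

end Charge

end BFV

end

theorem mainTheorem1
    {EB : Type*} [NormedAddCommGroup EB] [NormedSpace ℝ EB] [FiniteDimensional ℝ EB]
    {S : Type*} [TopologicalSpace S] [T2Space S] [SigmaCompactSpace S]
    [ChartedSpace EB S] [IsManifold 𝓘(ℝ, EB) ∞ S]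
    {F : Type*} [NormedAddCommGroup F] [NormedSpace ℝ F] [FiniteDimensional ℝ F]
    {V : S → Type*} [TopologicalSpace (TotalSpace F V)]
    [∀ x, AddCommGroup (V x)] [∀ x, Module ℝ (V x)] [∀ x, TopologicalSpace (V x)]
    [∀ x, IsTopologicalAddGroup (V x)] [∀ x, ContinuousSMul ℝ (V x)]
    [FiberBundle F V] [VectorBundle ℝ F V] [ContMDiffVectorBundle ∞ F V 𝓘(ℝ, EB)]
    (P : BFV.PoissonBivector (𝓘(ℝ, EB).prod 𝓘(ℝ, F)) (TotalSpace F V))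
    (hP : BFV.IsCoisotropic F V P)
    (cov₀ cov₁ : CovariantDerivative 𝓘(ℝ, EB) F V)
    (hcov₀ : CovariantDerivative.ContMDiffCovariantDerivative cov₀ ∞)
    (hcov₁ : CovariantDerivative.ContMDiffCovariantDerivative cov₁ ∞)
    (B₀ B₁ : BFV.GradedPoissonBracket (BFV.bfvDeg EB F V))
    (hB₀ : BFV.IsBFVBracket cov₀ P B₀) (hB₁ : BFV.IsBFVBracket cov₁ P B₁)
    (Ω₀ Ω₁ : BFV.BFVAlg EB F V)
    (hΩ₀ : BFV.IsBFVCharge B₀ Ω₀) (hΩ₁ : BFV.IsBFVCharge B₁ Ω₁) :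
    Nonempty (BFV.DGPoissonIso (BFV.bfvComplex B₀ Ω₀ hΩ₀) (BFV.bfvComplex B₁ Ω₁ hΩ₁)) := by
  obtain ⟨C⟩ := BFV.exists_trivCover EB F V
  have hG := hB₀.isPairing_lead
  have hτ := hΩ₀.evalAt_proj_one
  obtain ⟨ψ, hdeg, hbr, hψ⟩ := (C.frameCover hG).exists_algEquiv_of_homogeneous
    hB₀.isFibreBracket B₀ B₁
    (fun _ _ _ _ _ _ hk hn hl hm => hB₀.sub_pairing_mem hG hk hn hl hm)
    (fun _ _ _ _ _ _ hk hn hl hm => hB₁.sub_pairing_mem hG hk hn hl hm)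
    (fun _ hf _ hg => hB₀.sub_mem hB₁ hf hg)
    ((BFV.bfvWeight EB F V).proj_deg 1 hΩ₀.mem) ((BFV.bfvWeight EB F V).proj_mem 1 Ω₀)
    (C.koszulExact hG hτ) Ω₀ Ω₁ hΩ₀.mem hΩ₁.mem hΩ₀.mc hΩ₁.mc
    (hΩ₀.sub_tautological_mem hτ) (hΩ₁.sub_tautological_mem hτ)
  exact ⟨{
    toAlgEquiv := ψ
    map_mem_iff := hdeg
    map_br := hbr
    map_d := fun a => by
      change ψ (B₀.br Ω₀ a) = B₁.br Ω₁ (ψ a)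
      rw [hbr, hψ] }⟩
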